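/- **Conventions.** For $t\in\mathbb C$ let $G(t)$ be the set of $\mathbf a\in \mathrm{SL}(2,\mathbb C)\setminus\{\pm\mathbf e\}$ with $\mathrm{tr}(\mathbf a)=t$, where $\mathbf e$ is the identity matrix, and let $\mathbb B_t=\mathbb C\setminus\{2,t^2-2\}$. Put $$f_t(r_1,r_2,r_3;r)=r^2+t(t^2-r_1-r_2-r_3)r+t^2(3-r_1-r_2-r_3)+r_1^2+r_2^2+r_3^2+r_1r_2r_3-4 .$$ For a knot $K$ with group $\pi(K)$ let $\mathcal X(K)$ be the set of characters $\chi_\rho=\mathrm{tr}\circ\rho$ of all representations $\rho:\pi(K)\to\mathrm{SL}(2,\mathbb C)$, and $\mathcal X^{\rm irr}(K)$ the subset of characters of irreducible $\rho$ (those whose image has no common eigenvector), both with the Zariski topology. A *high-dimensional component* (HDC) is an irreducible component of dimension $>1$. For four-ended tangles, $S+T$ is the horizontal composite ($S$ to the left of $T$), $S\ast T$ the vertical composite ($S$ above $T$), and $D(T)$ is the closure joining the ends nw, sw of $T$ to each other, and ne, se to each other. $[1]$ is the crossing whose over-strand joins nw and se, $[-1]$ the one whose over-strand joins ne and sw; $[3]$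 is the horizontal composite of three copies of $[1]$, and $[1/3]$, $[-1/3]$ are the vertical composites of three copies of $[1]$, $[-1]$. Let $$Q_1=D([3]\ast[3]\ast([-1/3]+[-1/3])),\qquad Q_2=D([3]\ast[3]\ast([-1/3]+[1/3])),$$ and write these as $D(T_1\ast T_2\ast(T_3+T_4))$. The group $\pi(K)$ is given by its Wirtinger presentation: a generator for each directed arc, reversing an arc inverts the generator, and if an under-strand enters a crossing as $\mathsf b$ and leaves it as $\mathsf c$, and $\mathsf a$ is the over-strand directed from left to right as seen along $\mathsf b$, then $\mathsf c=\mathsf a\mathsf b\mathsf a^{-1}$. The longitude paired with the meridian $\mathfrak m$ given by a directed arc is $\mathfrak l=\mathfrak m^{w}\mathfrak z_1\cdots\mathfrak z_n$, where $w$ is the writhe of the diagram (a crossing counts $+1$ if the over-strand passes from left to right as seen along the under-strand, and $-1$ otherwise) and $\mathfrak z_k$ is the generator of the over-strand at the $k$-th under-crossing met when walking once around the knot from that arc, directed from right to left as seen by the walker. For an end $e$ of $T_i$, the arc through it is directed outward from $T_i$ and denoted $T_i^{e}$. **Claim for $Q_1$.** The diagram is a knot diagram with writhe $12$. For every $t$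 and all $\mathbf x,\mathbf y,\mathbf z\in G(t)$ with $\mathrm{tr}(\mathbf x\mathbf y)=\mathrm{tr}(\mathbf x\mathbf z)=1$ there is a unique representation $\rho$ of $Q_1$ with $$\rho(T_1^{\rm nw})=\rho(T_1^{\rm ne})^{-1}=\rho(T_2^{\rm se})=\rho(T_2^{\rm sw})^{-1}=\mathbf x,\quad \rho(T_1^{\rm sw})=\rho(T_1^{\rm se})^{-1}=\mathbf y,\quad \rho(T_3^{\rm ne})=\rho(T_3^{\rm se})^{-1}=\mathbf z,$$ and $\rho(\mathfrak l)=\rho(\mathfrak m)^{24}$ for every directed arc with its meridian $\mathfrak m$ and longitude $\mathfrak l$. There is an irreducible component $\mathcal C$ of $\mathcal X(Q_1)$ of dimension $>1$ such that 1. $\mathcal C\cap\mathcal X^{\rm irr}(Q_1)$ is an HDC of $\mathcal X^{\rm irr}(Q_1)$, and it consists of the characters of the irreducible ones among these representations; 2. with $t=\mathrm{tr}(\mathbf x)$, $t_{23}=\mathrm{tr}(\mathbf y\mathbf z)$, $t_{123}=\mathrm{tr}(\mathbf x\mathbf y\mathbf z)$, that is, $t=\chi(T_1^{\rm nw})$,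 $t_{23}=\chi(T_1^{\rm sw}T_3^{\rm ne})$, $t_{123}=\chi(T_1^{\rm nw}T_1^{\rm sw}T_3^{\rm ne})$, the map $\chi\mapsto(t,t_{23},t_{123})$ is an isomorphism of algebraic sets from $\mathcal C$ onto the hypersurface $\{(t,t_{23},t_{123})\in\mathbb C^3: f_t(1,1,t_{23};t_{123})=0\}$, and it restricts to an isomorphism from $\mathcal C\cap\mathcal X^{\rm irr}(Q_1)$ onto this hypersurface without the two points $(\pm\sqrt3,1,0)$; 3. $\rho(\mathfrak l)=\rho(\mathfrak m)^{24}$ for every irreducible $\rho$ with $\chi_\rho\in\mathcal C$ and every directed arc. **Claim for $Q_2$.** The diagram is a knot diagram with writhe $6$. For all $t$, all $\mathbf x,\mathbf y,\mathbf z\in G(t)$ with $\mathrm{tr}(\mathbf x\mathbf y)=\mathrm{tr}(\mathbf y\mathbf z)=1$ and $t_{13}:=\mathrm{tr}(\mathbf x\mathbf z)\in\mathbb B_t$, and all $s\in\mathbb B_t$ with $(s+2-t^2)(s-1)^2=t_{13}-t^2+2$, there is a unique representation $\rho$ of $Q_2$ with $$\rho(T_1^{\rm nw})=\rho(T_1^{\rm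 ne})^{-1}=\mathbf x,\quad \rho(T_1^{\rm sw})=\rho(T_1^{\rm se})^{-1}=\mathbf y,\quad \rho(T_2^{\rm se})=\rho(T_2^{\rm sw})^{-1}=\mathbf z,\quad \mathrm{tr}(\mathbf z\mathbf v)=s,\ \text{ where } \mathbf v=\rho(T_3^{\rm ne}).$$ There is an HDC $\mathcal C$ of $\mathcal X^{\rm irr}(Q_2)$ such that 1. the set $\mathcal V$ of characters of irreducible representations $\rho$ whose values on these arcs are of the form $\mathbf x,\mathbf y,\mathbf z,\mathbf v$ as displayed, with $\mathrm{tr}(\mathbf x\mathbf y)=\mathrm{tr}(\mathbf y\mathbf z)=1$ and $\mathrm{tr}(\mathbf x\mathbf z),\mathrm{tr}(\mathbf z\mathbf v)\in\mathbb B_t$, $t=\mathrm{tr}(\mathbf x)$, is a Zariski open subset of $\mathcal C$; 2. the map $\chi_\rho\mapsto(t,t_{13},t_{123},s)=(\mathrm{tr}\,\mathbf x,\mathrm{tr}(\mathbf x\mathbf z),\mathrm{tr}(\mathbf x\mathbf y\mathbf z),\mathrm{tr}(\mathbf z\mathbf v))$ is an isomorphism of quasi-affine algebraic sets from $\mathcal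 V$ onto $$\{(t,t_{13},t_{123},s)\in\mathbb C^4: f_t(1,1,t_{13};t_{123})=0,\ (s+2-t^2)(s-1)^2=t_{13}-t^2+2,\ t_{13},s\ne 2,t^2-2\};$$ 3. $\rho(\mathfrak l)=\rho(\mathfrak m)^{12}$ for every irreducible $\rho$ with $\chi_\rho\in\mathcal C$ and every directed arc. -/

import Mathlib

open scoped MatrixGroups

namespace HDC

/-! ### Affine algebraic sets over `ℂ` -/

/-- The set of points of the affine space over `ℂ` with coordinates indexed by `σ`. -/
def Aff (σ : Type*) : Type _ := σ → ℂ

/-- The common zeros of a set of polynomials. -/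
def zeros {σ : Type*} (S : Set (MvPolynomial σ ℂ)) : Set (Aff σ) :=
  {x | ∀ p ∈ S, MvPolynomial.eval x p = 0}

/-- The Zariski topology: the closed sets are the zero sets of families of polynomials. -/
instance zariskiTopology (σ : Type*) : TopologicalSpace (Aff σ) :=
  TopologicalSpace.ofClosed {Z | ∃ S, Z = zeros S}
    ⟨{1}, by ext x; simp [zeros]⟩
    (by
      intro A hA
      have hA' : ∀ Z ∈ A, ∃ S : Set (MvPolynomial σ ℂ), Z = zeros S := fun Z hZ => hA hZ
      choose! S hS using hA'
      refine ⟨⋃ Z ∈ A, S Z, ?_⟩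
      ext x
      simp only [Set.mem_sInter, zeros, Set.mem_iUnion, Set.mem_ofPred_eq]
      constructor
      · rintro h p ⟨Z, hZ, hp⟩
        have := h Z hZ
        rw [hS Z hZ] at this
        exact this p hp
      · intro h Z hZ
        rw [hS Z hZ]
        exact fun p hp => h p ⟨Z, hZ, hp⟩)
    (by
      rintro _ ⟨S, rfl⟩ _ ⟨T, rfl⟩
      refine ⟨{r | ∃ p ∈ S, ∃ q ∈ T, r = p * q}, ?_⟩
      ext x
      simp only [zeros, Set.mem_union, Set.mem_ofPred_eq]
      constructor
      · rintro (h | h) _ ⟨p, hp, q, hq, rfl⟩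
        · simp [h p hp]
        · simp [h q hq]
      · intro h
        by_contra hcon
        push Not at hcon
        obtain ⟨⟨p, hp, hp0⟩, ⟨q, hq, hq0⟩⟩ := hcon
        have := h _ ⟨p, hp, q, hq, rfl⟩
        rw [map_mul] at this
        exact (mul_ne_zero hp0 hq0) this)

/-- `C` is an irreducible component of `X` (with the Zariski topology induced on `X`). -/
def IsComponent {σ : Type*} (C X : Set (Aff σ)) : Prop :=
  C ⊆ X ∧ ((↑) ⁻¹' C : Set X) ∈ irreducibleComponents X

/-- A high-dimensional component of `X`: an irreducible component of dimension greater than `1`. -/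
def IsHighDimComponent {σ : Type*} (C X : Set (Aff σ)) : Prop :=
  IsComponent C X ∧ 1 < topologicalKrullDim C

/-- `V` is a Zariski open subset of `C`. -/
def IsZariskiOpenIn {σ : Type*} (V C : Set (Aff σ)) : Prop :=
  ∃ U : Set (Aff σ), IsOpen U ∧ V = C ∩ U

/-- `f` is a regular function on `Y`: near each point of `Y` it is a quotient of two
polynomials. -/
def IsRegularOn {σ : Type*} (Y : Set (Aff σ)) (f : Aff σ → ℂ) : Prop :=
  ∀ y ∈ Y, ∃ p q : MvPolynomial σ ℂ, MvPolynomial.eval y q ≠ 0 ∧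
    ∀ y' ∈ Y, MvPolynomial.eval y' q ≠ 0 →
      f y' = MvPolynomial.eval y' p / MvPolynomial.eval y' q

/-- `f` is a regular map on `Y`: all its coordinates are regular functions. -/
def IsRegularMapOn {σ τ : Type*} (Y : Set (Aff σ)) (f : Aff σ → Aff τ) : Prop :=
  ∀ j, IsRegularOn Y (fun y => f y j)

/-- `f` restricts to an isomorphism of (quasi-affine) algebraic sets from `Y` onto `Z`. -/
def IsIsomorphismOn {σ τ : Type*} (f : Aff σ → Aff τ) (Y : Set (Aff σ)) (Z : Set (Aff τ)) :
    Prop :=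
  IsRegularMapOn Y f ∧ Set.MapsTo f Y Z ∧
    ∃ g : Aff τ → Aff σ, IsRegularMapOn Z g ∧ Set.MapsTo g Z Y ∧
      Set.LeftInvOn g f Y ∧ Set.RightInvOn g f Z

/-! ### Representations in `SL(2,ℂ)` and characters -/

/-- The trace of an element of `SL(2,ℂ)`. -/
noncomputable def tr (a : SL(2, ℂ)) : ℂ := Matrix.trace (a : Matrix (Fin 2) (Fin 2) ℂ)

/-- The elements of `SL(2,ℂ)` of trace `t` other than `±1`. -/
def Gset (t : ℂ) : Set SL(2, ℂ) := {a | a ≠ 1 ∧ a ≠ -1 ∧ tr a = t}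

/-- `𝔹_t = ℂ ∖ {2, t² - 2}`. -/
def Bset (t : ℂ) : Set ℂ := {r | r ≠ 2 ∧ r ≠ t ^ 2 - 2}

/-- A representation is irreducible if its image has no common eigenvector. -/
def IsIrrep {Γ : Type*} [Group Γ] (ρ : Γ →* SL(2, ℂ)) : Prop :=
  ¬ ∃ v : Fin 2 → ℂ, v ≠ 0 ∧
    ∀ g, ∃ c : ℂ, Matrix.mulVec (ρ g : Matrix (Fin 2) (Fin 2) ℂ) v = c • v

/-- The character of a representation of `Γ`, as a point of the affine space with one coordinate
for each element of `Γ`. -/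
noncomputable def character {Γ : Type*} [Group Γ] (ρ : Γ →* SL(2, ℂ)) : Aff Γ :=
  fun g => tr (ρ g)

/-- The character variety. -/
def charVariety (Γ : Type*) [Group Γ] : Set (Aff Γ) := {χ | ∃ ρ, χ = character ρ}

/-- The irreducible character variety. -/
def irrCharVariety (Γ : Type*) [Group Γ] : Set (Aff Γ) := {χ | ∃ ρ, IsIrrep ρ ∧ χ = character ρ}

/-- The polynomial `f_t(r₁,r₂,r₃;r)`. -/
def fpoly (t r₁ r₂ r₃ r : ℂ) : ℂ :=
  r ^ 2 + t * (t ^ 2 - r₁ - r₂ - r₃) * r + t ^ 2 * (3 - r₁ - r₂ - r₃)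
    + r₁ ^ 2 + r₂ ^ 2 + r₃ ^ 2 + r₁ * r₂ * r₃ - 4

/-! ### Tangle diagrams and knot diagrams -/

/-- The four corners of a crossing; also the four ends of a tangle. -/
inductive Corner
  | nw | ne | se | sw
  deriving DecidableEq

namespace Corner

/-- The opposite corner. -/
def opp : Corner → Corner
  | nw => se | ne => sw | se => nw | sw => ne

/-- The next corner in clockwise order. -/
def cw : Corner → Corner
  | nw => ne | ne => se | se => sw | sw => nw

/-- The next corner in counterclockwise order. -/
def ccw : Corner → Corner
  | nw => sw | sw => se | se => ne | ne => nw

end Corner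

/-- Diagrams of four-ended tangles built from single crossings. `crossing true` is `[1]`, whose
over-strand joins the corners `nw`, `se`; `crossing false` is `[-1]`, whose over-strand joins `ne`,
`sw`. `hcomp S T` is `S + T` (`S` to the left of `T`), `vcomp S T` is `S ∗ T` (`S` above `T`). -/
inductive Tangle
  | crossing (sgn : Bool)
  | hcomp (S T : Tangle)
  | vcomp (S T : Tangle)

namespace Tangle

/-- The crossings of a tangle diagram. -/
def Crossing : Tangle → Type
  | crossing _ => Unit
  | hcomp S T => S.Crossing ⊕ T.Crossing
  | vcomp S T => S.Crossing ⊕ T.Crossing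

/-- Equality of crossings is decidable. -/
instance instDecEqCrossing : (T : Tangle) → DecidableEq T.Crossing
  | crossing _ => inferInstanceAs (DecidableEq Unit)
  | hcomp S T =>
      letI := instDecEqCrossing S
      letI := instDecEqCrossing T
      inferInstanceAs (DecidableEq (S.Crossing ⊕ T.Crossing))
  | vcomp S T =>
      letI := instDecEqCrossing S
      letI := instDecEqCrossing T
      inferInstanceAs (DecidableEq (S.Crossing ⊕ T.Crossing))

/-- The number of crossings. -/
def size : Tangle → ℕ
  | crossing _ => 1
  | hcomp S T => S.size + T.size
  | vcomp S T => S.size + T.size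

/-- Whether a given crossing is a copy of `[1]` (`true`) or of `[-1]` (`false`). -/
def sgn : (T : Tangle) → T.Crossing → Bool
  | crossing b, _ => b
  | hcomp S _, .inl c => S.sgn c
  | hcomp _ T, .inr c => T.sgn c
  | vcomp S _, .inl c => S.sgn c
  | vcomp _ T, .inr c => T.sgn c

/-- A half-edge is a pair (crossing, corner). It stands for the piece of the diagram that leaves the
crossing at that corner, directed away from the crossing. -/
abbrev HalfEdge (T : Tangle) : Type := T.Crossing × Corner

/-- Inclusion of the half-edges of `S` into those of a composite of `S` and `T`. -/
def inL {A B : Type} (h : A × Corner) : (A ⊕ B) × Corner := (.inl h.1, h.2)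

/-- Inclusion of the half-edges of `T` into those of a composite of `S` and `T`. -/
def inR {A B : Type} (h : B × Corner) : (A ⊕ B) × Corner := (.inr h.1, h.2)

/-- The half-edge that runs out of the tangle at a given end. -/
def tip : (T : Tangle) → Corner → T.HalfEdge
  | crossing _, k => ((), k)
  | hcomp S _, .nw => inL (S.tip .nw)
  | hcomp S _, .sw => inL (S.tip .sw)
  | hcomp _ T, .ne => inR (T.tip .ne)
  | hcomp _ T, .se => inR (T.tip .se)
  | vcomp S _, .nw => inL (S.tip .nw)
  | vcomp S _, .ne => inL (S.tip .ne)
  | vcomp _ T, .sw => inR (T.tip .sw)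
  | vcomp _ T, .se => inR (T.tip .se)

/-- Where a half-edge leads: to another half-edge (the same edge of the diagram seen from its
other endpoint), or to an end of the tangle. In `S + T` the ends `ne`, `se` of `S` are joined to the
ends `nw`, `sw` of `T`; in `S ∗ T` the ends `sw`, `se` of `S` are joined to the ends `nw`, `ne`
of `T`. -/
def partner : (T : Tangle) → T.HalfEdge → T.HalfEdge ⊕ Corner
  | crossing _, (_, k) => .inr k
  | hcomp S T, (.inl c, k) =>
      match S.partner (c, k) with
      | .inl h => .inl (inL h)
      | .inr .nw => .inr .nw
      | .inr .sw => .inr .sw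
      | .inr .ne => .inl (inR (T.tip .nw))
      | .inr .se => .inl (inR (T.tip .sw))
  | hcomp S T, (.inr c, k) =>
      match T.partner (c, k) with
      | .inl h => .inl (inR h)
      | .inr .nw => .inl (inL (S.tip .ne))
      | .inr .sw => .inl (inL (S.tip .se))
      | .inr .ne => .inr .ne
      | .inr .se => .inr .se
  | vcomp S T, (.inl c, k) =>
      match S.partner (c, k) with
      | .inl h => .inl (inL h)
      | .inr .nw => .inr .nw
      | .inr .ne => .inr .ne
      | .inr .sw => .inl (inR (T.tip .nw))
      | .inr .se => .inl (inR (T.tip .ne))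
  | vcomp S T, (.inr c, k) =>
      match T.partner (c, k) with
      | .inl h => .inl (inR h)
      | .inr .nw => .inl (inL (S.tip .sw))
      | .inr .ne => .inl (inL (S.tip .se))
      | .inr .sw => .inr .sw
      | .inr .se => .inr .se

/-! In the rest of this section `T` stands for the link diagram `D(T)`, the denominator closure: the
ends `nw`, `sw` of `T` are joined to each other, and so are `ne`, `se`. -/

/-- In `D(T)`: the same edge, seen from its other endpoint. -/
def glue (T : Tangle) (h : T.HalfEdge) : T.HalfEdge :=
  match T.partner h with
  | .inl h' => h'
  | .inr .nw => T.tip .sw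
  | .inr .sw => T.tip .nw
  | .inr .ne => T.tip .se
  | .inr .se => T.tip .ne

/-- Whether the strand through a half-edge is the over-strand at its crossing. -/
def isOver (T : Tangle) (h : T.HalfEdge) : Bool :=
  match h.2 with
  | .nw => T.sgn h.1
  | .se => T.sgn h.1
  | .ne => !T.sgn h.1
  | .sw => !T.sgn h.1

/-- Wirtinger relators of `D(T)`. The generators are the half-edges, as directed arcs.
The two half-edges of one edge are inverse to each other, and so are the two halves of an
over-strand. If the under-strand enters a crossing through the corner `k` as `b` and leaves it as
`c`, then `c = a b a⁻¹`, where `a` is the over-strand directed from left to right as seen by someone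
walking along `b`. -/
def relators (T : Tangle) : Set (FreeGroup T.HalfEdge) :=
  {r | ∃ h, r = .of h * .of (T.glue h)} ∪
  {r | ∃ (c : T.Crossing) (k : Corner), T.isOver (c, k) = true ∧
    r = .of (c, k) * .of (c, k.opp)} ∪
  {r | ∃ (c : T.Crossing) (k : Corner), T.isOver (c, k) = false ∧
    r = .of (c, k.opp) *
      (.of (c, k.opp.cw) * (.of (c, k))⁻¹ * (.of (c, k.opp.cw))⁻¹)⁻¹}

/-- The group of the link `D(T)`, by its Wirtinger presentation. -/
abbrev linkGroup (T : Tangle) : Type := PresentedGroup T.relators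

/-- The meridian contributed by a directed arc. -/
def arc (T : Tangle) (h : T.HalfEdge) : T.linkGroup := PresentedGroup.of h

/-- Walking along `D(T)`, starting with the half-edge `h` in its direction. `walk h i` is the
half-edge followed after `i` crossings have been passed. -/
def walk (T : Tangle) (h : T.HalfEdge) : ℕ → T.HalfEdge
  | 0 => h
  | i + 1 => ((T.glue (T.walk h i)).1, (T.glue (T.walk h i)).2.opp)

/-- The crossing and the corner through which it is entered, when a crossing is passed for the
`(i + 1)`-st time. -/
def enter (T : Tangle) (h : T.HalfEdge) (i : ℕ) : T.HalfEdge := T.glue (T.walk h i)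

/-- `D(T)` is a diagram of a knot: a walk runs through every edge. -/
def IsKnot (T : Tangle) : Prop :=
  ∀ h h' : T.HalfEdge, ∃ i, T.walk h i = h' ∨ T.walk h i = T.glue h'

/-- The writhe of the knot diagram `D(T)`: the sum over all crossings of `+1` or `-1`, where the
sign is `+1` exactly when the over-strand passes from left to right as seen from the
under-strand. -/
def writhe (T : Tangle) (h : T.HalfEdge) : ℤ :=
  ∑ i ∈ Finset.range (2 * T.size),
    if T.isOver (T.enter h i) = true then 0
    else if ∃ j ∈ Finset.range (2 * T.size),
        T.enter h j = ((T.enter h i).1, (T.enter h i).2.cw) then 1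
    else -1

/-- The longitude paired with the meridian `𝔪 = arc h`: it is `𝔪 ^ w 𝔷₁ ⋯ 𝔷ₙ`, where `w` is the
writhe and `𝔷ₖ` is the meridian contributed by the over-strand at the `k`-th under-crossing met on a
walk that starts along `h`, directed from right to left as seen by the walker. -/
def longitude (T : Tangle) (h : T.HalfEdge) : T.linkGroup :=
  T.arc h ^ T.writhe h *
    ((List.range (2 * T.size)).map fun i =>
      if T.isOver (T.enter h i) = true then 1
      else T.arc ((T.enter h i).1, (T.enter h i).2.opp.ccw)).prod

end Tangle

open Tangle

/-- The tangle `[3]`. -/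
def three : Tangle := hcomp (crossing true) (hcomp (crossing true) (crossing true))

/-- The tangle `[1/3]`. -/
def third : Tangle := vcomp (crossing true) (vcomp (crossing true) (crossing true))

/-- The tangle `[-1/3]`. -/
def negThird : Tangle := vcomp (crossing false) (vcomp (crossing false) (crossing false))

/-- `Q₁ = D([3] ∗ [3] ∗ ([-1/3] + [-1/3]))`. -/
def Q1 : Tangle := vcomp three (vcomp three (hcomp negThird negThird))

/-- `Q₂ = D([3] ∗ [3] ∗ ([-1/3] + [1/3]))`. -/
def Q2 : Tangle := vcomp three (vcomp three (hcomp negThird third))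

/-! ### The representations of `Q₁` and `Q₂`

`Q₁` and `Q₂` are of the form `D(T₁ ∗ T₂ ∗ (T₃ + T₄))`. The functions below give the meridian of the
arc of `Q₁` or `Q₂` that runs out of the subtangle `T₁`, `T₂` or `T₃` at a given end. -/

def Q1.end1 (k : Corner) : Q1.linkGroup := Q1.arc (inL (three.tip k))
def Q1.end2 (k : Corner) : Q1.linkGroup := Q1.arc (inR (inL (three.tip k)))
def Q1.end3 (k : Corner) : Q1.linkGroup := Q1.arc (inR (inR (inL (negThird.tip k))))
def Q2.end1 (k : Corner) : Q2.linkGroup := Q2.arc (inL (three.tip k))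
def Q2.end2 (k : Corner) : Q2.linkGroup := Q2.arc (inR (inL (three.tip k)))
def Q2.end3 (k : Corner) : Q2.linkGroup := Q2.arc (inR (inR (inL (negThird.tip k))))

/-- `ρ` takes the value `x` on the four arcs `x₁,…,x₄`, `y` on `y₁, y₂` and `z` on `z₁, z₂`. -/
def Q1.HasValues (ρ : Q1.linkGroup →* SL(2, ℂ)) (x y z : SL(2, ℂ)) : Prop :=
  ρ (Q1.end1 .nw) = x ∧ ρ (Q1.end1 .ne) = x⁻¹ ∧ ρ (Q1.end2 .se) = x ∧ ρ (Q1.end2 .sw) = x⁻¹ ∧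
  ρ (Q1.end1 .sw) = y ∧ ρ (Q1.end1 .se) = y⁻¹ ∧
  ρ (Q1.end3 .ne) = z ∧ ρ (Q1.end3 .se) = z⁻¹

/-- `ρ` takes the value `x` on the arcs `x₁, x₂`, `y` on `y₁, y₂`, `z` on `z₁, z₂` and `v` on `v`. -/
def Q2.HasValues (ρ : Q2.linkGroup →* SL(2, ℂ)) (x y z v : SL(2, ℂ)) : Prop :=
  ρ (Q2.end1 .nw) = x ∧ ρ (Q2.end1 .ne) = x⁻¹ ∧
  ρ (Q2.end1 .sw) = y ∧ ρ (Q2.end1 .se) = y⁻¹ ∧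
  ρ (Q2.end2 .se) = z ∧ ρ (Q2.end2 .sw) = z⁻¹ ∧
  ρ (Q2.end3 .ne) = v

/-- The coordinates `(t, t₂₃, t₁₂₃)` of a character of `Q₁`. -/
def Q1.coords (χ : Aff Q1.linkGroup) : Aff (Fin 3) :=
  ![χ (Q1.end1 .nw), χ (Q1.end1 .sw * Q1.end3 .ne),
    χ (Q1.end1 .nw * Q1.end1 .sw * Q1.end3 .ne)]

/-- The coordinates `(t, t₁₃, t₁₂₃, s)` of a character of `Q₂`. -/
def Q2.coords (χ : Aff Q2.linkGroup) : Aff (Fin 4) :=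
  ![χ (Q2.end1 .nw), χ (Q2.end1 .nw * Q2.end2 .se),
    χ (Q2.end1 .nw * Q2.end1 .sw * Q2.end2 .se), χ (Q2.end2 .se * Q2.end3 .ne)]

/-- The hypersurface `f_t(1,1,t₂₃;t₁₂₃) = 0` in the space of `(t, t₂₃, t₁₂₃)`. -/
def Q1.surface : Set (Aff (Fin 3)) := {p | fpoly (p 0) 1 1 (p 1) (p 2) = 0}

/-- The two points `(±√3, 1, 0)`. -/
def Q1.badPoints : Set (Aff (Fin 3)) := {p | p 0 ^ 2 = 3 ∧ p 1 = 1 ∧ p 2 = 0}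

/-- The quasi-affine surface in the space of `(t, t₁₃, t₁₂₃, s)` given by
`f_t(1,1,t₁₃;t₁₂₃) = 0`, `(s+2-t²)(s-1)² = t₁₃-t²+2` and `t₁₃, s ≠ 2, t²-2`. -/
def Q2.surface : Set (Aff (Fin 4)) :=
  {p | fpoly (p 0) 1 1 (p 1) (p 2) = 0 ∧
    (p 3 + 2 - p 0 ^ 2) * (p 3 - 1) ^ 2 = p 1 - p 0 ^ 2 + 2 ∧
    p 1 ∈ Bset (p 0) ∧ p 3 ∈ Bset (p 0)}

/-- The characters of the irreducible representations of `Q₁` that come from triples `(x,y,z)` with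
`tr(xy) = tr(xz) = 1`. -/
def Q1.family : Set (Aff Q1.linkGroup) :=
  {χ | ∃ ρ x y z, IsIrrep ρ ∧ Q1.HasValues ρ x y z ∧ tr (x * y) = 1 ∧ tr (x * z) = 1 ∧
    χ = character ρ}

/-- The characters of the irreducible representations of `Q₂` that come from quadruples `(x,y,z,v)`
with `tr(xy) = tr(yz) = 1` and `tr(xz), tr(zv) ∈ 𝔹_t`, where `t = tr(x)`. -/
def Q2.family : Set (Aff Q2.linkGroup) :=
  {χ | ∃ ρ x y z v, IsIrrep ρ ∧ Q2.HasValues ρ x y z v ∧ tr (x * y) = 1 ∧ tr (y * z) = 1 ∧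
    tr (x * z) ∈ Bset (tr x) ∧ tr (z * v) ∈ Bset (tr x) ∧ χ = character ρ}

end HDC

namespace HDC

/-! Elements a, b of SL(2,ℂ) with equal traces and tr(ab) = 1 satisfy the braid relation aba = bab
(`braid_of_trace`), and (aba)² = -1 is central (`braid_square`). A triple twist sends a pair (a, b)
to (`out₁ a b`, `out₂ a b`), where `out₁ a b` is b conjugated by aba and `out₂ a b` is a conjugated
by ab; under the braid relation these are a and b again. So braid pairs pass through the twists
unchanged: the conditions for closing up the diagram hold identically for Q₁, and for Q₂ they reduce
to the single relation `x * out₂ v⁻¹ z⁻¹ = 1`. Once s = tr(zv) is fixed, this relation is affine in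
v and can be solved (`exists_mul_out₂_eq_one`).

The resulting families are surfaces. Every trace function on them is a polynomial in the stated
coordinates, divided for Q₂ by a power of a nonvanishing denominator (`Q1.exists_eval`,
`Q2.exists_eval`), and every point of the target comes from matrices (`exists_triple`); hence the
coordinates give isomorphisms. The target is a double cover of a plane whose discriminant has a
simple zero along a line, so it is irreducible (`isIrreducible_doubleCover`). A curve in the fiber
t² = 3 gives a chain point, curve, surface, so the dimension exceeds 1.

Each family fills an open part of the character variety. By `mat_out₁` and `mat_out₂`, a twist
changes a pair by multiples of tr(ab) - 1. Tracing the closing relations of an arbitrary coloring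
against test elements therefore yields a homogeneous linear system in these defects, and where its
determinant is nonzero they all vanish (`Q1.eq_of_openVal_ne_zero`,
`Q2.tr_eq_one_of_openVal_ne_zero`). With irreducibility this makes the closure a component
(`isComponent_of_isOpen`). For irreducible representations a relation between values is a closed
condition on the character (`IsIrrep.eq_of_mem_closure`), so the description by values, and with it
the longitude formula, extends to the whole component.

For the longitude, the identity y⁻¹x⁻²y⁻¹ = -x² (`braid_cube`) collapses the product of over-arcs to
a power of the meridian. One starting arc for each direction of travel is enough, because passing a
crossing conjugates meridian and longitude by the same element (`longitude_walk`). -/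

instance instFintypeCorner : Fintype Corner :=
  ⟨{.nw, .ne, .se, .sw}, by intro x; cases x <;> simp⟩

namespace Tangle

instance instFintypeCrossing : (T : Tangle) → Fintype T.Crossing
  | crossing _ => inferInstanceAs (Fintype Unit)
  | hcomp S T =>
      letI := instFintypeCrossing S
      letI := instFintypeCrossing T
      inferInstanceAs (Fintype (S.Crossing ⊕ T.Crossing))
  | vcomp S T =>
      letI := instFintypeCrossing S
      letI := instFintypeCrossing T
      inferInstanceAs (Fintype (S.Crossing ⊕ T.Crossing))

/-! ### Walks, and how the longitude changes along a walk -/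

theorem walk_add (T : Tangle) (h : T.HalfEdge) (i j : ℕ) :
    T.walk h (i + j) = T.walk (T.walk h i) j := by
  induction j with
  | zero => rfl
  | succ j ih => rw [← add_assoc]; simp only [walk, ih]

theorem enter_walk_one (T : Tangle) (h : T.HalfEdge) (i : ℕ) :
    T.enter (T.walk h 1) i = T.enter h (i + 1) := by
  rw [enter, enter, ← walk_add, add_comm]

/-- The factor that the `(i + 1)`-st passage of a crossing contributes to the longitude. -/
def passage (T : Tangle) (h : T.HalfEdge) (i : ℕ) : T.linkGroup :=
  if T.isOver (T.enter h i) = true then 1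
  else T.arc ((T.enter h i).1, (T.enter h i).2.opp.ccw)

theorem longitude_eq (T : Tangle) (h : T.HalfEdge) :
    T.longitude h = T.arc h ^ T.writhe h * ((List.range (2 * T.size)).map (T.passage h)).prod :=
  rfl

theorem arc_mul_glue (T : Tangle) (h : T.HalfEdge) : T.arc h * T.arc (T.glue h) = 1 :=
  PresentedGroup.one_of_mem (Or.inl (Or.inl ⟨h, rfl⟩))

theorem arc_over (T : Tangle) (c : T.Crossing) (k : Corner) (hk : T.isOver (c, k) = true) :
    T.arc (c, k) * T.arc (c, k.opp) = 1 :=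
  PresentedGroup.one_of_mem (Or.inl (Or.inr ⟨c, k, hk, rfl⟩))

theorem arc_under (T : Tangle) (c : T.Crossing) (k : Corner) (hk : T.isOver (c, k) = false) :
    T.arc (c, k.opp) *
      (T.arc (c, k.opp.cw) * (T.arc (c, k))⁻¹ * (T.arc (c, k.opp.cw))⁻¹)⁻¹ = 1 :=
  PresentedGroup.one_of_mem (rels := T.relators) (Or.inr ⟨c, k, hk, rfl⟩)

theorem isOver_opp_ccw (T : Tangle) (c : T.Crossing) (k : Corner) :
    T.isOver (c, k.opp.ccw) = !T.isOver (c, k) := by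
  cases k <;> simp [isOver, Corner.opp, Corner.ccw]

/-- At an under-crossing the Wirtinger relation conjugates the meridian by the over-arc; at an
over-crossing the meridian is unchanged and the factor is 1. The longitude collects exactly these
factors. -/
theorem arc_walk_one (T : Tangle) (h : T.HalfEdge) :
    T.arc (T.walk h 1) = (T.passage h 0)⁻¹ * T.arc h * T.passage h 0 := by
  have hg := T.arc_mul_glue h
  have hw : T.walk h 1 = ((T.glue h).1, (T.glue h).2.opp) := rfl
  have he : T.enter h 0 = T.glue h := rfl
  rw [hw, passage, he]
  generalize T.glue h = e at *
  obtain ⟨c, k⟩ := e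
  have h1 : T.arc h = (T.arc (c, k))⁻¹ := eq_inv_of_mul_eq_one_left hg
  by_cases ho : T.isOver (c, k) = true
  · rw [if_pos ho, h1]
    simpa using (eq_inv_of_mul_eq_one_right (T.arc_over c k ho))
  · rw [if_neg ho, h1]
    have ho' : T.isOver (c, k) = false := by simpa using ho
    have h2 := T.arc_over c k.opp.ccw (by rw [isOver_opp_ccw, ho']; rfl)
    have h3 := eq_of_mul_inv_eq_one (T.arc_under c k ho')
    have h4 : k.opp.ccw.opp = k.opp.cw := by cases k <;> rfl
    rw [h4] at h2
    rw [h3, eq_inv_of_mul_eq_one_right h2, inv_inv]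

/-- Starting one crossing later moves the first factor of the product to its end, which is
conjugation by that factor; the power of the meridian is conjugated in the same way. -/
theorem longitude_walk_one (T : Tangle) (h : T.HalfEdge)
    (hper : T.walk h (2 * T.size) = h) (hw : T.writhe (T.walk h 1) = T.writhe h) :
    T.longitude (T.walk h 1) = (T.passage h 0)⁻¹ * T.longitude h * T.passage h 0 := by
  have hp : ∀ i, T.passage (T.walk h 1) i = T.passage h (i + 1) := fun i => by
    simp only [passage, enter_walk_one]
  have hN : T.passage h (2 * T.size) = T.passage h 0 := by
    have : T.enter h (2 * T.size) = T.enter h 0 := by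
      rw [enter, hper]; rfl
    simp only [passage, this]
  have hl : T.passage h 0 * ((List.range (2 * T.size)).map (T.passage (T.walk h 1))).prod =
      ((List.range (2 * T.size)).map (T.passage h)).prod * T.passage h 0 := by
    rw [← hN, ← List.prod_range_succ, hN, funext hp, List.prod_range_succ']
  rw [longitude_eq, longitude_eq, hw, arc_walk_one]
  have hc : ((T.passage h 0)⁻¹ * T.arc h * T.passage h 0) ^ T.writhe h =
      (T.passage h 0)⁻¹ * T.arc h ^ T.writhe h * T.passage h 0 := by
    simpa using (conj_zpow (i := T.writhe h) (a := (T.passage h 0)⁻¹) (b := T.arc h))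
  rw [hc, mul_assoc _ (T.passage h 0), hl]
  group

/-- An equation `ρ(𝔩) = ρ(𝔪) ^ n` propagates along a walk. -/
theorem longitude_walk {T : Tangle} (hper : ∀ h, T.walk h (2 * T.size) = h) {w : ℤ}
    (hw : ∀ h, T.writhe h = w) {G : Type*} [Group G] (ρ : T.linkGroup →* G) (n : ℕ)
    (h : T.HalfEdge) (hl : ρ (T.longitude h) = ρ (T.arc h) ^ n) (i : ℕ) :
    ρ (T.longitude (T.walk h i)) = ρ (T.arc (T.walk h i)) ^ n := by
  induction i with
  | zero => exact hl
  | succ i ih =>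
    rw [walk_add, longitude_walk_one T _ (hper _) (by rw [hw, hw]), arc_walk_one]
    simp only [map_mul, map_inv, ih]
    simpa using (conj_pow (i := n) (a := (ρ (T.passage (T.walk h i) 0))⁻¹)
      (b := ρ (T.arc (T.walk h i)))).symm

/-- In the applications `a` and `b` represent the two directions of travel. From `h` one completes
the period back to `a` or `b` and continues from there, so that only checks over single half-edges,
not over pairs, remain. -/
theorem isKnot_of_walk {T : Tangle} (N : ℕ) (hper : ∀ h, T.walk h N = h) (a b : T.HalfEdge)
    (hab : ∀ h, ∃ i : Fin N, T.walk a i = h ∨ T.walk b i = h)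
    (ha : ∀ h, ∃ i : Fin N, T.walk a i = h ∨ T.walk a i = T.glue h)
    (hb : ∀ h, ∃ i : Fin N, T.walk b i = h ∨ T.walk b i = T.glue h) : T.IsKnot := by
  intro h h'
  have key : ∀ c (i : Fin N), T.walk c i = h →
      (∃ j : Fin N, T.walk c j = h' ∨ T.walk c j = T.glue h') →
      ∃ i, T.walk h i = h' ∨ T.walk h i = T.glue h' := by
    rintro c i rfl ⟨j, hj⟩
    refine ⟨(N - i) + j, ?_⟩
    rw [← walk_add, ← add_assoc, Nat.add_sub_cancel' i.2.le, walk_add, hper]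
    exact hj
  obtain ⟨i, hi | hi⟩ := hab h
  · exact key a i hi (ha h')
  · exact key b i hi (hb h')

end Tangle

/-! ### Finite verifications on the diagrams of Q₁ and Q₂ -/

open Tangle

theorem Q1.walk_period : ∀ h : Q1.HalfEdge, Q1.walk h (2 * Q1.size) = h := by decide +kernel

theorem Q1.walk_tip :
    ∀ h : Q1.HalfEdge, ∃ i : Fin 24, Q1.walk (Q1.tip .nw) i = h ∨ Q1.walk (Q1.tip .sw) i = h := by
  decide +kernel

theorem Q1.isKnot : Q1.IsKnot :=
  isKnot_of_walk 24 Q1.walk_period _ _ Q1.walk_tip (by decide +kernel) (by decide +kernel)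

theorem Q1.writhe_eq : ∀ h : Q1.HalfEdge, Q1.writhe h = 12 := by decide +kernel

theorem Q2.walk_period : ∀ h : Q2.HalfEdge, Q2.walk h (2 * Q2.size) = h := by decide +kernel

theorem Q2.walk_tip :
    ∀ h : Q2.HalfEdge, ∃ i : Fin 24, Q2.walk (Q2.tip .nw) i = h ∨ Q2.walk (Q2.tip .sw) i = h := by
  decide +kernel

theorem Q2.isKnot : Q2.IsKnot :=
  isKnot_of_walk 24 Q2.walk_period _ _ Q2.walk_tip (by decide +kernel) (by decide +kernel)

theorem Q2.writhe_eq : ∀ h : Q2.HalfEdge, Q2.writhe h = 6 := by decide +kernel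

namespace Tangle

/-! ### Colorings of tangles by elements of a group -/

theorem partner_tip : ∀ (T : Tangle) (k : Corner), T.partner (T.tip k) = .inr k
  | crossing _, _ => rfl
  | hcomp S T, .nw => by simp [tip, inL, partner, partner_tip S]
  | hcomp S T, .sw => by simp [tip, inL, partner, partner_tip S]
  | hcomp S T, .ne => by simp [tip, inR, partner, partner_tip T]
  | hcomp S T, .se => by simp [tip, inR, partner, partner_tip T]
  | vcomp S T, .nw => by simp [tip, inL, partner, partner_tip S]
  | vcomp S T, .ne => by simp [tip, inL, partner, partner_tip S]
  | vcomp S T, .sw => by simp [tip, inR, partner, partner_tip T]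
  | vcomp S T, .se => by simp [tip, inR, partner, partner_tip T]

variable {G : Type*} [Group G]

/-- The Wirtinger relations at the crossings. -/
def CrossingRel (T : Tangle) (f : T.HalfEdge → G) : Prop :=
  ∀ c k, (T.isOver (c, k) = true → f (c, k) * f (c, k.opp) = 1) ∧
    (T.isOver (c, k) = false →
      f (c, k.opp) * (f (c, k.opp.cw) * (f (c, k))⁻¹ * (f (c, k.opp.cw))⁻¹)⁻¹ = 1)

/-- A coloring of a tangle diagram by elements of a group: the Wirtinger relations at the
crossings hold, and the two directions of an arc have inverse values. -/
def IsColoring (T : Tangle) (f : T.HalfEdge → G) : Prop :=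
  (∀ h, f h * Sum.elim f (fun k => (f (T.tip k))⁻¹) (T.partner h) = 1) ∧ T.CrossingRel f

/-- The edge condition at an end `k` only says that the value agrees with the one at `tip k`. At a
joined pair of ends the two joint relations translate it into the condition across the joint, so
gluing adds nothing else. -/
theorem isColoring_hcomp_iff (S T : Tangle) (f : (hcomp S T).HalfEdge → G) :
    IsColoring (hcomp S T) f ↔
      IsColoring S (fun h => f (inL h)) ∧ IsColoring T (fun h => f (inR h)) ∧
      f (inL (S.tip .ne)) * f (inR (T.tip .nw)) = 1 ∧
      f (inL (S.tip .se)) * f (inR (T.tip .sw)) = 1 := by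
  constructor
  · rintro ⟨he, hc⟩
    have h1 : f (inL (S.tip .ne)) * f (inR (T.tip .nw)) = 1 := by
      have := he (inL (S.tip .ne))
      simp only [partner, inL, partner_tip S] at this
      exact this
    have h2 : f (inL (S.tip .se)) * f (inR (T.tip .sw)) = 1 := by
      have := he (inL (S.tip .se))
      simp only [partner, inL, partner_tip S] at this
      exact this
    refine ⟨⟨fun h => ?_, fun c k => hc (.inl c) k⟩, ⟨fun h => ?_, fun c k => hc (.inr c) k⟩, h1, h2⟩
    · have := he (inL h)
      obtain ⟨c, k⟩ := h
      simp only [inL, partner] at this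
      rcases hp : S.partner (c, k) with h' | k'
      · simp only [hp] at this ⊢; exact this
      · cases k' <;> simp only [hp, tip, Sum.elim_inr] at this ⊢
        · exact this
        · rw [← eq_inv_of_mul_eq_one_right h1]; exact this
        · rw [← eq_inv_of_mul_eq_one_right h2]; exact this
        · exact this
    · have := he (inR h)
      obtain ⟨c, k⟩ := h
      simp only [inR, partner] at this
      rcases hp : T.partner (c, k) with h' | k'
      · simp only [hp] at this ⊢; exact this
      · cases k' <;> simp only [hp, tip, Sum.elim_inr] at this ⊢
        · rw [← eq_inv_of_mul_eq_one_left h1]; exact this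
        · exact this
        · exact this
        · rw [← eq_inv_of_mul_eq_one_left h2]; exact this
  · rintro ⟨⟨heS, hcS⟩, ⟨heT, hcT⟩, h1, h2⟩
    refine ⟨?_, ?_⟩
    · rintro ⟨c | c, k⟩
      · have := heS (c, k)
        simp only [partner]
        rcases hp : S.partner (c, k) with h' | k'
        · simp only [hp] at this ⊢; exact this
        · cases k' <;> simp only [hp, tip, Sum.elim_inr] at this ⊢
          · exact this
          · change f (inL (c, k)) * f (inR (T.tip .nw)) = 1
            rw [eq_inv_of_mul_eq_one_right h1]; exact this
          · change f (inL (c, k)) * f (inR (T.tip .sw)) = 1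
            rw [eq_inv_of_mul_eq_one_right h2]; exact this
          · exact this
      · have := heT (c, k)
        simp only [partner]
        rcases hp : T.partner (c, k) with h' | k'
        · simp only [hp] at this ⊢; exact this
        · cases k' <;> simp only [hp, tip, Sum.elim_inr] at this ⊢
          · change f (inR (c, k)) * f (inL (S.tip .ne)) = 1
            rw [eq_inv_of_mul_eq_one_left h1]; exact this
          · exact this
          · exact this
          · change f (inR (c, k)) * f (inL (S.tip .se)) = 1
            rw [eq_inv_of_mul_eq_one_left h2]; exact this
    · rintro (c | c) k
      · exact hcS c k
      · exact hcT c k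

theorem isColoring_vcomp_iff (S T : Tangle) (f : (vcomp S T).HalfEdge → G) :
    IsColoring (vcomp S T) f ↔
      IsColoring S (fun h => f (inL h)) ∧ IsColoring T (fun h => f (inR h)) ∧
      f (inL (S.tip .sw)) * f (inR (T.tip .nw)) = 1 ∧
      f (inL (S.tip .se)) * f (inR (T.tip .ne)) = 1 := by
  constructor
  · rintro ⟨he, hc⟩
    have h1 : f (inL (S.tip .sw)) * f (inR (T.tip .nw)) = 1 := by
      have := he (inL (S.tip .sw))
      simp only [partner, inL, partner_tip S] at this
      exact this
    have h2 : f (inL (S.tip .se)) * f (inR (T.tip .ne)) = 1 := by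
      have := he (inL (S.tip .se))
      simp only [partner, inL, partner_tip S] at this
      exact this
    refine ⟨⟨fun h => ?_, fun c k => hc (.inl c) k⟩, ⟨fun h => ?_, fun c k => hc (.inr c) k⟩, h1, h2⟩
    · have := he (inL h)
      obtain ⟨c, k⟩ := h
      simp only [inL, partner] at this
      rcases hp : S.partner (c, k) with h' | k'
      · simp only [hp] at this ⊢; exact this
      · cases k' <;> simp only [hp, tip, Sum.elim_inr] at this ⊢
        · exact this
        · exact this
        · rw [← eq_inv_of_mul_eq_one_right h2]; exact this
        · rw [← eq_inv_of_mul_eq_one_right h1]; exact this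
    · have := he (inR h)
      obtain ⟨c, k⟩ := h
      simp only [inR, partner] at this
      rcases hp : T.partner (c, k) with h' | k'
      · simp only [hp] at this ⊢; exact this
      · cases k' <;> simp only [hp, tip, Sum.elim_inr] at this ⊢
        · rw [← eq_inv_of_mul_eq_one_left h1]; exact this
        · rw [← eq_inv_of_mul_eq_one_left h2]; exact this
        · exact this
        · exact this
  · rintro ⟨⟨heS, hcS⟩, ⟨heT, hcT⟩, h1, h2⟩
    refine ⟨?_, ?_⟩
    · rintro ⟨c | c, k⟩
      · have := heS (c, k)
        simp only [partner]
        rcases hp : S.partner (c, k) with h' | k'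
        · simp only [hp] at this ⊢; exact this
        · cases k' <;> simp only [hp, tip, Sum.elim_inr] at this ⊢
          · exact this
          · exact this
          · change f (inL (c, k)) * f (inR (T.tip .ne)) = 1
            rw [eq_inv_of_mul_eq_one_right h2]; exact this
          · change f (inL (c, k)) * f (inR (T.tip .nw)) = 1
            rw [eq_inv_of_mul_eq_one_right h1]; exact this
      · have := heT (c, k)
        simp only [partner]
        rcases hp : T.partner (c, k) with h' | k'
        · simp only [hp] at this ⊢; exact this
        · cases k' <;> simp only [hp, tip, Sum.elim_inr] at this ⊢
          · change f (inR (c, k)) * f (inL (S.tip .sw)) = 1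
            rw [eq_inv_of_mul_eq_one_left h1]; exact this
          · change f (inR (c, k)) * f (inL (S.tip .se)) = 1
            rw [eq_inv_of_mul_eq_one_left h2]; exact this
          · exact this
          · exact this
    · rintro (c | c) k
      · exact hcS c k
      · exact hcT c k

/-- A coloring of the link diagram `D(T)`. -/
def IsLinkColoring (T : Tangle) (f : T.HalfEdge → G) : Prop :=
  IsColoring T f ∧ f (T.tip .nw) * f (T.tip .sw) = 1 ∧ f (T.tip .ne) * f (T.tip .se) = 1

theorem isLinkColoring_arc (T : Tangle) : T.IsLinkColoring T.arc := by
  have h1 : T.arc (T.tip .nw) * T.arc (T.tip .sw) = 1 := by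
    simpa [glue, partner_tip] using T.arc_mul_glue (T.tip .nw)
  have h2 : T.arc (T.tip .ne) * T.arc (T.tip .se) = 1 := by
    simpa [glue, partner_tip] using T.arc_mul_glue (T.tip .ne)
  refine ⟨⟨fun h => ?_, fun c k => ⟨T.arc_over c k, T.arc_under c k⟩⟩, h1, h2⟩
  have := T.arc_mul_glue h
  rw [glue] at this
  rcases hp : T.partner h with h' | k'
  · simpa [hp] using this
  · cases k' <;> simp only [hp, Sum.elim_inr] at this ⊢
    · rw [← eq_inv_of_mul_eq_one_right h1]; exact this
    · rw [← eq_inv_of_mul_eq_one_right h2]; exact this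
    · rw [← eq_inv_of_mul_eq_one_left h2]; exact this
    · rw [← eq_inv_of_mul_eq_one_left h1]; exact this

theorem CrossingRel.map {H : Type*} [Group H] {T : Tangle} {f : T.HalfEdge → G}
    (hf : T.CrossingRel f) (φ : G →* H) : T.CrossingRel (fun h => φ (f h)) := fun c k =>
  ⟨fun h => by rw [← map_mul, (hf c k).1 h, map_one],
    fun h => by simpa only [map_mul, map_inv, map_one] using congrArg φ ((hf c k).2 h)⟩

theorem IsColoring.map {H : Type*} [Group H] {T : Tangle} {f : T.HalfEdge → G}
    (hf : T.IsColoring f) (φ : G →* H) : T.IsColoring (fun h => φ (f h)) := by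
  refine ⟨fun h => ?_, hf.2.map φ⟩
  have := congrArg φ (hf.1 h)
  rcases hp : T.partner h with h' | k' <;> simpa [hp] using this

theorem IsLinkColoring.map {H : Type*} [Group H] {T : Tangle} {f : T.HalfEdge → G}
    (hf : T.IsLinkColoring f) (φ : G →* H) : T.IsLinkColoring (fun h => φ (f h)) :=
  ⟨hf.1.map φ, by rw [← map_mul, hf.2.1, map_one], by rw [← map_mul, hf.2.2, map_one]⟩

theorem isLinkColoring_hom {T : Tangle} (ρ : T.linkGroup →* G) :
    T.IsLinkColoring (fun h => ρ (T.arc h)) :=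
  T.isLinkColoring_arc.map ρ

theorem IsLinkColoring.lift_relators {T : Tangle} {f : T.HalfEdge → G} (hf : T.IsLinkColoring f) :
    ∀ r ∈ T.relators, FreeGroup.lift f r = 1 := by
  obtain ⟨⟨he, hc⟩, h1, h2⟩ := hf
  rintro r ((⟨h, rfl⟩ | ⟨c, k, hk, rfl⟩) | ⟨c, k, hk, rfl⟩)
  · have := he h
    simp only [map_mul, FreeGroup.lift_apply_of, glue]
    rcases hp : T.partner h with h' | k'
    · simpa [hp] using this
    · cases k' <;> simp only [hp, Sum.elim_inr] at this ⊢
      · rw [eq_inv_of_mul_eq_one_right h1]; exact this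
      · rw [eq_inv_of_mul_eq_one_right h2]; exact this
      · rw [eq_inv_of_mul_eq_one_left h2]; exact this
      · rw [eq_inv_of_mul_eq_one_left h1]; exact this
  · simpa only [map_mul, FreeGroup.lift_apply_of] using (hc c k).1 hk
  · simpa only [map_mul, map_inv, FreeGroup.lift_apply_of] using (hc c k).2 hk

/-- The representation given by a coloring. -/
def IsLinkColoring.hom {T : Tangle} {f : T.HalfEdge → G} (hf : T.IsLinkColoring f) :
    T.linkGroup →* G :=
  PresentedGroup.toGroup hf.lift_relators

theorem IsLinkColoring.hom_arc {T : Tangle} {f : T.HalfEdge → G} (hf : T.IsLinkColoring f)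
    (h : T.HalfEdge) : hf.hom (T.arc h) = f h :=
  PresentedGroup.toGroup.of hf.lift_relators

theorem linkGroup_hom_ext {T : Tangle} {ρ ρ' : T.linkGroup →* G}
    (h : ∀ e, ρ (T.arc e) = ρ' (T.arc e)) : ρ = ρ' :=
  PresentedGroup.ext h

theorem isColoring_crossing_true (f : (crossing true).HalfEdge → G) :
    IsColoring (crossing true) f ↔ f ((), .se) = (f ((), .nw))⁻¹ ∧
      f ((), .ne) = (f ((), .nw))⁻¹ * (f ((), .sw))⁻¹ * f ((), .nw) := by
  constructor
  · rintro ⟨-, hc⟩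
    have h1 := (hc () .nw).1 rfl
    have h2 := (hc () .sw).2 rfl
    simp only [Corner.opp, Corner.cw] at h1 h2
    rw [← eq_inv_of_mul_eq_one_right h1]
    refine ⟨rfl, ?_⟩
    rw [eq_of_mul_inv_eq_one h2, eq_inv_of_mul_eq_one_right h1]
    group
  · rintro ⟨h1, h2⟩
    refine ⟨fun ⟨_, k⟩ => ?_, ?_⟩
    · exact mul_inv_cancel _
    · rintro ⟨⟩ k
      cases k <;> simp [isOver, sgn, Corner.opp, Corner.cw, h1, h2, mul_assoc]

theorem isColoring_crossing_false (f : (crossing false).HalfEdge → G) :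
    IsColoring (crossing false) f ↔ f ((), .sw) = (f ((), .ne))⁻¹ ∧
      f ((), .se) = (f ((), .ne))⁻¹ * (f ((), .nw))⁻¹ * f ((), .ne) := by
  constructor
  · rintro ⟨-, hc⟩
    have h1 := (hc () .ne).1 rfl
    have h2 := (hc () .nw).2 rfl
    simp only [Corner.opp, Corner.cw] at h1 h2
    rw [← eq_inv_of_mul_eq_one_right h1]
    refine ⟨rfl, ?_⟩
    rw [eq_of_mul_inv_eq_one h2, eq_inv_of_mul_eq_one_right h1]
    group
  · rintro ⟨h1, h2⟩
    refine ⟨fun ⟨_, k⟩ => ?_, ?_⟩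
    · exact mul_inv_cancel _
    · rintro ⟨⟩ k
      cases k <;> simp [isOver, sgn, Corner.opp, Corner.cw, h1, h2, mul_assoc]

end Tangle

/-! ### Explicit colorings of the triple twists -/

section Colorings

variable {G : Type*} [Group G]

/-- The coloring of `[1]` with the inward values `a`, `b` at the ends `nw`, `sw`. -/
def colorH (a b : G) : Corner → G
  | .nw => a⁻¹ | .sw => b⁻¹ | .ne => a * b * a⁻¹ | .se => a

/-- The coloring of `[1]` with the inward values `q`, `p` at the ends `ne`, `nw`. -/
def colorV (q p : G) : Corner → G
  | .nw => p⁻¹ | .ne => q⁻¹ | .se => p | .sw => p⁻¹ * q * p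

/-- The coloring of `[-1]` with the inward values `q`, `p` at the ends `ne`, `nw`. -/
def colorN (q p : G) : Corner → G
  | .nw => p⁻¹ | .ne => q⁻¹ | .se => q * p * q⁻¹ | .sw => q

/-- The coloring of `[3]` with the inward values `a`, `b` at the ends `nw`, `sw`. -/
def colorThree (a b : G) : three.HalfEdge → G
  | (.inl _, k) => colorH a b k
  | (.inr (.inl _), k) => colorH (a * b * a⁻¹) a k
  | (.inr (.inr _), k) => colorH (a * b * a * b⁻¹ * a⁻¹) (a * b * a⁻¹) k

/-- The coloring of `[1/3]` with the inward values `q`, `p` at the ends `ne`, `nw`. -/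
def colorThird (q p : G) : third.HalfEdge → G
  | (.inl _, k) => colorV q p k
  | (.inr (.inl _), k) => colorV p (p⁻¹ * q * p) k
  | (.inr (.inr _), k) => colorV (p⁻¹ * q * p) (p⁻¹ * q⁻¹ * p * q * p) k

/-- The coloring of `[-1/3]` with the inward values `q`, `p` at the ends `ne`, `nw`. -/
def colorNegThird (q p : G) : negThird.HalfEdge → G
  | (.inl _, k) => colorN q p k
  | (.inr (.inl _), k) => colorN (q * p * q⁻¹) q k
  | (.inr (.inr _), k) => colorN (q * p * q * p⁻¹ * q⁻¹) (q * p * q⁻¹) k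

theorem isColoring_colorH (a b : G) :
    IsColoring (crossing true) (fun h => colorH a b h.2) := by
  rw [isColoring_crossing_true]
  simp [colorH]

theorem isColoring_colorV (q p : G) :
    IsColoring (crossing true) (fun h => colorV q p h.2) := by
  rw [isColoring_crossing_true]
  simp [colorV, mul_assoc]

theorem isColoring_colorN (q p : G) :
    IsColoring (crossing false) (fun h => colorN q p h.2) := by
  rw [isColoring_crossing_false]
  simp [colorN, mul_assoc]

theorem colorH_unique {f : (crossing true).HalfEdge → G} (hf : IsColoring (crossing true) f)
    {a b : G} (ha : f ((), .nw) = a⁻¹) (hb : f ((), .sw) = b⁻¹) (k : Corner) :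
    f ((), k) = colorH a b k := by
  obtain ⟨h1, h2⟩ := (isColoring_crossing_true f).1 hf
  cases k <;> simp [colorH, h1, h2, ha, hb]

theorem colorV_unique {f : (crossing true).HalfEdge → G} (hf : IsColoring (crossing true) f)
    {q p : G} (hq : f ((), .ne) = q⁻¹) (hp : f ((), .nw) = p⁻¹) (k : Corner) :
    f ((), k) = colorV q p k := by
  obtain ⟨h1, h2⟩ := (isColoring_crossing_true f).1 hf
  have h3 : f ((), .sw) = p⁻¹ * q * p := by
    rw [hq, hp] at h2
    rw [← inv_inv (f _), ← inv_inv q, h2]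
    group
  cases k <;> simp [colorV, h1, h3, hp, hq]

theorem colorN_unique {f : (crossing false).HalfEdge → G} (hf : IsColoring (crossing false) f)
    {q p : G} (hq : f ((), .ne) = q⁻¹) (hp : f ((), .nw) = p⁻¹) (k : Corner) :
    f ((), k) = colorN q p k := by
  obtain ⟨h1, h2⟩ := (isColoring_crossing_false f).1 hf
  cases k <;> simp [colorN, h1, h2, hp, hq]

theorem isColoring_colorThree (a b : G) : IsColoring three (colorThree a b) := by
  refine (isColoring_hcomp_iff _ _ _).2 ⟨isColoring_colorH a b,
    (isColoring_hcomp_iff _ _ _).2 ⟨isColoring_colorH _ _, isColoring_colorH _ _, ?_, ?_⟩, ?_, ?_⟩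
  · change (a * b * a⁻¹) * a * (a * b * a⁻¹)⁻¹ * (a * b * a * b⁻¹ * a⁻¹)⁻¹ = 1
    group
  · exact mul_inv_cancel _
  · exact mul_inv_cancel _
  · exact mul_inv_cancel _

theorem isColoring_colorThird (q p : G) : IsColoring third (colorThird q p) := by
  refine (isColoring_vcomp_iff _ _ _).2 ⟨isColoring_colorV q p,
    (isColoring_vcomp_iff _ _ _).2 ⟨isColoring_colorV _ _, isColoring_colorV _ _, ?_, ?_⟩, ?_, ?_⟩
  · change (p⁻¹ * q * p)⁻¹ * p * (p⁻¹ * q * p) * (p⁻¹ * q⁻¹ * p * q * p)⁻¹ = 1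
    group
  · exact mul_inv_cancel _
  · exact mul_inv_cancel _
  · exact mul_inv_cancel _

theorem isColoring_colorNegThird (q p : G) : IsColoring negThird (colorNegThird q p) := by
  refine (isColoring_vcomp_iff _ _ _).2 ⟨isColoring_colorN q p,
    (isColoring_vcomp_iff _ _ _).2 ⟨isColoring_colorN _ _, isColoring_colorN _ _, ?_, ?_⟩, ?_, ?_⟩
  · exact mul_inv_cancel _
  · change (q * p * q⁻¹) * q * (q * p * q⁻¹)⁻¹ * (q * p * q * p⁻¹ * q⁻¹)⁻¹ = 1
    group
  · exact mul_inv_cancel _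
  · exact mul_inv_cancel _

/-- Two adjacent values determine the other two at a crossing and are passed on to the next one. A
twist thus puts no condition on its inputs; conditions arise only when tangles are closed up. -/
theorem colorThree_unique {f : three.HalfEdge → G} (hf : IsColoring three f) {a b : G}
    (ha : f (three.tip .nw) = a⁻¹) (hb : f (three.tip .sw) = b⁻¹) : f = colorThree a b := by
  obtain ⟨h1, h23, e1, e2⟩ := (isColoring_hcomp_iff _ _ _).1 hf
  obtain ⟨h2, h3, e3, e4⟩ := (isColoring_hcomp_iff _ _ _).1 h23
  have k1 := colorH_unique h1 ha hb
  have k2 := colorH_unique h2 (a := a * b * a⁻¹) (b := a)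
    ((eq_inv_of_mul_eq_one_right e1).trans (congrArg _ (k1 .ne)))
    ((eq_inv_of_mul_eq_one_right e2).trans (congrArg _ (k1 .se)))
  have k3 := colorH_unique h3 (a := a * b * a * b⁻¹ * a⁻¹) (b := a * b * a⁻¹)
    ((eq_inv_of_mul_eq_one_right e3).trans (congrArg _ ((k2 .ne).trans (by simp [colorH, mul_assoc]))))
    ((eq_inv_of_mul_eq_one_right e4).trans (congrArg _ (k2 .se)))
  funext ⟨c, k⟩
  rcases c with c | c | c
  exacts [k1 k, k2 k, k3 k]

theorem colorThird_unique {f : third.HalfEdge → G} (hf : IsColoring third f) {q p : G}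
    (hq : f (third.tip .ne) = q⁻¹) (hp : f (third.tip .nw) = p⁻¹) : f = colorThird q p := by
  obtain ⟨h1, h23, e1, e2⟩ := (isColoring_vcomp_iff _ _ _).1 hf
  obtain ⟨h2, h3, e3, e4⟩ := (isColoring_vcomp_iff _ _ _).1 h23
  have k1 := colorV_unique h1 hq hp
  have k2 := colorV_unique h2 (q := p) (p := p⁻¹ * q * p)
    ((eq_inv_of_mul_eq_one_right e2).trans (congrArg _ (k1 .se)))
    ((eq_inv_of_mul_eq_one_right e1).trans (congrArg _ (k1 .sw)))
  have k3 := colorV_unique h3 (q := p⁻¹ * q * p) (p := p⁻¹ * q⁻¹ * p * q * p)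
    ((eq_inv_of_mul_eq_one_right e4).trans (congrArg _ (k2 .se)))
    ((eq_inv_of_mul_eq_one_right e3).trans (congrArg _ ((k2 .sw).trans (by simp [colorV, mul_assoc]))))
  funext ⟨c, k⟩
  rcases c with c | c | c
  exacts [k1 k, k2 k, k3 k]

theorem colorNegThird_unique {f : negThird.HalfEdge → G} (hf : IsColoring negThird f) {q p : G}
    (hq : f (negThird.tip .ne) = q⁻¹) (hp : f (negThird.tip .nw) = p⁻¹) :
    f = colorNegThird q p := by
  obtain ⟨h1, h23, e1, e2⟩ := (isColoring_vcomp_iff _ _ _).1 hf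
  obtain ⟨h2, h3, e3, e4⟩ := (isColoring_vcomp_iff _ _ _).1 h23
  have k1 := colorN_unique h1 hq hp
  have k2 := colorN_unique h2 (q := q * p * q⁻¹) (p := q)
    ((eq_inv_of_mul_eq_one_right e2).trans (congrArg _ (k1 .se)))
    ((eq_inv_of_mul_eq_one_right e1).trans (congrArg _ (k1 .sw)))
  have k3 := colorN_unique h3 (q := q * p * q * p⁻¹ * q⁻¹) (p := q * p * q⁻¹)
    ((eq_inv_of_mul_eq_one_right e4).trans (congrArg _ ((k2 .se).trans (by simp [colorN, mul_assoc]))))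
    ((eq_inv_of_mul_eq_one_right e3).trans (congrArg _ (k2 .sw)))
  funext ⟨c, k⟩
  rcases c with c | c | c
  exacts [k1 k, k2 k, k3 k]

end Colorings

/-! ### Colorings of the two knot diagrams -/

section LinkColorings

variable {G : Type*} [Group G]

/-- The value of the coloring `colorThree a b` at the end `ne`. -/
def out₁ (a b : G) : G := a * b * a * b * a⁻¹ * b⁻¹ * a⁻¹

/-- The value of the coloring `colorThree a b` at the end `se`. -/
def out₂ (a b : G) : G := a * b * a * b⁻¹ * a⁻¹

theorem colorThree_ne (a b : G) : colorThree a b (three.tip .ne) = out₁ a b := by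
  change a * b * a * b⁻¹ * a⁻¹ * (a * b * a⁻¹) * (a * b * a * b⁻¹ * a⁻¹)⁻¹ = _
  rw [out₁]; group

theorem colorNegThird_se (q p : G) : colorNegThird q p (negThird.tip .se) = out₁ q p := by
  change q * p * q * p⁻¹ * q⁻¹ * (q * p * q⁻¹) * (q * p * q * p⁻¹ * q⁻¹)⁻¹ = _
  rw [out₁]; group

theorem colorThird_se (q p : G) : colorThird q p (third.tip .se) = (out₂ p⁻¹ q⁻¹)⁻¹ := by
  change p⁻¹ * q⁻¹ * p * q * p = _
  rw [out₂]; group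

theorem colorThird_sw (q p : G) : colorThird q p (third.tip .sw) = (out₁ p⁻¹ q⁻¹)⁻¹ := by
  change (p⁻¹ * q⁻¹ * p * q * p)⁻¹ * (p⁻¹ * q * p) * (p⁻¹ * q⁻¹ * p * q * p) = _
  rw [out₁]; group

/-- `out₁ a b` is `b` conjugated by `a * b * a`, and under the braid relation this conjugation
interchanges `a` and `b`. -/
theorem out₁_of_braid {a b : G} (h : a * b * a = b * a * b) : out₁ a b = a := by
  have h' : a * b * a * b = a * (a * b * a) := by
    rw [h, ← mul_assoc, ← mul_assoc, h]
  rw [out₁, h']; group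

theorem out₂_of_braid {a b : G} (h : a * b * a = b * a * b) : out₂ a b = b := by
  rw [out₂, h]; group

theorem braid_inv {a b : G} (h : a * b * a = b * a * b) :
    a⁻¹ * b⁻¹ * a⁻¹ = b⁻¹ * a⁻¹ * b⁻¹ := by
  simpa [mul_assoc] using congrArg (·⁻¹) h

/-- The coloring of `Q₁` with the outward values `x₁`, `y` at the ends `nw`, `sw` of `T₁`, `x₄⁻¹` at
the end `sw` of `T₂` and `z` at the end `ne` of `T₃`. -/
def colorQ1 (x₁ y x₄ z : G) : Q1.HalfEdge → G
  | (.inl c, k) => colorThree x₁⁻¹ y⁻¹ (c, k)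
  | (.inr (.inl c), k) => colorThree y x₄ (c, k)
  | (.inr (.inr (.inl c)), k) => colorNegThird z⁻¹ x₄⁻¹ (c, k)
  | (.inr (.inr (.inr c)), k) => colorNegThird (out₂ y x₄) z (c, k)

/-- The coloring of `Q₂` with the outward values `x`, `y` at the ends `nw`, `sw` of `T₁`, `z⁻¹` at
the end `sw` of `T₂` and `v` at the end `ne` of `T₃`. -/
def colorQ2 (x y z v : G) : Q2.HalfEdge → G
  | (.inl c, k) => colorThree x⁻¹ y⁻¹ (c, k)
  | (.inr (.inl c), k) => colorThree y z (c, k)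
  | (.inr (.inr (.inl c)), k) => colorNegThird v⁻¹ z⁻¹ (c, k)
  | (.inr (.inr (.inr c)), k) => colorThird (out₂ y z) v (c, k)

/-- The remaining joints hold by the choice of the inputs. The four hypotheses are the right joint
between T₁ and T₂, the lower joint between T₃ and T₄, and the left and right closing arcs. -/
theorem isLinkColoring_colorQ1 {x₁ y x₄ z : G} (h₁ : out₂ x₁⁻¹ y⁻¹ * out₁ y x₄ = 1)
    (h₂ : out₁ z⁻¹ x₄⁻¹ * out₂ (out₂ y x₄) z = 1) (h₃ : x₁ * out₂ z⁻¹ x₄⁻¹ = 1)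
    (h₄ : out₁ x₁⁻¹ y⁻¹ * out₁ (out₂ y x₄) z = 1) : Q1.IsLinkColoring (colorQ1 x₁ y x₄ z) := by
  refine ⟨(isColoring_vcomp_iff _ _ _).2 ⟨isColoring_colorThree _ _,
    (isColoring_vcomp_iff _ _ _).2 ⟨isColoring_colorThree _ _,
      (isColoring_hcomp_iff _ _ _).2 ⟨isColoring_colorNegThird _ _, isColoring_colorNegThird _ _,
        ?_, ?_⟩, ?_, ?_⟩, ?_, ?_⟩, ?_, ?_⟩
  · exact inv_mul_cancel (z⁻¹)
  · exact (congrArg (· * out₂ (out₂ y x₄) z) (colorNegThird_se z⁻¹ x₄⁻¹)).trans h₂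
  · change x₄⁻¹ * x₄⁻¹⁻¹ = 1
    group
  · exact mul_inv_cancel (out₂ y x₄)
  · exact inv_mul_cancel (y⁻¹)
  · exact (congrArg (out₂ x₁⁻¹ y⁻¹ * ·) (colorThree_ne y x₄)).trans h₁
  · exact (congrArg (· * out₂ z⁻¹ x₄⁻¹) (inv_inv x₁)).trans h₃
  · exact (congrArg₂ (· * ·) (colorThree_ne x₁⁻¹ y⁻¹) (colorNegThird_se (out₂ y x₄) z)).trans h₄

theorem isLinkColoring_colorQ2 {x y z v : G} (h₁ : out₂ x⁻¹ y⁻¹ * out₁ y z = 1)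
    (h₂ : out₁ v⁻¹ z⁻¹ * (out₁ v⁻¹ (out₂ y z)⁻¹)⁻¹ = 1) (h₃ : x * out₂ v⁻¹ z⁻¹ = 1)
    (h₄ : out₁ x⁻¹ y⁻¹ * (out₂ v⁻¹ (out₂ y z)⁻¹)⁻¹ = 1) : Q2.IsLinkColoring (colorQ2 x y z v) := by
  refine ⟨(isColoring_vcomp_iff _ _ _).2 ⟨isColoring_colorThree _ _,
    (isColoring_vcomp_iff _ _ _).2 ⟨isColoring_colorThree _ _,
      (isColoring_hcomp_iff _ _ _).2 ⟨isColoring_colorNegThird _ _, isColoring_colorThird _ _,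
        ?_, ?_⟩, ?_, ?_⟩, ?_, ?_⟩, ?_, ?_⟩
  · exact inv_mul_cancel (v⁻¹)
  · exact (congrArg₂ (· * ·) (colorNegThird_se v⁻¹ z⁻¹) (colorThird_sw (out₂ y z) v)).trans h₂
  · change z⁻¹ * z⁻¹⁻¹ = 1
    group
  · exact mul_inv_cancel (out₂ y z)
  · exact inv_mul_cancel (y⁻¹)
  · exact (congrArg (out₂ x⁻¹ y⁻¹ * ·) (colorThree_ne y z)).trans h₁
  · exact (congrArg (· * out₂ v⁻¹ z⁻¹) (inv_inv x)).trans h₃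
  · exact (congrArg₂ (· * ·) (colorThree_ne x⁻¹ y⁻¹) (colorThird_se (out₂ y z) v)).trans h₄

/-- This applies to every representation of the knot group, inside the family or not: it turns all
of them into quadruples subject to four equations. Here `x₁` and `x₄` are still independent. -/
theorem colorQ1_unique {f : Q1.HalfEdge → G} (hf : Q1.IsLinkColoring f) {x₁ y x₄ z : G}
    (hx₁ : f (inL (three.tip .nw)) = x₁) (hy : f (inL (three.tip .sw)) = y)
    (hx₄ : f (inR (inL (three.tip .sw))) = x₄⁻¹)
    (hz : f (inR (inR (inL (negThird.tip .ne)))) = z) :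
    f = colorQ1 x₁ y x₄ z ∧ out₂ x₁⁻¹ y⁻¹ * out₁ y x₄ = 1 ∧
      out₁ z⁻¹ x₄⁻¹ * out₂ (out₂ y x₄) z = 1 ∧ x₁ * out₂ z⁻¹ x₄⁻¹ = 1 ∧
      out₁ x₁⁻¹ y⁻¹ * out₁ (out₂ y x₄) z = 1 := by
  obtain ⟨hc, e7, e8⟩ := hf
  obtain ⟨h1, h234, e1, e2⟩ := (isColoring_vcomp_iff _ _ _).1 hc
  obtain ⟨h2, h34, e3, e4⟩ := (isColoring_vcomp_iff _ _ _).1 h234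
  obtain ⟨h3, h4, e5, e6⟩ := (isColoring_hcomp_iff _ _ _).1 h34
  have k1 := colorThree_unique h1 (a := x₁⁻¹) (b := y⁻¹) (hx₁.trans (inv_inv _).symm)
    (hy.trans (inv_inv _).symm)
  have k2 := colorThree_unique h2 (a := y) (b := x₄)
    ((eq_inv_of_mul_eq_one_right e1).trans (congrArg _ hy)) hx₄
  have k3 := colorNegThird_unique h3 (q := z⁻¹) (p := x₄⁻¹) (hz.trans (inv_inv _).symm)
    ((eq_inv_of_mul_eq_one_right e3).trans (congrArg _ hx₄))
  have k4 := colorNegThird_unique h4 (q := out₂ y x₄) (p := z)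
    ((eq_inv_of_mul_eq_one_right e4).trans (congrArg _ (congrFun k2 (three.tip .se))))
    ((eq_inv_of_mul_eq_one_right e5).trans (congrArg _ hz))
  refine ⟨?_, ?_, ?_, ?_, ?_⟩
  · funext ⟨c, k⟩
    rcases c with c | c | c | c
    exacts [congrFun k1 (c, k), congrFun k2 (c, k), congrFun k3 (c, k), congrFun k4 (c, k)]
  · rw [← colorThree_ne, ← congrFun k2]
    exact (congrArg (· * f _) (congrFun k1 (three.tip .se)).symm).trans e2
  · rw [← colorNegThird_se, ← congrFun k3]
    exact (congrArg (f _ * ·) (congrFun k4 (negThird.tip .sw)).symm).trans e6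
  · rw [← hx₁]
    exact (congrArg (f _ * ·) (congrFun k3 (negThird.tip .sw)).symm).trans e7
  · rw [← colorThree_ne, ← congrFun k1, ← colorNegThird_se, ← congrFun k4]
    exact e8

theorem colorQ2_unique {f : Q2.HalfEdge → G} (hf : Q2.IsLinkColoring f) {x y z v : G}
    (hx : f (inL (three.tip .nw)) = x) (hy : f (inL (three.tip .sw)) = y)
    (hz : f (inR (inL (three.tip .sw))) = z⁻¹)
    (hv : f (inR (inR (inL (negThird.tip .ne)))) = v) :
    f = colorQ2 x y z v ∧ out₂ x⁻¹ y⁻¹ * out₁ y z = 1 ∧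
      out₁ v⁻¹ z⁻¹ * (out₁ v⁻¹ (out₂ y z)⁻¹)⁻¹ = 1 ∧ x * out₂ v⁻¹ z⁻¹ = 1 ∧
      out₁ x⁻¹ y⁻¹ * (out₂ v⁻¹ (out₂ y z)⁻¹)⁻¹ = 1 := by
  obtain ⟨hc, e7, e8⟩ := hf
  obtain ⟨h1, h234, e1, e2⟩ := (isColoring_vcomp_iff _ _ _).1 hc
  obtain ⟨h2, h34, e3, e4⟩ := (isColoring_vcomp_iff _ _ _).1 h234
  obtain ⟨h3, h4, e5, e6⟩ := (isColoring_hcomp_iff _ _ _).1 h34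
  have k1 := colorThree_unique h1 (a := x⁻¹) (b := y⁻¹) (hx.trans (inv_inv _).symm)
    (hy.trans (inv_inv _).symm)
  have k2 := colorThree_unique h2 (a := y) (b := z)
    ((eq_inv_of_mul_eq_one_right e1).trans (congrArg _ hy)) hz
  have k3 := colorNegThird_unique h3 (q := v⁻¹) (p := z⁻¹) (hv.trans (inv_inv _).symm)
    ((eq_inv_of_mul_eq_one_right e3).trans (congrArg _ hz))
  have k4 := colorThird_unique h4 (q := out₂ y z) (p := v)
    ((eq_inv_of_mul_eq_one_right e4).trans (congrArg _ (congrFun k2 (three.tip .se))))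
    ((eq_inv_of_mul_eq_one_right e5).trans (congrArg _ hv))
  refine ⟨?_, ?_, ?_, ?_, ?_⟩
  · funext ⟨c, k⟩
    rcases c with c | c | c | c
    exacts [congrFun k1 (c, k), congrFun k2 (c, k), congrFun k3 (c, k), congrFun k4 (c, k)]
  · rw [← colorThree_ne, ← congrFun k2]
    exact (congrArg (· * f _) (congrFun k1 (three.tip .se)).symm).trans e2
  · rw [← colorNegThird_se, ← congrFun k3, ← colorThird_sw, ← congrFun k4]
    exact e6
  · rw [← hx]
    exact (congrArg (f _ * ·) (congrFun k3 (negThird.tip .sw)).symm).trans e7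
  · rw [← colorThree_ne, ← congrFun k1, ← colorThird_se, ← congrFun k4]
    exact e8

end LinkColorings

/-! ### Longitudes as products of over-arcs -/

section Longitudes

variable {G : Type*} [Group G]

/-- The over-arcs met at under-crossings on a walk once around the knot, directed from right to
left. -/
def Tangle.overArcs (T : Tangle) (h : T.HalfEdge) : List T.HalfEdge :=
  (List.range (2 * T.size)).filterMap fun i =>
    if T.isOver (T.enter h i) = true then none
    else some ((T.enter h i).1, (T.enter h i).2.opp.ccw)

theorem Tangle.map_longitude {T : Tangle} (ρ : T.linkGroup →* G) (h : T.HalfEdge) :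
    ρ (T.longitude h) = ρ (T.arc h) ^ T.writhe h *
      ((T.overArcs h).map fun e => ρ (T.arc e)).prod := by
  rw [longitude, map_mul, map_zpow, map_list_prod, overArcs]
  congr 1
  induction List.range (2 * T.size) with
  | nil => rfl
  | cons i l ih =>
    by_cases hi : T.isOver (T.enter h i) = true
    · simpa [hi] using ih
    · simp only [List.map_cons, List.prod_cons, List.filterMap_cons, hi, ih]
      simp

/-- The left side is `x (xyx)⁻² x`. The central element `c` stands for the scalar -1, which keeps
the computation inside an arbitrary group. -/
theorem braid_cube {x y c : G} (hc : x * y * x * (x * y * x) = c)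
    (hcc : c * c = 1) (hcomm : ∀ g, c * g = g * c) :
    y⁻¹ * x⁻¹ * x⁻¹ * y⁻¹ = c * x ^ 2 := by
  have h1 : (x * y * x)⁻¹ * (x * y * x)⁻¹ = c := by
    rw [← mul_inv_rev, hc, inv_eq_of_mul_eq_one_left hcc]
  have : y⁻¹ * x⁻¹ * x⁻¹ * y⁻¹ = x * ((x * y * x)⁻¹ * (x * y * x)⁻¹) * x := by group
  rw [this, h1, ← hcomm, pow_two]
  group

theorem braid_conj {x y : G} (h : x * y * x = y * x * y) : y⁻¹ * x⁻¹ * y = x * y⁻¹ * x⁻¹ := by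
  have : y⁻¹ * x⁻¹ * y = x * (x * y * x)⁻¹ * y := by group
  rw [this, h]
  group

theorem braid_conj_inv {x y : G} (h : x * y * x = y * x * y) : y⁻¹ * x⁻¹ * y * x * y = x := by
  rw [braid_conj h]
  have : x * y⁻¹ * x⁻¹ * x * y = x := by group
  exact this

/-- The product of the over-arcs of `Q₁` for one of the representations of the family. -/
theorem overArcs_prod_Q1 {x y z c : G} (hy : x * y * x = y * x * y) (hz : x * z * x = z * x * z)
    (hyc : x * y * x * (x * y * x) = c) (hzc : x * z * x * (x * z * x) = c)
    (hcc : c * c = 1) (hcomm : ∀ g, c * g = g * c) :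
    (z⁻¹ * x⁻¹ * z) * x⁻¹ * z⁻¹ * y⁻¹ * x⁻¹ * (y * x⁻¹ * y⁻¹) * (x * z⁻¹ * x⁻¹) * x⁻¹ * z⁻¹ *
      y⁻¹ * x⁻¹ * (x⁻¹ * y⁻¹ * x) = x ^ 12 := by
  have ky := braid_cube hyc hcc hcomm
  have kz := braid_cube hzc hcc hcomm
  -- This grouping exposes two blocks for `braid_cube`; rewriting by `braid_conj` creates two more,
  -- so that four factors `c` appear and cancel.
  have e : (z⁻¹ * x⁻¹ * z) * x⁻¹ * z⁻¹ * y⁻¹ * x⁻¹ * (y * x⁻¹ * y⁻¹) * (x * z⁻¹ * x⁻¹) * x⁻¹ *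
      z⁻¹ * y⁻¹ * x⁻¹ * (x⁻¹ * y⁻¹ * x) = (z⁻¹ * x⁻¹ * z) * x⁻¹ * z⁻¹ * (y⁻¹ * x⁻¹ * y) *
      x⁻¹ * y⁻¹ * x * (z⁻¹ * x⁻¹ * x⁻¹ * z⁻¹) * (y⁻¹ * x⁻¹ * x⁻¹ * y⁻¹) * x := by group
  rw [e, braid_conj hy, braid_conj hz, ky, kz]
  have e2 : x * z⁻¹ * x⁻¹ * x⁻¹ * z⁻¹ * (x * y⁻¹ * x⁻¹) * x⁻¹ * y⁻¹ * x * (c * x ^ 2) *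
      (c * x ^ 2) * x = x * (z⁻¹ * x⁻¹ * x⁻¹ * z⁻¹) * x * (y⁻¹ * x⁻¹ * x⁻¹ * y⁻¹) * x *
      (c * x ^ 2) * (c * x ^ 2) * x := by group
  rw [e2, ky, kz]
  have e3 : x * (c * x ^ 2) = c * x ^ 3 := by rw [← mul_assoc, ← hcomm, mul_assoc, ← pow_succ']
  have e4 : ∀ m n, c * x ^ m * (c * x ^ n) = x ^ (m + n) := fun m n => by
    rw [mul_assoc, ← mul_assoc (x ^ m), ← hcomm, mul_assoc, ← mul_assoc, hcc, one_mul, pow_add]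
  rw [e3, mul_assoc (c * x ^ 3), e3, e4, mul_assoc _ (c * x ^ 2) (c * x ^ 2), e4]
  group

/-- The product of the over-arcs of `Q₂` for one of the representations of the family. -/
theorem overArcs_prod_Q2 {x y z c : G} (hy : x * y * x = y * x * y)
    (hyc : x * y * x * (x * y * x) = c)
    (hzc : y * z * y * (y * z * y) = c) (hcc : c * c = 1) (hcomm : ∀ g, c * g = g * c) :
    y⁻¹ * x⁻¹ * (y * z⁻¹ * y⁻¹) * y⁻¹ * z⁻¹ * (x⁻¹ * y⁻¹ * x) = x ^ 6 := by
  have ky := braid_cube hyc hcc hcomm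
  have kz := braid_cube hzc hcc hcomm
  have e : y⁻¹ * x⁻¹ * (y * z⁻¹ * y⁻¹) * y⁻¹ * z⁻¹ * (x⁻¹ * y⁻¹ * x) =
      y⁻¹ * x⁻¹ * y * (z⁻¹ * y⁻¹ * y⁻¹ * z⁻¹) * x⁻¹ * y⁻¹ * x := by group
  -- The word is cut into three copies of `y⁻¹x⁻¹yxy`, each equal to `x` by `braid_conj_inv`, one
  -- block for `braid_cube`, and a final `x`.
  have e2 : y⁻¹ * x⁻¹ * y * (c * y ^ 2) * x⁻¹ * y⁻¹ * x =
      c * ((y⁻¹ * x⁻¹ * y * x * y) * (y⁻¹ * x⁻¹ * y * x * y) * (y⁻¹ * x⁻¹ * y * x * y) *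
        (y⁻¹ * x⁻¹ * x⁻¹ * y⁻¹) * x) := by
    rw [← mul_assoc _ c, ← hcomm, pow_two]; group
  rw [e, kz, e2, braid_conj_inv hy, ky]
  have : c * (x * x * x * (c * x ^ 2) * x) = c * (x * x * x * c) * x ^ 2 * x := by group
  rw [this, ← hcomm (x * x * x), ← mul_assoc, hcc]
  group

end Longitudes

/-! ### Over-arcs met along the knots, and the resulting longitudes -/

theorem Q1.overArcs_nw : Q1.overArcs (Q1.tip .nw) =
    [(.inr (.inr (.inl (.inr (.inl ())))), .sw), (.inr (.inr (.inr (.inl ()))), .ne),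
      (.inr (.inr (.inr (.inr (.inr ())))), .ne), (.inl (.inr (.inr ())), .se),
      (.inl (.inl ()), .se), (.inr (.inl (.inr (.inl ()))), .nw),
      (.inr (.inr (.inr (.inr (.inl ())))), .ne), (.inr (.inr (.inl (.inr (.inr ())))), .sw),
      (.inr (.inr (.inl (.inl ()))), .sw), (.inr (.inl (.inl ())), .nw),
      (.inr (.inl (.inr (.inr ()))), .nw), (.inl (.inr (.inl ())), .se)] := by
  decide +kernel

theorem Q1.overArcs_sw : Q1.overArcs (Q1.tip .sw) =
    [(.inl (.inr (.inl ())), .nw), (.inr (.inl (.inr (.inr ()))), .se),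
      (.inr (.inl (.inl ())), .se), (.inr (.inr (.inl (.inl ()))), .ne),
      (.inr (.inr (.inl (.inr (.inr ())))), .ne), (.inr (.inr (.inr (.inr (.inl ())))), .sw),
      (.inr (.inl (.inr (.inl ()))), .se), (.inl (.inl ()), .nw), (.inl (.inr (.inr ())), .nw),
      (.inr (.inr (.inr (.inr (.inr ())))), .sw), (.inr (.inr (.inr (.inl ()))), .sw),
      (.inr (.inr (.inl (.inr (.inl ())))), .ne)] := by
  decide +kernel

theorem Q2.overArcs_nw : Q2.overArcs (Q2.tip .nw) =
    [(.inr (.inr (.inl (.inr (.inl ())))), .sw), (.inr (.inr (.inr (.inr (.inl ())))), .se),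
      (.inl (.inr (.inr ())), .se), (.inl (.inl ()), .se), (.inr (.inl (.inr (.inl ()))), .nw),
      (.inr (.inr (.inr (.inl ()))), .se), (.inr (.inr (.inr (.inr (.inr ())))), .se),
      (.inr (.inr (.inl (.inr (.inr ())))), .sw), (.inr (.inr (.inl (.inl ()))), .sw),
      (.inr (.inl (.inl ())), .nw), (.inr (.inl (.inr (.inr ()))), .nw),
      (.inl (.inr (.inl ())), .se)] := by
  decide +kernel

theorem Q2.overArcs_sw : Q2.overArcs (Q2.tip .sw) =
    [(.inl (.inr (.inl ())), .nw), (.inr (.inl (.inr (.inr ()))), .se),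
      (.inr (.inl (.inl ())), .se), (.inr (.inr (.inl (.inl ()))), .ne),
      (.inr (.inr (.inl (.inr (.inr ())))), .ne), (.inr (.inr (.inr (.inr (.inr ())))), .nw),
      (.inr (.inr (.inr (.inl ()))), .nw), (.inr (.inl (.inr (.inl ()))), .se),
      (.inl (.inl ()), .nw), (.inl (.inr (.inr ())), .nw),
      (.inr (.inr (.inr (.inr (.inl ())))), .nw), (.inr (.inr (.inl (.inr (.inl ())))), .ne)] := by
  decide +kernel

section Longitudes

variable {G : Type*} [Group G]

/-- The over-arcs multiply to `x ^ 12` and the writhe contributes another 12. Only one arc for each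
direction is computed; `longitude_walk` covers the others. -/
theorem Q1.longitude_of_color {ρ : Q1.linkGroup →* G} {x y z c : G}
    (hρ : (fun h => ρ (Q1.arc h)) = colorQ1 x y x z)
    (hy : x * y * x = y * x * y) (hz : x * z * x = z * x * z)
    (hyc : x * y * x * (x * y * x) = c) (hzc : x * z * x * (x * z * x) = c)
    (hcc : c * c = 1) (hcomm : ∀ g, c * g = g * c) (h : Q1.HalfEdge) :
    ρ (Q1.longitude h) = ρ (Q1.arc h) ^ 24 := by
  have key := overArcs_prod_Q1 hy hz hyc hzc hcc hcomm
  have o₁ := out₂_of_braid hy.symm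
  have o₂ := out₂_of_braid hz
  have o₃ := out₂_of_braid (braid_inv hy)
  have o₄ := out₂_of_braid (braid_inv hz.symm)
  have hnw : ρ (Q1.longitude (Q1.tip .nw)) = ρ (Q1.arc (Q1.tip .nw)) ^ 24 := by
    have h0 : ρ (Q1.arc (Q1.tip .nw)) = x := (congrFun hρ (Q1.tip .nw)).trans (inv_inv x)
    have hp : ((Q1.overArcs (Q1.tip .nw)).map (colorQ1 x y x z)).prod = x ^ 12 := by
      rw [← key, Q1.overArcs_nw]
      change (z⁻¹ * x⁻¹ * z⁻¹⁻¹) * ((out₂ y x)⁻¹ * ((out₂ (out₂ y x) z)⁻¹ * (out₂ x⁻¹ y⁻¹ *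
        (x⁻¹ * ((y * x * y⁻¹)⁻¹ * ((out₂ y x * z * (out₂ y x)⁻¹)⁻¹ * (out₂ z⁻¹ x⁻¹ * (z⁻¹ * (y⁻¹ *
        ((out₂ y x)⁻¹ * (x⁻¹ * y⁻¹ * x⁻¹⁻¹ * 1))))))))))) = _
      rw [o₁, o₂, o₃, o₄]
      group
    rw [map_longitude, Q1.writhe_eq, h0, hρ, hp, ← zpow_natCast, ← zpow_natCast, ← zpow_add]
    norm_num
  -- The reversed walk meets the inverse over-arcs in the opposite order, so its product is the
  -- inverse of the previous one.
  have hsw : ρ (Q1.longitude (Q1.tip .sw)) = ρ (Q1.arc (Q1.tip .sw)) ^ 24 := by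
    have h0 : ρ (Q1.arc (Q1.tip .sw)) = x⁻¹ := (congrFun hρ (Q1.tip .sw)).trans o₄
    have hp : ((Q1.overArcs (Q1.tip .sw)).map (colorQ1 x y x z)).prod = (x ^ 12)⁻¹ := by
      rw [← key, Q1.overArcs_sw]
      change (x⁻¹ * y⁻¹ * x⁻¹⁻¹)⁻¹ * (out₂ y x * (y * (z⁻¹⁻¹ * ((out₂ z⁻¹ x⁻¹)⁻¹ *
        (out₂ y x * z * (out₂ y x)⁻¹ * (y * x * y⁻¹ * (x⁻¹⁻¹ * ((out₂ x⁻¹ y⁻¹)⁻¹ *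
        (out₂ (out₂ y x) z * (out₂ y x * ((z⁻¹ * x⁻¹ * z⁻¹⁻¹)⁻¹ * 1))))))))))) = _
      rw [o₁, o₂, o₃, o₄]
      simp [mul_assoc]
    rw [map_longitude, Q1.writhe_eq, h0, hρ, hp, ← inv_pow, ← zpow_natCast, ← zpow_natCast,
      ← zpow_add]
    norm_num
  obtain ⟨i, rfl | rfl⟩ := Q1.walk_tip h
  · exact longitude_walk Q1.walk_period Q1.writhe_eq ρ 24 _ hnw i
  · exact longitude_walk Q1.walk_period Q1.writhe_eq ρ 24 _ hsw i

theorem Q2.longitude_of_color {ρ : Q2.linkGroup →* G} {x y z v c : G}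
    (hρ : (fun h => ρ (Q2.arc h)) = colorQ2 x y z v) (hv : x * out₂ v⁻¹ z⁻¹ = 1)
    (hy : x * y * x = y * x * y) (hz : y * z * y = z * y * z)
    (hyc : x * y * x * (x * y * x) = c) (hzc : y * z * y * (y * z * y) = c)
    (hcc : c * c = 1) (hcomm : ∀ g, c * g = g * c) (h : Q2.HalfEdge) :
    ρ (Q2.longitude h) = ρ (Q2.arc h) ^ 12 := by
  have key := overArcs_prod_Q2 hy hyc hzc hcc hcomm
  have o₁ := out₂_of_braid hz
  have o₂ := out₂_of_braid (braid_inv hy)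
  have hnw : ρ (Q2.longitude (Q2.tip .nw)) = ρ (Q2.arc (Q2.tip .nw)) ^ 12 := by
    have h0 : ρ (Q2.arc (Q2.tip .nw)) = x := (congrFun hρ (Q2.tip .nw)).trans (inv_inv x)
    have hp : ((Q2.overArcs (Q2.tip .nw)).map (colorQ2 x y z v)).prod = x ^ 6 := by
      rw [← key, Q2.overArcs_nw]
      change (v⁻¹ * z⁻¹ * v⁻¹⁻¹) * ((v⁻¹ * out₂ y z * v) * (out₂ x⁻¹ y⁻¹ * (x⁻¹ *
        ((y * z * y⁻¹)⁻¹ * (v * ((v⁻¹ * (out₂ y z)⁻¹ * v * out₂ y z * v) * (out₂ v⁻¹ z⁻¹ * (v⁻¹ *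
        (y⁻¹ * ((out₂ y z)⁻¹ * (x⁻¹ * y⁻¹ * x⁻¹⁻¹ * 1))))))))))) = _
      -- Once `out₂ v⁻¹ z⁻¹` is written out, all letters `v` cancel freely, and a word in `x`, `y`,
      -- `z` alone remains.
      rw [o₁, o₂, out₂]
      group
    rw [map_longitude, Q2.writhe_eq, h0, hρ, hp, ← zpow_natCast, ← zpow_natCast, ← zpow_add]
    norm_num
  have hsw : ρ (Q2.longitude (Q2.tip .sw)) = ρ (Q2.arc (Q2.tip .sw)) ^ 12 := by
    have h0 : ρ (Q2.arc (Q2.tip .sw)) = x⁻¹ :=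
      (congrFun hρ (Q2.tip .sw)).trans (eq_inv_of_mul_eq_one_right hv)
    have hp : ((Q2.overArcs (Q2.tip .sw)).map (colorQ2 x y z v)).prod = (x ^ 6)⁻¹ := by
      rw [← key, Q2.overArcs_sw]
      change (x⁻¹ * y⁻¹ * x⁻¹⁻¹)⁻¹ * (out₂ y z * (y * (v⁻¹⁻¹ * ((out₂ v⁻¹ z⁻¹)⁻¹ *
        ((v⁻¹ * (out₂ y z)⁻¹ * v * out₂ y z * v)⁻¹ * (v⁻¹ * (y * z * y⁻¹ * (x⁻¹⁻¹ *
        ((out₂ x⁻¹ y⁻¹)⁻¹ * ((v⁻¹ * out₂ y z * v)⁻¹ * ((v⁻¹ * z⁻¹ * v⁻¹⁻¹)⁻¹ * 1))))))))))) = _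
      rw [o₁, o₂, out₂]
      simp [mul_assoc]
    rw [map_longitude, Q2.writhe_eq, h0, hρ, hp, ← inv_pow, ← zpow_natCast, ← zpow_natCast,
      ← zpow_add]
    norm_num
  obtain ⟨i, rfl | rfl⟩ := Q2.walk_tip h
  · exact longitude_walk Q2.walk_period Q2.writhe_eq ρ 12 _ hnw i
  · exact longitude_walk Q2.walk_period Q2.writhe_eq ρ 12 _ hsw i

end Longitudes

/-! ### Trace identities for triple twists in SL(2) over a commutative ring -/

section SL2

variable {R : Type*} [CommRing R]

/-- The underlying matrix of an element of `SL(2,R)`. -/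
abbrev mat (a : SL(2, R)) : Matrix (Fin 2) (Fin 2) R := (a : Matrix (Fin 2) (Fin 2) R)

theorem mat_injective : Function.Injective (mat : SL(2, R) → _) := Subtype.coe_injective

theorem mat_mul (a b : SL(2, R)) : mat (a * b) = mat a * mat b :=
  Matrix.SpecialLinearGroup.coe_mul a b

theorem mat_inv (a : SL(2, R)) : mat a⁻¹ = (mat a).trace • 1 - mat a := by
  rw [mat, Matrix.SpecialLinearGroup.coe_inv]
  ext i j
  fin_cases i <;> fin_cases j <;> simp [Matrix.adjugate_fin_two, Matrix.trace_fin_two]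

theorem trace_mat_inv (a : SL(2, R)) : (mat a⁻¹).trace = (mat a).trace := by
  rw [mat_inv, Matrix.trace_sub, Matrix.trace_smul, Matrix.trace_one]
  simp; ring

theorem mat_mul_self (a : SL(2, R)) : mat a * mat a = (mat a).trace • mat a - 1 := by
  have h : mat a * mat a⁻¹ = 1 := by rw [← mat_mul, mul_inv_cancel]; rfl
  rw [mat_inv, mul_sub, mul_smul_comm, mul_one] at h
  rw [← h]; abel

/-- Polarized Cayley–Hamilton. It serves to move letters of a word into a fixed order. -/
theorem matrix_mul_comm_eq (A B : Matrix (Fin 2) (Fin 2) R) :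
    B * A = -(A * B) + B.trace • A + A.trace • B + ((A * B).trace - A.trace * B.trace) • 1 := by
  ext i j
  fin_cases i <;> fin_cases j <;>
    simp [Matrix.trace_fin_two, Matrix.mul_apply, Fin.sum_univ_two] <;> ring

theorem mat_mul_mul (a b : SL(2, R)) : mat a * mat b * mat a =
    (mat (a * b)).trace • mat a + mat b - (mat b).trace • 1 := by
  rw [mul_assoc, matrix_mul_comm_eq (mat a) (mat b), mat_mul]
  simp only [mul_add, mul_neg, mul_smul_comm, ← mul_assoc, mat_mul_self, sub_mul, smul_mul_assoc,
    one_mul, mul_one]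
  module

/-- Elements of equal traces whose product has trace `1` satisfy the braid relation. -/
theorem braid_of_trace {a b : SL(2, R)} (h : (mat a).trace = (mat b).trace)
    (h1 : (mat (a * b)).trace = 1) : a * b * a = b * a * b := by
  apply mat_injective
  have h2 : (mat (b * a)).trace = 1 := by rw [mat_mul, Matrix.trace_mul_comm, ← mat_mul, h1]
  -- By `mat_mul_mul` both sides become `a + b - t`, which is symmetric in the two elements.
  rw [mat_mul (a * b), mat_mul a, mat_mul (b * a), mat_mul b, mat_mul_mul, mat_mul_mul, h1, h2, h]
  module

/-- The square equals (ab)³, and ab has characteristic polynomial X² - X + 1, a divisor of X³ + 1.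
-/
theorem braid_square {a b : SL(2, R)} (h : (mat a).trace = (mat b).trace)
    (h1 : (mat (a * b)).trace = 1) : a * b * a * (a * b * a) = -1 := by
  have e : a * b * a * (a * b * a) = a * b * (a * b) * (a * b) := by
    have := braid_of_trace h h1
    calc a * b * a * (a * b * a) = a * b * a * (b * a * b) := by rw [this]
      _ = a * b * (a * b) * (a * b) := by group
  rw [e]
  apply mat_injective
  rw [mat_mul, mat_mul _ (a * b), mat_mul_self, h1, one_smul, sub_mul, mat_mul_self, h1, one_smul,
    one_mul]
  rw [sub_sub_cancel_left]
  exact (Matrix.SpecialLinearGroup.coe_neg 1).symm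

/-- Measures how far a triple twist is from returning its input: the defect is a multiple of tr(ab)
- 1. The open conditions that isolate the families rest on this formula and the next. -/
theorem mat_out₂ {a b : SL(2, R)} (h : (mat a).trace = (mat b).trace) :
    mat (out₂ a b) = mat b + ((mat (a * b)).trace - 1) • (mat a - mat (a * b * a⁻¹)) := by
  have hτ : (mat (a * b)).trace = (mat a * mat b).trace := by rw [mat_mul]
  have h1 := mat_mul_self a
  have h2 := mat_mul_self b
  have h3 := matrix_mul_comm_eq (mat a) (mat b)
  simp only [out₂, mat_mul, mat_inv]
  rw [h] at *
  generalize (mat b).trace = t at *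
  generalize (mat a * mat b).trace = τ at *
  generalize mat a = A at *
  generalize mat b = B at *
  have h1' : ∀ W, A * (A * W) = t • (A * W) - W := fun W => by
    rw [← mul_assoc, h1, sub_mul, smul_mul_assoc, one_mul]
  simp only [mul_assoc, mul_add, mul_sub, add_mul, sub_mul, mul_smul_comm, smul_mul_assoc, mul_one,
    one_mul, mul_neg, neg_mul, h1, h2, h3, h1', smul_add, smul_sub]
  module

/-- A twist preserves the product ab, so this output is `a * b` times the inverse of `out₂ a b`, and
`mat_inv` makes the inverse linear once the trace is known. -/
theorem mat_out₁ {a b : SL(2, R)} (h : (mat a).trace = (mat b).trace) :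
    mat (out₁ a b) =
      mat a - ((mat (a * b)).trace - 1) • mat (a * b) * (mat a - mat (a * b * a⁻¹)) := by
  have e : out₁ a b = a * b * (out₂ a b)⁻¹ := by rw [out₁, out₂]; group
  have e' : a = a * b * b⁻¹ := by group
  have ht : (mat (out₂ a b)).trace = (mat b).trace := by
    have : out₂ a b = (a * b) * (a * (a * b)⁻¹) := by rw [out₂]; group
    rw [this, mat_mul, Matrix.trace_mul_comm, ← mat_mul, inv_mul_cancel_right, h]
  have h2 : mat a = mat (a * b) * mat b⁻¹ := by rw [← mat_mul, ← e']
  rw [e, mat_mul, mat_inv (out₂ a b), ht, mat_out₂ h]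
  conv_rhs => lhs; rw [h2, mat_inv b]
  rw [← sub_sub, mul_sub, mul_smul_comm, smul_mul_assoc]

end SL2

/-! ### Zariski topology: closures, regular maps, components and dimension -/

section Zariski

open MvPolynomial

variable {σ τ : Type*}

theorem isClosed_zeros (S : Set (MvPolynomial σ ℂ)) : IsClosed (zeros S) := by
  rw [← isOpen_compl_iff]
  exact ⟨S, compl_compl _⟩

theorem isClosed_eval_eq_zero (p : MvPolynomial σ ℂ) : IsClosed {x : Aff σ | eval x p = 0} := by
  convert isClosed_zeros {p} using 1
  ext x; simp [zeros]

theorem isOpen_eval_ne_zero (p : MvPolynomial σ ℂ) : IsOpen {x : Aff σ | eval x p ≠ 0} :=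
  (isClosed_eval_eq_zero p).isOpen_compl

theorem isClosed_iff_zeros {Z : Set (Aff σ)} : IsClosed Z ↔ ∃ S, Z = zeros S := by
  constructor
  · intro h
    obtain ⟨S, hS⟩ := (isOpen_compl_iff.2 h)
    exact ⟨S, by rw [← hS, compl_compl]⟩
  · rintro ⟨S, rfl⟩
    exact isClosed_zeros S

theorem exists_eval_ne_zero {U : Set (Aff σ)} (hU : IsOpen U) {x : Aff σ} (hx : x ∈ U) :
    ∃ p : MvPolynomial σ ℂ, eval x p ≠ 0 ∧ ∀ y, eval y p ≠ 0 → y ∈ U := by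
  obtain ⟨S, hS⟩ := isClosed_iff_zeros.1 hU.isClosed_compl
  have hx' : x ∉ zeros S := by rw [← hS]; simpa using hx
  simp only [zeros, Set.mem_ofPred_eq, not_forall] at hx'
  obtain ⟨p, hp, hpx⟩ := hx'
  refine ⟨p, hpx, fun y hy => ?_⟩
  by_contra hyU
  have : y ∈ zeros S := by rw [← hS]; exact hyU
  exact hy (this p hp)

theorem mem_closure_iff_eval {V : Set (Aff σ)} {x : Aff σ} :
    x ∈ closure V ↔ ∀ p : MvPolynomial σ ℂ, (∀ y ∈ V, eval y p = 0) → eval x p = 0 := by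
  constructor
  · intro h p hp
    exact (isClosed_eval_eq_zero p).closure_subset_iff.2 hp h
  · intro h
    by_contra hx
    obtain ⟨p, hp, hpU⟩ := exists_eval_ne_zero isClosed_closure.isOpen_compl (x := x) hx
    refine hp (h p fun y hy => ?_)
    by_contra hy0
    exact hpU y hy0 (subset_closure hy)

theorem aff_eval_X (x : Aff σ) (i : σ) : eval x (X i : MvPolynomial σ ℂ) = x i :=
  MvPolynomial.eval_X (f := x) i

theorem aff_eval_C (x : Aff σ) (a : ℂ) : eval x (C a : MvPolynomial σ ℂ) = a :=
  MvPolynomial.eval_C a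

instance instT1SpaceAff : T1Space (Aff σ) := ⟨fun x => by
  rw [isClosed_iff_zeros]
  refine ⟨Set.range fun i => X i - C (x i), ?_⟩
  ext y
  constructor
  · rintro rfl _ ⟨i, rfl⟩
    rw [map_sub, aff_eval_X, aff_eval_C, sub_self]
  · intro h
    refine _root_.funext fun i => ?_
    have := h _ ⟨i, rfl⟩
    rwa [map_sub, aff_eval_X, aff_eval_C, sub_eq_zero] at this⟩

theorem isIrreducible_of_eval {S : Set (Aff σ)} (hne : S.Nonempty)
    (h : ∀ p q : MvPolynomial σ ℂ, (∀ x ∈ S, eval x p * eval x q = 0) →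
      (∀ x ∈ S, eval x p = 0) ∨ ∀ x ∈ S, eval x q = 0) : IsIrreducible S := by
  refine ⟨hne, ?_⟩
  rintro U V hU hV ⟨x, hxS, hxU⟩ ⟨y, hyS, hyV⟩
  obtain ⟨p, hp, hpU⟩ := exists_eval_ne_zero hU hxU
  obtain ⟨q, hq, hqV⟩ := exists_eval_ne_zero hV hyV
  by_contra hcon
  have : ∀ z ∈ S, eval z p * eval z q = 0 := fun z hz => by
    by_contra h0
    exact hcon ⟨z, hz, hpU z (left_ne_zero_of_mul h0), hqV z (right_ne_zero_of_mul h0)⟩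
  rcases h p q this with h | h
  · exact hp (h x hxS)
  · exact hq (h y hyS)

/-! ### Regular functions -/

theorem IsRegularOn.of_polynomial (Y : Set (Aff σ)) (p : MvPolynomial σ ℂ) :
    IsRegularOn Y fun y => eval y p := fun _ _ => ⟨p, 1, by simp, fun _ _ _ => by simp⟩

theorem IsRegularOn.congr {Y : Set (Aff σ)} {f g : Aff σ → ℂ} (hf : IsRegularOn Y f)
    (h : ∀ y ∈ Y, g y = f y) : IsRegularOn Y g := fun y hy => by
  obtain ⟨p, q, hq, hpq⟩ := hf y hy
  exact ⟨p, q, hq, fun z hz hzq => by rw [h z hz, hpq z hz hzq]⟩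

theorem IsRegularOn.mono {Y Z : Set (Aff σ)} {f : Aff σ → ℂ} (hf : IsRegularOn Y f) (h : Z ⊆ Y) :
    IsRegularOn Z f := fun y hy => by
  obtain ⟨p, q, hq, hpq⟩ := hf y (h hy)
  exact ⟨p, q, hq, fun z hz => hpq z (h hz)⟩

theorem IsRegularOn.add {Y : Set (Aff σ)} {f g : Aff σ → ℂ} (hf : IsRegularOn Y f)
    (hg : IsRegularOn Y g) : IsRegularOn Y fun y => f y + g y := fun y hy => by
  obtain ⟨p, q, hq, hpq⟩ := hf y hy
  obtain ⟨p', q', hq', hpq'⟩ := hg y hy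
  refine ⟨p * q' + q * p', q * q', by simpa using ⟨hq, hq'⟩, fun z hz hzq => ?_⟩
  rw [map_mul, mul_ne_zero_iff] at hzq
  refine (congrArg₂ (· + ·) (hpq z hz hzq.1) (hpq' z hz hzq.2)).trans ?_
  simp only [map_add, map_mul]
  exact div_add_div _ _ hzq.1 hzq.2

theorem IsRegularOn.mul {Y : Set (Aff σ)} {f g : Aff σ → ℂ} (hf : IsRegularOn Y f)
    (hg : IsRegularOn Y g) : IsRegularOn Y fun y => f y * g y := fun y hy => by
  obtain ⟨p, q, hq, hpq⟩ := hf y hy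
  obtain ⟨p', q', hq', hpq'⟩ := hg y hy
  refine ⟨p * p', q * q', by simpa using ⟨hq, hq'⟩, fun z hz hzq => ?_⟩
  rw [map_mul, mul_ne_zero_iff] at hzq
  refine (congrArg₂ (· * ·) (hpq z hz hzq.1) (hpq' z hz hzq.2)).trans ?_
  simp only [map_mul]
  exact div_mul_div_comm _ _ _ _

theorem IsRegularMapOn.comp_eval {Y : Set (Aff σ)} {f : Aff σ → Aff τ} (hf : IsRegularMapOn Y f)
    (P : MvPolynomial τ ℂ) : IsRegularOn Y fun y => MvPolynomial.eval (f y) P := by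
  induction P using MvPolynomial.induction_on with
  | C a => exact (IsRegularOn.of_polynomial Y (C a)).congr fun y _ =>
      (aff_eval_C _ a).trans (aff_eval_C y a).symm
  | add p q hp hq => exact (hp.add hq).congr fun y _ => map_add _ _ _
  | mul_X p i hp => exact (hp.mul (hf i)).congr fun y _ =>
      (map_mul _ _ _).trans (congrArg _ (aff_eval_X _ i))

theorem IsRegularMapOn.mono {Y Z : Set (Aff σ)} {f : Aff σ → Aff τ} (hf : IsRegularMapOn Y f)
    (h : Z ⊆ Y) : IsRegularMapOn Z f := fun j => (hf j).mono h

theorem IsRegularMapOn.continuousOn {Y : Set (Aff σ)} {f : Aff σ → Aff τ}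
    (hf : IsRegularMapOn Y f) : ContinuousOn f Y := by
  intro y hy U hU
  obtain ⟨V, hVU, hV, hyV⟩ := mem_nhds_iff.1 hU
  obtain ⟨P, hP, hPV⟩ := exists_eval_ne_zero hV hyV
  obtain ⟨p, q, hq, hpq⟩ := hf.comp_eval P y hy
  have hp : eval y p ≠ 0 := fun h0 => hP (by
    have := hpq y hy hq
    rw [h0, zero_div] at this
    exact this)
  refine mem_nhdsWithin.2 ⟨{x | eval x (p * q) ≠ 0}, isOpen_eval_ne_zero _, ?_, ?_⟩
  · rw [Set.mem_ofPred_eq, map_mul]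
    exact mul_ne_zero hp hq
  · rintro z ⟨hz, hzY⟩
    rw [Set.mem_ofPred_eq, map_mul, mul_ne_zero_iff] at hz
    refine hVU (hPV _ ?_)
    have := hpq z hzY hz.2
    refine fun h0 => div_ne_zero hz.1 hz.2 ?_
    rw [← this]
    exact h0

/-- An isomorphism restricts to an isomorphism from the preimage of a subset. -/
theorem IsIsomorphismOn.restrict {f : Aff σ → Aff τ} {Y Y' : Set (Aff σ)} {Z Z' : Set (Aff τ)}
    (h : IsIsomorphismOn f Y Z) (hZ : Z' ⊆ Z) (hY : ∀ y, y ∈ Y' ↔ y ∈ Y ∧ f y ∈ Z') :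
    IsIsomorphismOn f Y' Z' := by
  obtain ⟨hf, hfm, g, hg, hgm, hl, hr⟩ := h
  have hYY : Y' ⊆ Y := fun y hy => ((hY y).1 hy).1
  refine ⟨hf.mono hYY, fun y hy => ((hY y).1 hy).2, g, hg.mono hZ, fun z hz => ?_,
    fun y hy => hl (hYY hy), fun z hz => hr (hZ hz)⟩
  refine (hY _).2 ⟨hgm (hZ hz), ?_⟩
  rw [hr (hZ hz)]
  exact hz

theorem IsIsomorphismOn.isIrreducible {f : Aff σ → Aff τ} {Y : Set (Aff σ)} {Z : Set (Aff τ)}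
    (h : IsIsomorphismOn f Y Z) (hZ : IsIrreducible Z) : IsIrreducible Y := by
  obtain ⟨hf, hfm, g, hg, hgm, hl, hr⟩ := h
  have : g '' Z = Y := by
    ext y
    constructor
    · rintro ⟨z, hz, rfl⟩
      exact hgm hz
    · exact fun hy => ⟨f y, hfm hy, hl hy⟩
  rw [← this]
  exact hZ.image g hg.continuousOn

theorem IsIsomorphismOn.krullDim_le {f : Aff σ → Aff τ} {Y : Set (Aff σ)} {Z : Set (Aff τ)}
    (h : IsIsomorphismOn f Y Z) : topologicalKrullDim Z ≤ topologicalKrullDim Y := by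
  obtain ⟨hf, hfm, g, hg, hgm, hl, hr⟩ := h
  have hF : Continuous (hfm.restrict f Y Z) := hf.continuousOn.mapsToRestrict hfm
  have hG : Continuous (hgm.restrict g Z Y) := hg.continuousOn.mapsToRestrict hgm
  have hFG : Function.LeftInverse (hfm.restrict f Y Z) (hgm.restrict g Z Y) := fun z =>
    Subtype.ext (hr z.2)
  exact (hFG.isEmbedding hF hG).isInducing.topologicalKrullDim_le

/-! ### Components and dimension -/

theorem isIrreducible_preimage_val {C X : Set (Aff σ)} (hC : IsIrreducible C) (hCX : C ⊆ X) :
    IsIrreducible ((↑) ⁻¹' C : Set X) := by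
  obtain ⟨⟨x, hx⟩, hpre⟩ := hC
  refine ⟨⟨⟨x, hCX hx⟩, hx⟩, ?_⟩
  rintro _ _ ⟨U, hU, rfl⟩ ⟨V, hV, rfl⟩ ⟨y, hyC, hyU⟩ ⟨z, hzC, hzV⟩
  obtain ⟨w, hwC, hwU, hwV⟩ := hpre U V hU hV ⟨y, hyC, hyU⟩ ⟨z, hzC, hzV⟩
  exact ⟨⟨w, hCX hwC⟩, hwC, hwU, hwV⟩

/-- A relatively closed irreducible subset that is open somewhere is a component. -/
theorem isComponent_of_isOpen {C X U : Set (Aff σ)} (hC : IsIrreducible C) (hCX : C ⊆ X)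
    (hcl : ∀ x ∈ X, x ∈ closure C → x ∈ C) (hU : IsOpen U) (hUX : ∀ x ∈ X, x ∈ U → x ∈ C)
    (hUC : (C ∩ U).Nonempty) : IsComponent C X := by
  refine ⟨hCX, isIrreducible_preimage_val hC hCX, fun t ht hle x hxt => ?_⟩
  have ht' : IsIrreducible ((↑) '' t : Set (Aff σ)) :=
    ht.image _ continuous_subtype_val.continuousOn
  obtain ⟨c, hcC, hcU⟩ := hUC
  have hne : (((↑) '' t : Set (Aff σ)) ∩ U).Nonempty :=
    ⟨c, ⟨⟨c, hCX hcC⟩, hle hcC, rfl⟩, hcU⟩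
  -- An irreducible set lies in the closure of its intersection with any open set that it meets;
  -- here this intersection is contained in `C`.
  have hsub := subset_closure_inter_of_isPreirreducible_of_isOpen ht'.isPreirreducible hU hne
  refine hcl x x.2 (closure_mono ?_ (hsub ⟨x, hxt, rfl⟩))
  rintro _ ⟨⟨y, -, rfl⟩, hyU⟩
  exact hUX y y.2 hyU

theorem one_lt_krullDim_of_lt_of_lt {α : Type*} [Preorder α] {a b c : α} (h : a < b) (h' : b < c) :
    1 < Order.krullDim α := by
  have h2 : ((2 : ℕ) : WithBot ℕ∞) ≤ Order.krullDim α :=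
    Order.LTSeries.length_le_krullDim ⟨2, ![a, b, c], fun i => by
      fin_cases i
      · exact h
      · exact h'⟩
  exact lt_of_lt_of_le (by norm_num) h2

/-- A set that contains an irreducible curve properly, in the sense of a polynomial that vanishes on
the curve only, has dimension greater than one. -/
theorem one_lt_krullDim {Y L : Set (Aff σ)} (hY : IsIrreducible Y) (hL : IsIrreducible L)
    (hLY : L ⊆ Y) (hL2 : L.Nontrivial) (P : MvPolynomial σ ℂ) (hP : ∀ x ∈ L, eval x P = 0)
    {y : Aff σ} (hy : y ∈ Y) (hyP : eval y P ≠ 0) : 1 < topologicalKrullDim Y := by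
  obtain ⟨a, ha, b, hb, hab⟩ := hL2
  let Z₀ : TopologicalSpace.IrreducibleCloseds Y :=
    ⟨{⟨a, hLY ha⟩}, isIrreducible_singleton, isClosed_singleton⟩
  let Z₁ : TopologicalSpace.IrreducibleCloseds Y :=
    ⟨closure ((↑) ⁻¹' L), (isIrreducible_preimage_val hL hLY).closure, isClosed_closure⟩
  let Z₂ : TopologicalSpace.IrreducibleCloseds Y :=
    ⟨Set.univ, by simpa using isIrreducible_preimage_val hY subset_rfl, isClosed_univ⟩
  have h₀₁ : Z₀ < Z₁ := by
    refine SetLike.lt_iff_le_and_exists.2 ⟨?_, ⟨b, hLY hb⟩, subset_closure hb, ?_⟩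
    · rintro x rfl
      exact subset_closure ha
    · exact fun h => hab (congrArg Subtype.val h).symm
  have h₁₂ : Z₁ < Z₂ := by
    refine SetLike.lt_iff_le_and_exists.2 ⟨fun x _ => Set.mem_univ x, ⟨y, hy⟩, Set.mem_univ _, ?_⟩
    intro h
    have h' : (⟨y, hy⟩ : Y) ∈ closure ((↑) ⁻¹' L : Set Y) := h
    have h'' : y ∈ closure L :=
      closure_mono (Set.image_preimage_subset _ _)
        (image_closure_subset_closure_image continuous_subtype_val ⟨_, h', rfl⟩)
    exact hyP (mem_closure_iff_eval.1 h'' P hP)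
  exact one_lt_krullDim_of_lt_of_lt h₀₁ h₁₂

end Zariski

/-! ### Irreducibility of double covers of the plane and of parametrized curves -/

section DoubleCover

open Polynomial

theorem eq_zero_of_evalEval {p : ℂ[X][X]} (h : ∀ t w : ℂ, evalEval t w p = 0) : p = 0 := by
  refine eq_zero_of_infinite_isRoot p (Set.Infinite.mono (s := Set.range (C : ℂ → ℂ[X])) ?_
    (Set.infinite_range_of_injective C_injective))
  rintro _ ⟨w, rfl⟩
  exact Polynomial.funext fun t => by simpa [evalEval] using h t w

/-- If the discriminant of `r² + b r + c` has a simple zero along `w = 0`, the norm form of the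
corresponding quadratic extension is anisotropic. -/
theorem norm_form_anisotropic {b c k A B : ℂ[X][X]} (hd : b ^ 2 - 4 * c = X * k)
    (hk : k.eval 0 ≠ 0) (h : B ^ 2 - b * A * B + c * A ^ 2 = 0) : A = 0 ∧ B = 0 := by
  have hsq : (2 * B - b * A) ^ 2 = X * k * A ^ 2 := by
    rw [← hd]; linear_combination 4 * h
  have hA : A = 0 := by
    by_contra hA
    have hk0 : k ≠ 0 := fun h0 => hk (by rw [h0, eval_zero])
    have hr : X * k * A ^ 2 ≠ 0 := mul_ne_zero (mul_ne_zero X_ne_zero hk0) (pow_ne_zero 2 hA)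
    have hl : 2 * B - b * A ≠ 0 := fun h0 => hr (by rw [← hsq, h0, zero_pow two_ne_zero])
    -- The order of vanishing along `w = 0` is even on the left of `hsq` and odd on the right.
    have h1 := congrArg (rootMultiplicity 0) hsq
    rw [rootMultiplicity_mul hr, rootMultiplicity_mul (left_ne_zero_of_mul hr), pow_two, pow_two,
      rootMultiplicity_mul (mul_ne_zero hl hl), rootMultiplicity_mul (mul_ne_zero hA hA),
      rootMultiplicity_eq_zero (p := k) (by simpa [IsRoot] using hk)] at h1
    have hX : rootMultiplicity (0 : ℂ[X]) X = 1 := by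
      simpa using rootMultiplicity_X_sub_C_self (x := (0 : ℂ[X]))
    omega
  refine ⟨hA, ?_⟩
  rw [hA] at h
  simpa using h

/-- A surface with coordinates in the quadratic extension of `ℂ[t, w]` given by `r² + b r + c = 0`,
where the discriminant has a simple zero along `w = 0`, is irreducible. -/
theorem isIrreducible_doubleCover {b c k : ℂ[X][X]} (hd : b ^ 2 - 4 * c = X * k)
    (hk : k.eval 0 ≠ 0) {σ : Type*} (F₀ F₁ : σ → ℂ[X][X]) {S : Set (Aff σ)}
    (hS : ∀ x, x ∈ S ↔ ∃ t w r : ℂ, r ^ 2 + evalEval t w b * r + evalEval t w c = 0 ∧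
      ∀ j, x j = evalEval t w (F₀ j) + evalEval t w (F₁ j) * r) : IsIrreducible S := by
  have hroot : ∀ t w : ℂ, ∃ r₁ r₂ : ℂ, r₁ + r₂ = -evalEval t w b ∧ r₁ * r₂ = evalEval t w c := by
    intro t w
    obtain ⟨s, hs⟩ := IsAlgClosed.exists_pow_nat_eq (evalEval t w b ^ 2 - 4 * evalEval t w c)
      (n := 2) two_pos
    exact ⟨(-evalEval t w b + s) / 2, (-evalEval t w b - s) / 2, by ring,
      by linear_combination (-1 / 4 : ℂ) * hs⟩
  -- On the surface every polynomial reduces to the form A r + B by means of r² = -b r - c. The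
  -- outer variable of `ℂ[X][X]` is `w`, the inner one `t`.
  have hred : ∀ P : MvPolynomial σ ℂ, ∃ A B : ℂ[X][X], ∀ (x : Aff σ) (t w r : ℂ),
      r ^ 2 + evalEval t w b * r + evalEval t w c = 0 →
      (∀ j, x j = evalEval t w (F₀ j) + evalEval t w (F₁ j) * r) →
      MvPolynomial.eval x P = evalEval t w A * r + evalEval t w B := by
    intro P
    induction P using MvPolynomial.induction_on with
    | C a => exact ⟨0, C (C a), fun x t w r _ _ => by rw [aff_eval_C]; simp [evalEval]⟩
    | add p q hp hq =>
      obtain ⟨A, B, h⟩ := hp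
      obtain ⟨A', B', h'⟩ := hq
      refine ⟨A + A', B + B', fun x t w r hr hx => ?_⟩
      rw [map_add, h x t w r hr hx, h' x t w r hr hx, evalEval_add, evalEval_add]
      ring
    | mul_X p i hp =>
      obtain ⟨A, B, h⟩ := hp
      refine ⟨A * F₀ i + B * F₁ i - A * F₁ i * b, B * F₀ i - A * F₁ i * c,
        fun x t w r hr hx => ?_⟩
      rw [map_mul, h x t w r hr hx, aff_eval_X, hx i]
      simp only [evalEval_add, evalEval_sub, evalEval_mul]
      linear_combination evalEval t w A * evalEval t w (F₁ i) * hr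
  refine isIrreducible_of_eval ?_ ?_
  · obtain ⟨r, r', h1, h2⟩ := hroot 0 0
    refine ⟨fun j => evalEval 0 0 (F₀ j) + evalEval 0 0 (F₁ j) * r,
      (hS _).2 ⟨0, 0, r, ?_, fun j => rfl⟩⟩
    linear_combination r * h1 - h2
  · intro p q hpq
    obtain ⟨A, B, hp⟩ := hred p
    obtain ⟨A', B', hq⟩ := hred q
    -- Each factor is a norm, the product of A r + B over the two roots r, so the product of the
    -- norms vanishes at every (t, w).
    have hprod : (B ^ 2 - b * A * B + c * A ^ 2) * (B' ^ 2 - b * A' * B' + c * A' ^ 2) = 0 := by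
      refine eq_zero_of_evalEval fun t w => ?_
      obtain ⟨r₁, r₂, h1, h2⟩ := hroot t w
      have e1 : r₁ ^ 2 + evalEval t w b * r₁ + evalEval t w c = 0 := by
        linear_combination r₁ * h1 - h2
      have e2 : r₂ ^ 2 + evalEval t w b * r₂ + evalEval t w c = 0 := by
        linear_combination r₂ * h1 - h2
      have z : ∀ r, r ^ 2 + evalEval t w b * r + evalEval t w c = 0 →
          (evalEval t w A * r + evalEval t w B) * (evalEval t w A' * r + evalEval t w B') = 0 := by
        intro r hr
        rw [← hp (fun j => evalEval t w (F₀ j) + evalEval t w (F₁ j) * r) t w r hr fun j => rfl,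
          ← hq (fun j => evalEval t w (F₀ j) + evalEval t w (F₁ j) * r) t w r hr fun j => rfl]
        exact hpq _ ((hS _).2 ⟨t, w, r, hr, fun j => rfl⟩)
      have hN : ∀ A B : ℂ[X][X], evalEval t w (B ^ 2 - b * A * B + c * A ^ 2) =
          (evalEval t w A * r₁ + evalEval t w B) * (evalEval t w A * r₂ + evalEval t w B) := by
        intro A B
        simp only [evalEval_add, evalEval_sub, evalEval_mul, evalEval_pow]
        linear_combination -evalEval t w A * evalEval t w B * h1 - evalEval t w A ^ 2 * h2
      rw [evalEval_mul, hN, hN]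
      linear_combination (evalEval t w A * r₂ + evalEval t w B) *
        (evalEval t w A' * r₂ + evalEval t w B') * z r₁ e1
    rcases mul_eq_zero.1 hprod with h | h
    · left
      intro x hx
      obtain ⟨t, w, r, hr, hx⟩ := (hS x).1 hx
      obtain ⟨rfl, rfl⟩ := norm_form_anisotropic hd hk h
      rw [hp x t w r hr hx]; simp
    · right
      intro x hx
      obtain ⟨t, w, r, hr, hx⟩ := (hS x).1 hx
      obtain ⟨rfl, rfl⟩ := norm_form_anisotropic hd hk h
      rw [hq x t w r hr hx]; simp

/-- An infinite set of points on a polynomially parametrized curve is irreducible. -/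
theorem isIrreducible_curve {σ : Type*} (F : σ → ℂ[X]) {T : Set ℂ} (hT : T.Infinite)
    {S : Set (Aff σ)} (hS : ∀ x, x ∈ S ↔ ∃ s ∈ T, ∀ j, x j = (F j).eval s) : IsIrreducible S := by
  have hred : ∀ P : MvPolynomial σ ℂ, ∃ A : ℂ[X], ∀ (x : Aff σ) (s : ℂ),
      (∀ j, x j = (F j).eval s) → MvPolynomial.eval x P = A.eval s := by
    intro P
    induction P using MvPolynomial.induction_on with
    | C a => exact ⟨C a, fun x s _ => by rw [aff_eval_C, eval_C]⟩
    | add p q hp hq =>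
      obtain ⟨A, h⟩ := hp
      obtain ⟨A', h'⟩ := hq
      exact ⟨A + A', fun x s hx => by rw [map_add, h x s hx, h' x s hx, eval_add]⟩
    | mul_X p i hp =>
      obtain ⟨A, h⟩ := hp
      exact ⟨A * F i, fun x s hx => by rw [map_mul, h x s hx, aff_eval_X, hx, eval_mul]⟩
  refine isIrreducible_of_eval ?_ ?_
  · obtain ⟨s, hs⟩ := hT.nonempty
    exact ⟨fun j => (F j).eval s, (hS _).2 ⟨s, hs, fun j => rfl⟩⟩
  · intro p q hpq
    obtain ⟨A, hp⟩ := hred p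
    obtain ⟨A', hq⟩ := hred q
    have hprod : A * A' = 0 := by
      refine eq_zero_of_infinite_isRoot _ (hT.mono fun s hs => ?_)
      have := hpq (fun j => (F j).eval s) ((hS _).2 ⟨s, hs, fun j => rfl⟩)
      rw [hp _ s fun j => rfl, hq _ s fun j => rfl] at this
      simpa [IsRoot] using this
    rcases mul_eq_zero.1 hprod with rfl | rfl
    · left
      intro x hx
      obtain ⟨s, -, hx⟩ := (hS x).1 hx
      rw [hp x s hx, eval_zero]
    · right
      intro x hx
      obtain ⟨s, -, hx⟩ := (hS x).1 hx
      rw [hq x s hx, eval_zero]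

end DoubleCover

/-! ### The two target surfaces -/

section Surfaces

open Polynomial

theorem isIrreducible_inter_open {σ : Type*} {S U : Set (Aff σ)} (hS : IsIrreducible S)
    (hU : IsOpen U) (hne : (S ∩ U).Nonempty) : IsIrreducible (S ∩ U) := by
  refine ⟨hne, ?_⟩
  rintro V W hV hW ⟨x, ⟨hxS, hxU⟩, hxV⟩ ⟨y, ⟨hyS, hyU⟩, hyW⟩
  obtain ⟨z, hzS, ⟨hzU, hzV⟩, -, hzW⟩ :=
    hS.isPreirreducible (U ∩ V) (U ∩ W) (hU.inter hV) (hU.inter hW) ⟨x, hxS, hxU, hxV⟩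
      ⟨y, hyS, hyU, hyW⟩
  exact ⟨z, ⟨hzS, hzU⟩, hzV, hzW⟩

/-- With w = t₂₃ + 2 - t² the equation becomes r² - t w r + w(w + t² - 3) = 0, of discriminant w((t²
- 4)w + 12 - 4t²). -/
theorem Q1.isIrreducible_surface : IsIrreducible Q1.surface := by
  refine isIrreducible_doubleCover (b := -(C X * X)) (c := X * (X + C (X ^ 2 - 3)))
    (k := C (X ^ 2 - 4) * X + C (12 - 4 * X ^ 2)) ?_ ?_
    (![C X, X + C (X ^ 2 - 2), 0] : Fin 3 → ℂ[X][X]) ![0, 0, 1] fun x => ?_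
  · simp only [map_sub, map_mul, map_pow, map_ofNat]
    ring
  · intro h
    have := congrArg (Polynomial.eval 0) h
    simp at this
  · simp only [Fin.forall_fin_succ, Fin.isValue, IsEmpty.forall_iff]
    simp only [evalEval, Q1.surface, fpoly, Set.mem_ofPred_eq]
    constructor
    · intro h
      refine ⟨x 0, x 1 + 2 - x 0 ^ 2, x 2, ?_, ?_⟩
      · simp
        linear_combination h
      · simp
    · rintro ⟨t, w, r, h, h0, h1, h2, -⟩
      simp at h h0 h1 h2
      rw [h0, h1, h2]
      linear_combination h

/-- The closure of `Q2.surface`. -/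
def Q2.closedSurface : Set (Aff (Fin 4)) :=
  {p | fpoly (p 0) 1 1 (p 1) (p 2) = 0 ∧
    (p 3 + 2 - p 0 ^ 2) * (p 3 - 1) ^ 2 = p 1 - p 0 ^ 2 + 2}

/-- Now w = s + 2 - t², and the second equation reads t₁₃ + 2 - t² = w(w + t² - 3)². Substituting
this into the equation for Q₁ adds a square factor to the discriminant that does not vanish
identically along w = 0, so the zero there stays simple. -/
theorem Q2.isIrreducible_closedSurface : IsIrreducible Q2.closedSurface := by
  refine isIrreducible_doubleCover (b := -(C X * (X * (X + C (X ^ 2 - 3)) ^ 2)))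
    (c := X * (X + C (X ^ 2 - 3)) ^ 2 * (X * (X + C (X ^ 2 - 3)) ^ 2 + C (X ^ 2 - 3)))
    (k := (X + C (X ^ 2 - 3)) ^ 2 *
      (C (X ^ 2 - 4) * (X * (X + C (X ^ 2 - 3)) ^ 2) + C (12 - 4 * X ^ 2))) ?_ ?_
    (![C X, X * (X + C (X ^ 2 - 3)) ^ 2 + C (X ^ 2 - 2), 0, X + C (X ^ 2 - 2)] : Fin 4 → ℂ[X][X])
    ![0, 0, 1, 0] fun x => ?_
  · simp only [map_sub, map_mul, map_pow, map_ofNat]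
    ring
  · intro h
    have := congrArg (Polynomial.eval 0) h
    simp at this
  · simp only [Fin.forall_fin_succ, Fin.isValue, IsEmpty.forall_iff]
    simp only [evalEval, Q2.closedSurface, fpoly, Set.mem_ofPred_eq]
    constructor
    · rintro ⟨h, h'⟩
      have e : x 1 = (x 3 + 2 - x 0 ^ 2) * (x 3 - 1) ^ 2 + x 0 ^ 2 - 2 := by
        linear_combination -h'
      refine ⟨x 0, x 3 + 2 - x 0 ^ 2, x 2, ?_, ?_⟩
      · rw [e] at h
        simp
        linear_combination h
      · simp
        linear_combination e
    · rintro ⟨t, w, r, h, h0, h1, h2, h3, -⟩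
      simp at h h0 h1 h2 h3
      rw [h0, h1, h2, h3]
      exact ⟨by linear_combination h, by ring⟩

theorem Q1.mem_surface {t u r : ℂ} : (![t, u, r] : Aff (Fin 3)) ∈ Q1.surface ↔
    fpoly t 1 1 u r = 0 := Iff.rfl

theorem Q1.mem_badPoints {t u r : ℂ} : (![t, u, r] : Aff (Fin 3)) ∈ Q1.badPoints ↔
    t ^ 2 = 3 ∧ u = 1 ∧ r = 0 := Iff.rfl

theorem Q2.mem_surface {t u r s : ℂ} : (![t, u, r, s] : Aff (Fin 4)) ∈ Q2.surface ↔
    fpoly t 1 1 u r = 0 ∧ (s + 2 - t ^ 2) * (s - 1) ^ 2 = u - t ^ 2 + 2 ∧ u ∈ Bset t ∧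
      s ∈ Bset t := Iff.rfl

theorem Q1.isClosed_badPoints : IsClosed Q1.badPoints := by
  refine isClosed_iff_zeros.2 ⟨{.X 0 ^ 2 - .C 3, .X 1 - .C 1, .X 2}, ?_⟩
  ext x
  simp only [zeros, Q1.badPoints, Set.mem_insert_iff, Set.mem_singleton_iff, Set.mem_ofPred_eq,
    forall_eq_or_imp, forall_eq, map_sub, map_pow, aff_eval_X, aff_eval_C, sub_eq_zero]

/-- In the fiber t = τ the polynomial f_t(1,1,u;r) splits into lines r = m(u - 1). They provide the
curves for the dimension estimates, and t = 0 and t = 2 are the values at the points chosen off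
these curves. -/
theorem exists_sqrt_three : ∃ τ m : ℂ, τ ^ 2 = 3 ∧ m ^ 2 - τ * m + 1 = 0 ∧ τ ≠ 0 ∧ τ ≠ 2 := by
  obtain ⟨τ, hτ⟩ := IsAlgClosed.exists_pow_nat_eq (3 : ℂ) (n := 2) two_pos
  obtain ⟨s, hs⟩ := IsAlgClosed.exists_pow_nat_eq (-1 : ℂ) (n := 2) two_pos
  refine ⟨τ, (τ + s) / 2, hτ, by linear_combination hs / 4 - hτ / 4, ?_, ?_⟩
  · rintro rfl; norm_num at hτ
  · rintro rfl; norm_num at hτ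

theorem Q1.isIrreducible_surface_sdiff : IsIrreducible (Q1.surface \ Q1.badPoints) := by
  refine isIrreducible_inter_open Q1.isIrreducible_surface Q1.isClosed_badPoints.isOpen_compl
    ⟨![0, -2, 0], ?_, ?_⟩
  · refine Q1.mem_surface.2 ?_
    norm_num [fpoly]
  · exact fun h => absurd (Q1.mem_badPoints.1 h).1 (by norm_num)

theorem Q1.one_lt_krullDim_surface_sdiff :
    1 < topologicalKrullDim (Q1.surface \ Q1.badPoints : Set (Aff (Fin 3))) := by
  obtain ⟨τ, m, hτ, hm, hτ0, -⟩ := exists_sqrt_three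
  -- The curve is the line r = m(u - 1) in the fiber t = τ, without its bad point at s = 0.
  refine one_lt_krullDim Q1.isIrreducible_surface_sdiff
    (L := {x | ∃ s ∈ ({0}ᶜ : Set ℂ), ∀ j, x j = ((![C τ, 1 + X, C m * X] : Fin 3 → ℂ[X]) j).eval s})
    (isIrreducible_curve _ (Set.finite_singleton 0).infinite_compl fun x => Iff.rfl) ?_ ?_
    (.X 0 - .C τ) ?_ (y := ![0, -2, 0]) ⟨?_, ?_⟩ ?_
  · rintro x ⟨s, hs, hx⟩
    simp only [Fin.forall_fin_succ, Fin.isValue, IsEmpty.forall_iff] at hx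
    simp at hx hs
    obtain ⟨h0, h1, h2⟩ := hx
    refine ⟨?_, ?_⟩
    · simp only [Q1.surface, fpoly, Set.mem_ofPred_eq, h0, h1, h2]
      linear_combination s ^ 2 * hm + (τ * m * s - s) * hτ
    · rintro ⟨-, h, -⟩
      rw [h1] at h
      exact hs (by linear_combination h)
  · refine ⟨fun j => ((![C τ, 1 + X, C m * X] : Fin 3 → ℂ[X]) j).eval 1, ⟨1, by simp, fun j => rfl⟩,
      fun j => ((![C τ, 1 + X, C m * X] : Fin 3 → ℂ[X]) j).eval 2, ⟨2, by simp, fun j => rfl⟩, ?_⟩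
    intro h
    have := congrFun h 1
    simp at this
  · rintro x ⟨s, hs, hx⟩
    rw [map_sub, aff_eval_X, aff_eval_C, hx 0]
    simp
  · refine Q1.mem_surface.2 ?_
    norm_num [fpoly]
  · exact fun h => absurd (Q1.mem_badPoints.1 h).1 (by norm_num)
  · simpa using hτ0

theorem Q1.one_lt_krullDim_surface : 1 < topologicalKrullDim Q1.surface :=
  lt_of_lt_of_le Q1.one_lt_krullDim_surface_sdiff
    (Topology.IsEmbedding.inclusion Set.sdiff_subset).isInducing.topologicalKrullDim_le

/-- A sample point off the fiber t² = 3; the matrices in `Q2.exists_openPoly_ne_zero` have these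
traces. -/
theorem Q2.test_mem_surface : (![2, -34, -30, -2] : Aff (Fin 4)) ∈ Q2.surface := by
  rw [Q2.mem_surface, fpoly, Bset]; norm_num

theorem Q2.isIrreducible_surface : IsIrreducible Q2.surface := by
  have h : Q2.surface = Q2.closedSurface ∩ {x | MvPolynomial.eval x
      ((.X 1 - .C 2) * (.X 1 - (.X 0 ^ 2 - .C 2)) * (.X 3 - .C 2) *
        (.X 3 - (.X 0 ^ 2 - .C 2)) : MvPolynomial (Fin 4) ℂ) ≠ 0} := by
    ext x
    simp only [Q2.surface, Q2.closedSurface, Bset, Set.mem_inter_iff, Set.mem_ofPred_eq, map_mul,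
      map_sub, map_pow, aff_eval_X, aff_eval_C, mul_ne_zero_iff, sub_ne_zero, and_assoc]
  have hmem := Q2.test_mem_surface
  rw [h] at hmem ⊢
  exact isIrreducible_inter_open Q2.isIrreducible_closedSurface (isOpen_eval_ne_zero _) ⟨_, hmem⟩

theorem Q2.one_lt_krullDim_surface : 1 < topologicalKrullDim Q2.surface := by
  obtain ⟨τ, m, hτ, hm, -, hτ2⟩ := exists_sqrt_three
  have hp : ((X - 1) * ((X - 1) ^ 3 - 1) : ℂ[X]) ≠ 0 := fun h => by
    have := congrArg (eval 0) h
    norm_num at this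
  have hT : {s : ℂ | (s - 1) * ((s - 1) ^ 3 - 1) ≠ 0}.Infinite := by
    refine Set.Infinite.mono (s := (((X - 1) * ((X - 1) ^ 3 - 1) : ℂ[X]).rootSet ℂ)ᶜ)
      (fun s hs h => hs ?_) (rootSet_finite _ ℂ).infinite_compl
    rw [mem_rootSet]
    exact ⟨hp, by simpa using h⟩
  -- For t² = 3 one has s + 2 - t² = s - 1, hence t₁₃ - 1 = (s - 1)³. The excluded parameters are
  -- those where t₁₃ or s takes the value 2 or t² - 2 = 1.
  refine one_lt_krullDim Q2.isIrreducible_surface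
    (L := {x | ∃ s ∈ {s : ℂ | (s - 1) * ((s - 1) ^ 3 - 1) ≠ 0}, ∀ j,
      x j = ((![C τ, 1 + (X - 1) ^ 3, C m * (X - 1) ^ 3, X] : Fin 4 → ℂ[X]) j).eval s})
    (isIrreducible_curve _ hT fun x => Iff.rfl) ?_ ?_
    (.X 0 - .C τ) ?_ Q2.test_mem_surface ?_
  · rintro x ⟨s, hs, hx⟩
    simp only [Fin.forall_fin_succ, Fin.isValue, IsEmpty.forall_iff] at hx
    simp at hx
    obtain ⟨h0, h1, h2, h3⟩ := hx
    obtain ⟨hs1, hs2⟩ := mul_ne_zero_iff.1 hs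
    simp only [Q2.surface, fpoly, Bset, Set.mem_ofPred_eq, h0, h1, h2, h3, hτ]
    refine ⟨?_, by ring, ⟨fun h => hs2 (by linear_combination h), fun h => hs1 ?_⟩,
      fun h => hs2 ?_, fun h => hs1 (by linear_combination h)⟩
    · linear_combination (s - 1) ^ 6 * hm
    · have : (s - 1) ^ 3 = 0 := by linear_combination h
      simpa using this
    · rw [h]; norm_num
  · refine ⟨fun j => ((![C τ, 1 + (X - 1) ^ 3, C m * (X - 1) ^ 3, X] : Fin 4 → ℂ[X]) j).eval 0,
      ⟨0, by norm_num, fun j => rfl⟩,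
      fun j => ((![C τ, 1 + (X - 1) ^ 3, C m * (X - 1) ^ 3, X] : Fin 4 → ℂ[X]) j).eval 3,
      ⟨3, by norm_num, fun j => rfl⟩, ?_⟩
    intro h
    have := congrFun h 3
    simp at this
  · rintro x ⟨s, hs, hx⟩
    rw [map_sub, aff_eval_X, aff_eval_C, hx 0]
    simp
  · simpa [sub_ne_zero] using Ne.symm hτ2

end Surfaces

/-! ### Traces of words in three elements of SL(2) -/

section TraceAlgebra

variable {R : Type*} [CommRing R]

/-- If the traces of `x`, `y`, `z` and of their products in this order lie in a subring `S`, then so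
do the traces of all elements of the algebra that `x`, `y`, `z` generate over `S`. -/
theorem exists_trace_subring (S : Subring R) (x y z : SL(2, R)) (hx : (mat x).trace ∈ S)
    (hy : (mat y).trace ∈ S) (hz : (mat z).trace ∈ S) (hxy : (mat (x * y)).trace ∈ S)
    (hxz : (mat (x * z)).trace ∈ S) (hyz : (mat (y * z)).trace ∈ S)
    (hxyz : (mat (x * y * z)).trace ∈ S) :
    ∃ N : Subring (Matrix (Fin 2) (Fin 2) R), mat x ∈ N ∧ mat y ∈ N ∧ mat z ∈ N ∧
      (∀ c ∈ S, c • (1 : Matrix (Fin 2) (Fin 2) R) ∈ N) ∧ ∀ w ∈ N, w.trace ∈ S := by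
  -- This span is stable under right multiplication by `x` and `y`, which `PX` and `PY` establish.
  let P : Submodule S (Matrix (Fin 2) (Fin 2) R) :=
    Submodule.span S {1, mat x, mat y, mat x * mat y}
  have hsmul : ∀ c ∈ S, ∀ m ∈ P, c • m ∈ P := fun c hc m hm => P.smul_mem (⟨c, hc⟩ : S) hm
  have h1 : 1 ∈ P := Submodule.subset_span (by simp)
  have hX : mat x ∈ P := Submodule.subset_span (by simp)
  have hY : mat y ∈ P := Submodule.subset_span (by simp)
  have hXY : mat x * mat y ∈ P := Submodule.subset_span (by simp)
  have hind : ∀ {p : Matrix (Fin 2) (Fin 2) R → Prop}, p 1 → p (mat x) → p (mat y) →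
      p (mat x * mat y) → p 0 → (∀ a b, p a → p b → p (a + b)) →
      (∀ c ∈ S, ∀ a, p a → p (c • a)) → ∀ m ∈ P, p m := by
    intro p p1 px py pxy p0 padd psmul m hm
    induction hm using Submodule.span_induction with
    | mem m hm =>
      simp only [Set.mem_insert_iff, Set.mem_singleton_iff] at hm
      rcases hm with rfl | rfl | rfl | rfl <;> assumption
    | zero => exact p0
    | add a b _ _ ha hb => exact padd a b ha hb
    | smul c a _ ha => exact psmul c c.2 a ha
  have eYX : mat y * mat x = -(mat x * mat y) + (mat y).trace • mat x + (mat x).trace • mat y +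
      ((mat (x * y)).trace - (mat x).trace * (mat y).trace) • 1 := by
    rw [mat_mul]; exact matrix_mul_comm_eq _ _
  have eZX : mat z * mat x = -(mat x * mat z) + (mat z).trace • mat x + (mat x).trace • mat z +
      ((mat (x * z)).trace - (mat x).trace * (mat z).trace) • 1 := by
    rw [mat_mul]; exact matrix_mul_comm_eq _ _
  have eZY : mat z * mat y = -(mat y * mat z) + (mat z).trace • mat y + (mat y).trace • mat z +
      ((mat (y * z)).trace - (mat y).trace * (mat z).trace) • 1 := by
    rw [mat_mul]; exact matrix_mul_comm_eq _ _
  have cxy := S.sub_mem hxy (S.mul_mem hx hy)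
  have cxz := S.sub_mem hxz (S.mul_mem hx hz)
  have cyz := S.sub_mem hyz (S.mul_mem hy hz)
  have PX : ∀ m ∈ P, m * mat x ∈ P := by
    refine hind ?_ ?_ ?_ ?_ ?_ ?_ ?_
    · rwa [one_mul]
    · rw [mat_mul_self]
      exact P.sub_mem (hsmul _ hx _ hX) h1
    · rw [eYX]
      exact P.add_mem (P.add_mem (P.add_mem (P.neg_mem hXY) (hsmul _ hy _ hX)) (hsmul _ hx _ hY))
        (hsmul _ cxy _ h1)
    · rw [mat_mul_mul]
      exact P.sub_mem (P.add_mem (hsmul _ hxy _ hX) hY) (hsmul _ hy _ h1)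
    · rw [zero_mul]; exact P.zero_mem
    · intro a b ha hb
      rw [add_mul]; exact P.add_mem ha hb
    · intro c hc a ha
      rw [smul_mul_assoc]; exact hsmul c hc _ ha
  have PY : ∀ m ∈ P, m * mat y ∈ P := by
    refine hind ?_ ?_ ?_ ?_ ?_ ?_ ?_
    · rwa [one_mul]
    · exact hXY
    · rw [mat_mul_self]
      exact P.sub_mem (hsmul _ hy _ hY) h1
    · rw [mul_assoc, mat_mul_self, mul_sub, mul_smul_comm, mul_one]
      exact P.sub_mem (hsmul _ hy _ hXY) hX
    · rw [zero_mul]; exact P.zero_mem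
    · intro a b ha hb
      rw [add_mul]; exact P.add_mem ha hb
    · intro c hc a ha
      rw [smul_mul_assoc]; exact hsmul c hc _ ha
  have Ptr : ∀ m ∈ P, m.trace ∈ S ∧ (m * mat z).trace ∈ S := by
    refine hind ⟨?_, by rwa [one_mul]⟩ ⟨hx, by rwa [← mat_mul]⟩ ⟨hy, by rwa [← mat_mul]⟩
      ⟨by rwa [← mat_mul], by rwa [← mat_mul, ← mat_mul]⟩ ?_ ?_ ?_
    · rw [Matrix.trace_one]
      exact natCast_mem S _
    · simp only [zero_mul, Matrix.trace_zero]
      exact ⟨S.zero_mem, S.zero_mem⟩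
    · rintro a b ⟨ha, ha'⟩ ⟨hb, hb'⟩
      rw [add_mul, Matrix.trace_add, Matrix.trace_add]
      exact ⟨S.add_mem ha hb, S.add_mem ha' hb'⟩
    · rintro c hc a ⟨ha, ha'⟩
      rw [smul_mul_assoc, Matrix.trace_smul, Matrix.trace_smul]
      exact ⟨S.mul_mem hc ha, S.mul_mem hc ha'⟩
  -- P + Pz is stable under right multiplication by all three generators, since z can be moved to
  -- the right. Its right multipliers form the ring `N`; as 1 lies in `M`, so does every multiplier,
  -- and on `M` the traces are controlled by `Ptr`.
  let M : Set (Matrix (Fin 2) (Fin 2) R) := {w | ∃ m ∈ P, ∃ n ∈ P, w = m + n * mat z}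
  have hMadd : ∀ a ∈ M, ∀ b ∈ M, a + b ∈ M := by
    rintro _ ⟨m, hm, n, hn, rfl⟩ _ ⟨m', hm', n', hn', rfl⟩
    exact ⟨m + m', P.add_mem hm hm', n + n', P.add_mem hn hn', by rw [add_mul]; abel⟩
  have hMneg : ∀ a ∈ M, -a ∈ M := by
    rintro _ ⟨m, hm, n, hn, rfl⟩
    exact ⟨-m, P.neg_mem hm, -n, P.neg_mem hn, by rw [neg_mul]; abel⟩
  have hM0 : (0 : Matrix (Fin 2) (Fin 2) R) ∈ M :=
    ⟨0, P.zero_mem, 0, P.zero_mem, by rw [zero_mul, add_zero]⟩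
  let N : Subring (Matrix (Fin 2) (Fin 2) R) :=
    { carrier := {w | ∀ m ∈ M, m * w ∈ M}
      mul_mem' := fun {a b} ha hb m hm => by rw [← mul_assoc]; exact hb _ (ha m hm)
      one_mem' := fun m hm => by rwa [mul_one]
      add_mem' := fun {a b} ha hb m hm => by rw [mul_add]; exact hMadd _ (ha m hm) _ (hb m hm)
      zero_mem' := fun m hm => by rw [mul_zero]; exact hM0
      neg_mem' := fun {a} ha m hm => by rw [mul_neg]; exact hMneg _ (ha m hm) }
  refine ⟨N, ?_, ?_, ?_, ?_, ?_⟩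
  · rintro _ ⟨m, hm, n, hn, rfl⟩
    refine ⟨m * mat x + (mat z).trace • (n * mat x) +
        ((mat (x * z)).trace - (mat x).trace * (mat z).trace) • n,
      P.add_mem (P.add_mem (PX _ hm) (hsmul _ hz _ (PX _ hn))) (hsmul _ cxz _ hn),
      -(n * mat x) + (mat x).trace • n,
      P.add_mem (P.neg_mem (PX _ hn)) (hsmul _ hx _ hn), ?_⟩
    rw [add_mul, mul_assoc n, eZX]
    simp only [mul_add, add_mul, mul_neg, neg_mul, mul_smul_comm, smul_mul_assoc, mul_one, mul_assoc]
    abel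
  · rintro _ ⟨m, hm, n, hn, rfl⟩
    refine ⟨m * mat y + (mat z).trace • (n * mat y) +
        ((mat (y * z)).trace - (mat y).trace * (mat z).trace) • n,
      P.add_mem (P.add_mem (PY _ hm) (hsmul _ hz _ (PY _ hn))) (hsmul _ cyz _ hn),
      -(n * mat y) + (mat y).trace • n,
      P.add_mem (P.neg_mem (PY _ hn)) (hsmul _ hy _ hn), ?_⟩
    rw [add_mul, mul_assoc n, eZY]
    simp only [mul_add, add_mul, mul_neg, neg_mul, mul_smul_comm, smul_mul_assoc, mul_one, mul_assoc]
    abel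
  · rintro _ ⟨m, hm, n, hn, rfl⟩
    refine ⟨-n, P.neg_mem hn, m + (mat z).trace • n, P.add_mem hm (hsmul _ hz _ hn), ?_⟩
    rw [add_mul, mul_assoc n, mat_mul_self]
    simp only [mul_sub, add_mul, mul_smul_comm, smul_mul_assoc, mul_one]
    abel
  · rintro c hc _ ⟨m, hm, n, hn, rfl⟩
    refine ⟨c • m, hsmul c hc _ hm, c • n, hsmul c hc _ hn, ?_⟩
    simp only [mul_smul_comm, smul_mul_assoc, mul_one, smul_add]
  · intro w hw
    obtain ⟨m, hm, n, hn, h⟩ := hw 1 ⟨1, h1, 0, P.zero_mem, by rw [zero_mul, add_zero]⟩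
    rw [one_mul] at h
    rw [h, Matrix.trace_add]
    exact S.add_mem (Ptr m hm).1 (Ptr n hn).2

/-- If a subring of matrices contains the scalars of a subring `S` and the traces of its elements lie
in `S`, the elements of `SL(2)` in it form a subgroup. -/
theorem mat_mem_of_mem_closure {S : Subring R} {N : Subring (Matrix (Fin 2) (Fin 2) R)}
    (hS : ∀ c ∈ S, c • (1 : Matrix (Fin 2) (Fin 2) R) ∈ N) (hN : ∀ w ∈ N, w.trace ∈ S)
    {T : Set SL(2, R)} (hT : ∀ a ∈ T, mat a ∈ N) {g : SL(2, R)} (hg : g ∈ Subgroup.closure T) :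
    mat g ∈ N := by
  induction hg using Subgroup.closure_induction with
  | mem a ha => exact hT a ha
  | one => exact N.one_mem
  | mul a b _ _ ha hb => rw [mat_mul]; exact N.mul_mem ha hb
  | inv a _ ha =>
    rw [mat_inv]
    exact N.sub_mem (hS _ (hN _ ha)) ha

end TraceAlgebra

/-! ### Irreducible representations and their characters -/

section Irreducible

variable {Γ : Type*} [Group Γ]

/-- Two vectors in the kernel of a nonzero matrix of size two are proportional. -/
theorem exists_smul_eq_of_mulVec_eq_zero {W : Matrix (Fin 2) (Fin 2) ℂ} (hW : W ≠ 0)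
    {u v : Fin 2 → ℂ} (hu : u ≠ 0) (h1 : W.mulVec u = 0) (h2 : W.mulVec v = 0) :
    ∃ c : ℂ, v = c • u := by
  have e1 := congrFun h1
  have e2 := congrFun h2
  simp only [Fin.forall_fin_two, Matrix.mulVec, dotProduct, Fin.sum_univ_two, Pi.zero_apply]
    at e1 e2
  have hd : u 0 * v 1 - u 1 * v 0 = 0 := by
    by_contra hne
    refine hW ?_
    ext i j
    have k0 : ∀ i, W i 0 * (u 0 * v 1 - u 1 * v 0) = 0 := Fin.forall_fin_two.2
      ⟨by linear_combination v 1 * e1.1 - u 1 * e2.1, by linear_combination v 1 * e1.2 - u 1 * e2.2⟩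
    have k1 : ∀ i, W i 1 * (u 0 * v 1 - u 1 * v 0) = 0 := Fin.forall_fin_two.2
      ⟨by linear_combination u 0 * e2.1 - v 0 * e1.1, by linear_combination u 0 * e2.2 - v 0 * e1.2⟩
    fin_cases j
    · exact (mul_eq_zero.1 (k0 i)).resolve_right hne
    · exact (mul_eq_zero.1 (k1 i)).resolve_right hne
  by_cases h0 : u 0 = 0
  · have h1 : u 1 ≠ 0 := fun h1 => hu (by ext i; fin_cases i; exacts [h0, h1])
    refine ⟨v 1 / u 1, ?_⟩
    ext i
    fin_cases i
    · have : v 0 = 0 := by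
        rw [h0, zero_mul, zero_sub, neg_eq_zero] at hd
        exact (mul_eq_zero.1 hd).resolve_left h1
      simp [h0, this]
    · simp [h1]
  · refine ⟨v 0 / u 0, ?_⟩
    ext i
    fin_cases i
    · simp [h0]
    · simp only [Fin.mk_one, Pi.smul_apply, smul_eq_mul]
      field_simp
      linear_combination hd

theorem exists_eigenvalue (A : Matrix (Fin 2) (Fin 2) ℂ) : ∃ c : ℂ, (A - c • 1).det = 0 := by
  obtain ⟨s, hs⟩ := IsAlgClosed.exists_pow_nat_eq (A.trace ^ 2 - 4 * A.det) two_pos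
  refine ⟨(A.trace + s) / 2, ?_⟩
  simp only [Matrix.det_fin_two, Matrix.trace_fin_two, Matrix.sub_apply, Matrix.smul_apply,
    Matrix.one_apply, smul_eq_mul] at hs ⊢
  simp
  linear_combination hs / 4

theorem IsIrrep.exists_not_scalar {ρ : Γ →* SL(2, ℂ)} (hρ : IsIrrep ρ) :
    ∃ g, ∀ c : ℂ, mat (ρ g) ≠ c • 1 := by
  by_contra! h
  refine hρ ⟨![1, 0], fun h => one_ne_zero (congrFun h 0), fun g => ?_⟩
  obtain ⟨c, hc⟩ := h g
  exact ⟨c, by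
    change (mat (ρ g)).mulVec _ = _
    rw [hc, Matrix.smul_mulVec, Matrix.one_mulVec]⟩

/-- The values of an irreducible representation separate matrices under the trace form. -/
theorem IsIrrep.eq_zero_of_trace_mul {ρ : Γ →* SL(2, ℂ)} (hρ : IsIrrep ρ)
    {W : Matrix (Fin 2) (Fin 2) ℂ} (hW : ∀ g, (W * mat (ρ g)).trace = 0) : W = 0 := by
  -- A singular V satisfies V A V = tr(VA) V, so V ρ(g) V = 0 for all g. If V ≠ 0, its image is then
  -- a line that equals its kernel and is invariant under ρ.
  have key : ∀ V : Matrix (Fin 2) (Fin 2) ℂ, (∀ g, (V * mat (ρ g)).trace = 0) → V.det = 0 →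
      V = 0 := by
    intro V hV hd
    by_contra hne
    have hVV : ∀ A : Matrix (Fin 2) (Fin 2) ℂ, V * A * V = (V * A).trace • V := by
      intro A
      rw [Matrix.det_fin_two] at hd
      ext i j
      fin_cases i <;> fin_cases j <;>
        simp [Matrix.trace_fin_two, Matrix.mul_apply, Fin.sum_univ_two]
      · linear_combination -A 1 1 * hd
      · linear_combination A 0 1 * hd
      · linear_combination A 1 0 * hd
      · linear_combination -A 0 0 * hd
    obtain ⟨e, he⟩ : ∃ e, V.mulVec e ≠ 0 := by
      by_contra! h
      exact hne (Matrix.ext_of_mulVec_single fun i => by rw [h, Matrix.zero_mulVec])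
    have hk : ∀ g, V.mulVec ((mat (ρ g)).mulVec (V.mulVec e)) = 0 := fun g => by
      rw [Matrix.mulVec_mulVec, Matrix.mulVec_mulVec, hVV, hV, zero_smul, Matrix.zero_mulVec]
    refine hρ ⟨V.mulVec e, he, fun g => ?_⟩
    refine exists_smul_eq_of_mulVec_eq_zero hne he ?_ (hk g)
    have := hk 1
    rwa [map_one, mat, Matrix.SpecialLinearGroup.coe_one, Matrix.one_mulVec] at this
  obtain ⟨g, hg⟩ := hρ.exists_not_scalar
  obtain ⟨c, hc⟩ := exists_eigenvalue (mat (ρ g))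
  refine key W hW ?_
  -- Multiplying W by the nonzero singular matrix ρ(g) - c keeps the orthogonality and gives a
  -- singular matrix, hence zero. So W is not invertible, and `key` applies to W itself.
  have h0 := key (W * (mat (ρ g) - c • 1)) (fun k => ?_) (by rw [Matrix.det_mul, hc, mul_zero])
  · by_contra hd
    refine hg c (sub_eq_zero.1 ?_)
    have hu : IsUnit W.det := isUnit_iff_ne_zero.2 hd
    rw [← Matrix.nonsing_inv_mul_cancel_left (A := W) (mat (ρ g) - c • 1) hu, h0, mul_zero]
  · rw [mul_sub, sub_mul, Matrix.trace_sub, mul_smul_comm, mul_one, smul_mul_assoc,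
      Matrix.trace_smul, hW, mul_assoc, ← mat_mul, ← map_mul, hW, smul_zero, sub_zero]

/-- By nondegeneracy of the trace form, a relation in an irreducible representation can be read off
its character. It is therefore a closed condition and can be carried between representations. -/
theorem IsIrrep.eq_of_character {ρ : Γ →* SL(2, ℂ)} (hρ : IsIrrep ρ) {a b : Γ}
    (h : ∀ g, character ρ (a * g) = character ρ (b * g)) : ρ a = ρ b := by
  refine mat_injective (sub_eq_zero.1 (hρ.eq_zero_of_trace_mul fun g => ?_))
  have := h g
  simp only [character, tr, map_mul] at this
  rw [sub_mul, Matrix.trace_sub, ← mat_mul, ← mat_mul, sub_eq_zero]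
  exact this

theorem character_mul_eq {ρ : Γ →* SL(2, ℂ)} {a b : Γ} (h : ρ a = ρ b) (g : Γ) :
    character ρ (a * g) = character ρ (b * g) := by
  simp only [character, map_mul, h]

/-- The relations that hold in a representation hold in any irreducible representation whose
character is in the closure of characters for which they hold. -/
theorem IsIrrep.eq_of_mem_closure {ρ : Γ →* SL(2, ℂ)} (hρ : IsIrrep ρ) {V : Set (Aff Γ)}
    (hV : character ρ ∈ closure V) {a b : Γ}
    (h : ∀ χ ∈ V, ∃ ρ' : Γ →* SL(2, ℂ), χ = character ρ' ∧ ρ' a = ρ' b) : ρ a = ρ b := by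
  refine hρ.eq_of_character fun g => ?_
  have := mem_closure_iff_eval.1 hV (.X (a * g) - .X (b * g)) fun χ hχ => by
    obtain ⟨ρ', rfl, h'⟩ := h χ hχ
    rw [map_sub, aff_eval_X, aff_eval_X, character_mul_eq h', sub_self]
  rwa [map_sub, aff_eval_X, aff_eval_X, sub_eq_zero] at this

theorem IsIrrep.eq_of_character_eq {ρ ρ' : Γ →* SL(2, ℂ)} (hρ : IsIrrep ρ)
    (hχ : character ρ = character ρ') {a b : Γ} (h : ρ' a = ρ' b) : ρ a = ρ b :=
  hρ.eq_of_character fun g => by rw [hχ, character_mul_eq h]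

/-- If the image were commutative, it would preserve each eigenspace of a non-scalar value, which is
a line. -/
theorem IsIrrep.exists_not_commute {ρ : Γ →* SL(2, ℂ)} (hρ : IsIrrep ρ) :
    ∃ a b, ρ (a * b) ≠ ρ (b * a) := by
  by_contra! h
  obtain ⟨g, hg⟩ := hρ.exists_not_scalar
  obtain ⟨c, hc⟩ := exists_eigenvalue (mat (ρ g))
  obtain ⟨u, hu, hu0⟩ := Matrix.exists_mulVec_eq_zero_iff.2 hc
  refine hρ ⟨u, hu, fun k => exists_smul_eq_of_mulVec_eq_zero (sub_ne_zero.2 (hg c)) hu hu0 ?_⟩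
  have : (mat (ρ g) - c • 1) * mat (ρ k) = mat (ρ k) * (mat (ρ g) - c • 1) := by
    rw [sub_mul, mul_sub, smul_mul_assoc, mul_smul_comm, one_mul, mul_one, ← mat_mul, ← mat_mul,
      ← map_mul, ← map_mul, h]
  change (mat (ρ g) - c • 1).mulVec ((mat (ρ k)).mulVec u) = 0
  rw [Matrix.mulVec_mulVec, this, ← Matrix.mulVec_mulVec, hu0, Matrix.mulVec_zero]

/-- The expression is minus the determinant of xy - yx, and a common eigenvector lies in the kernel
of that matrix. -/
theorem isIrrep_of_trace {ρ : Γ →* SL(2, ℂ)} {a b : Γ} {x y : SL(2, ℂ)} (ha : ρ a = x)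
    (hb : ρ b = y)
    (h : tr x ^ 2 + tr y ^ 2 + tr (x * y) ^ 2 - tr x * tr y * tr (x * y) - 4 ≠ 0) :
    IsIrrep ρ := by
  subst ha hb
  rintro ⟨v, hv, h'⟩
  obtain ⟨c, hc⟩ := h' a
  obtain ⟨d, hd⟩ := h' b
  have h0 : (mat (ρ a) * mat (ρ b) - mat (ρ b) * mat (ρ a)).det = 0 := by
    refine Matrix.exists_mulVec_eq_zero_iff.1 ⟨v, hv, ?_⟩
    rw [Matrix.sub_mulVec, ← Matrix.mulVec_mulVec, ← Matrix.mulVec_mulVec]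
    change (mat (ρ a)).mulVec v = _ at hc
    change (mat (ρ b)).mulVec v = _ at hd
    rw [hc, hd, Matrix.mulVec_smul, Matrix.mulVec_smul, hc, hd, smul_comm, sub_self]
  have e : ∀ A B : Matrix (Fin 2) (Fin 2) ℂ, (A * B - B * A).det = 4 * A.det * B.det -
      B.det * A.trace ^ 2 - A.det * B.trace ^ 2 - (A * B).trace ^ 2 +
      A.trace * B.trace * (A * B).trace := by
    intro A B
    simp only [Matrix.det_fin_two, Matrix.trace_fin_two, Matrix.sub_apply, Matrix.mul_apply,
      Fin.sum_univ_two]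
    ring
  rw [e, Matrix.SpecialLinearGroup.det_coe, Matrix.SpecialLinearGroup.det_coe, ← mat_mul] at h0
  refine h ?_
  simp only [tr]
  linear_combination -h0

end Irreducible

/-! ### Realizing points of the hypersurface by matrices -/

section Realization

theorem exists_add_eq_mul_eq_one (t : ℂ) : ∃ m n : ℂ, m + n = t ∧ m * n = 1 := by
  obtain ⟨s, hs⟩ := IsAlgClosed.exists_pow_nat_eq (t ^ 2 - 4) two_pos
  exact ⟨(t + s) / 2, (t - s) / 2, by ring, by linear_combination -hs / 4⟩

/-- A matrix of size two and determinant one. -/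
def mkSL (a b c d : ℂ) (h : a * d - b * c = 1) : SL(2, ℂ) :=
  ⟨!![a, b; c, d], by rw [Matrix.det_fin_two_of, h]⟩

theorem tr_mkSL {a b c d : ℂ} (h : a * d - b * c = 1) : tr (mkSL a b c d h) = a + d :=
  Matrix.trace_fin_two_of a b c d

theorem mkSL_mul {a b c d a' b' c' d' : ℂ} (h : a * d - b * c = 1) (h' : a' * d' - b' * c' = 1) :
    mkSL a b c d h * mkSL a' b' c' d' h' =
      mkSL (a * a' + b * c') (a * b' + b * d') (c * a' + d * c') (c * b' + d * d')
        (by linear_combination h' + (a' * d' - b' * c') * h) :=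
  mat_injective (Matrix.mul_fin_two ..)

theorem mkSL_mulVec {a b c d : ℂ} (h : a * d - b * c = 1) (v : Fin 2 → ℂ) :
    (mat (mkSL a b c d h)).mulVec v = ![a * v 0 + b * v 1, c * v 0 + d * v 1] := by
  change (!![a, b; c, d]).mulVec v = _
  ext i
  fin_cases i <;> simp [Matrix.mulVec, dotProduct, Fin.sum_univ_two]

/-- Every point of the hypersurface is given by the traces of a triple. -/
theorem exists_triple {t u r : ℂ} (h : fpoly t 1 1 u r = 0) :
    ∃ x y z : SL(2, ℂ), tr x = t ∧ tr y = t ∧ tr z = t ∧ tr (x * y) = 1 ∧ tr (x * z) = 1 ∧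
      tr (y * z) = u ∧ tr (x * y * z) = r ∧
      (t ^ 2 = 3 → u ≠ 1 → ∀ v : Fin 2 → ℂ, ∀ c d e : ℂ, (mat x).mulVec v = c • v →
        (mat y).mulVec v = d • v → (mat z).mulVec v = e • v → v = 0) := by
  by_cases ht : t ^ 2 = 3
  -- For t² = 3 the equation factors as (r - m(u-1))(r - n(u-1)) = 0 with eigenvalues m, n, named so
  -- that the first factor vanishes. Since m² + n² = 1, a diagonal, an upper and a lower triangular
  -- matrix have the required traces.
  · obtain ⟨m, n, hmn, h1, hr⟩ : ∃ m n : ℂ, m + n = t ∧ m * n = 1 ∧ r = m * (u - 1) := by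
      obtain ⟨m, n, hmn, h1⟩ := exists_add_eq_mul_eq_one t
      have h2 : (r - m * (u - 1)) * (r - n * (u - 1)) = 0 := by
        rw [fpoly] at h
        linear_combination h - (r * t + 1 - u) * ht + (u - 1) ^ 2 * h1 - r * (u - 1) * hmn
      rcases mul_eq_zero.1 h2 with h2 | h2
      · exact ⟨m, n, hmn, h1, sub_eq_zero.1 h2⟩
      · exact ⟨n, m, by rw [add_comm, hmn], by rw [mul_comm, h1], sub_eq_zero.1 h2⟩
    have e : m ^ 2 + n ^ 2 = 1 := by linear_combination (m + n + t) * hmn + ht - 2 * h1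
    refine ⟨mkSL m 0 0 n (by linear_combination h1), mkSL m 1 0 n (by linear_combination h1),
      mkSL m 0 (u - 1) n (by linear_combination h1), ?_, ?_, ?_, ?_, ?_, ?_, ?_, ?_⟩
    · rw [tr_mkSL, hmn]
    · rw [tr_mkSL, hmn]
    · rw [tr_mkSL, hmn]
    · rw [mkSL_mul, tr_mkSL]; linear_combination e
    · rw [mkSL_mul, tr_mkSL]; linear_combination e
    · rw [mkSL_mul, tr_mkSL]; linear_combination e
    · rw [mkSL_mul, mkSL_mul, tr_mkSL]; linear_combination (m + n) * e - (m + n) * h1 - hr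
    · intro _ hu v c d e' hx hy hz
      rw [mkSL_mulVec] at hx hy hz
      have hx0 : m * v 0 + 0 * v 1 = c * v 0 := congrFun hx 0
      have hx1 : 0 * v 0 + n * v 1 = c * v 1 := congrFun hx 1
      have hy0 : m * v 0 + 1 * v 1 = d * v 0 := congrFun hy 0
      have hz1 : (u - 1) * v 0 + n * v 1 = e' * v 1 := congrFun hz 1
      have hmn' : m - n ≠ 0 := fun h0 => by
        have : (m - n) ^ 2 = -1 := by linear_combination e - 2 * h1
        rw [h0] at this
        norm_num at this
      have h01 : v 0 * v 1 = 0 :=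
        mul_left_cancel₀ hmn' (by linear_combination v 1 * hx0 - v 0 * hx1)
      have h0 : v 0 = 0 ∧ v 1 = 0 := by
        rcases mul_eq_zero.1 h01 with h0 | h0
        · refine ⟨h0, ?_⟩
          rw [h0] at hy0
          linear_combination hy0
        · refine ⟨?_, h0⟩
          rw [h0] at hz1
          exact mul_left_cancel₀ (sub_ne_zero.2 hu) (by linear_combination hz1)
      ext i
      fin_cases i
      exacts [h0.1, h0.2]
  -- For t² ≠ 3, k = 3 - t² makes tr(xy) = 1. The prescribed traces of z, xz, yz, xyz are four
  -- linear equations for the entries of z, solved by p and q; the condition det z = 1 then becomes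
  -- the equation of the hypersurface.
  · obtain ⟨m, n, rfl, h1⟩ := exists_add_eq_mul_eq_one t
    have hk : 3 - (m + n) ^ 2 ≠ 0 := fun h0 => ht (by linear_combination -h0)
    obtain ⟨k, hk'⟩ : ∃ k, k = 3 - (m + n) ^ 2 := ⟨_, rfl⟩
    obtain ⟨p, hp⟩ : ∃ p, p = n * (1 + u) - n ^ 2 * (m + n) - r := ⟨_, rfl⟩
    obtain ⟨q, hq⟩ : ∃ q, k * q = u - m * p - n * (m + n - p) :=
      ⟨(u - m * p - n * (m + n - p)) / k, mul_div_cancel₀ _ (hk' ▸ hk)⟩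
    have hd : p * (m + n - p) - q * (1 - m * p - n * (m + n - p)) = 1 := by
      rw [← hk'] at hk
      refine mul_left_cancel₀ hk ?_
      rw [fpoly] at h
      have hn : n ≠ 0 := right_ne_zero_of_mul_eq_one h1
      obtain rfl : m = n⁻¹ := eq_inv_of_mul_eq_one_left h1
      calc _ = k * (p * (n⁻¹ + n - p)) - (k * q) * (1 - n⁻¹ * p - n * (n⁻¹ + n - p)) := by ring
        _ = k * 1 := by
          rw [hq, hk', hp]
          linear_combination (norm := skip) h
          field_simp
          ring
    refine ⟨mkSL m 1 0 n (by linear_combination h1), mkSL m 0 k n (by linear_combination h1),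
      mkSL p q (1 - m * p - n * (m + n - p)) (m + n - p) hd, ?_, ?_, ?_, ?_, ?_, ?_, ?_, ?_⟩
    · rw [tr_mkSL]
    · rw [tr_mkSL]
    · rw [tr_mkSL]; ring
    · rw [mkSL_mul, tr_mkSL]; linear_combination hk' - 2 * h1
    · rw [mkSL_mul, tr_mkSL]; ring
    · rw [mkSL_mul, tr_mkSL]; linear_combination hq
    · rw [mkSL_mul, mkSL_mul, tr_mkSL]; grind
    · exact fun h0 => absurd h0 ht

end Realization

/-! ### Trace functions on families of triples -/

section TraceFunctions

variable {ι τ : Type*}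

/-- A family of elements of `SL(2,ℂ)`, as an element of `SL(2)` of the ring of functions. -/
def piSL : (ι → SL(2, ℂ)) →* SL(2, ι → ℂ) where
  toFun f := ⟨Matrix.of fun i j p => f p i j, by
    refine funext fun p => ?_
    have := (f p).det_coe
    rw [Matrix.det_fin_two] at this ⊢
    exact this⟩
  map_one' := by
    ext i j p
    fin_cases i <;> fin_cases j <;> rfl
  map_mul' f g := by
    ext i j p
    change (mat (f p * g p)) i j = (∑ k, (fun p => f p i k) * (fun p => g p k j) : ι → ℂ) p
    rw [mat_mul, Matrix.mul_apply, Finset.sum_apply]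
    rfl

theorem trace_piSL (f : ι → SL(2, ℂ)) : (mat (piSL f)).trace = fun p => tr (f p) := by
  refine funext fun p => ?_
  rw [tr, Matrix.trace_fin_two, Matrix.trace_fin_two]
  rfl

/-- The functions on `ι` that are polynomials in given coordinates, divided by powers of `D`. -/
def coordSubring (q : ι → Aff τ) (D : MvPolynomial τ ℂ) : Subring (ι → ℂ) where
  carrier := {f | ∃ (P : MvPolynomial τ ℂ) (n : ℕ), ∀ i,
    f i * MvPolynomial.eval (q i) D ^ n = MvPolynomial.eval (q i) P}
  mul_mem' := by
    rintro f g ⟨P, n, hf⟩ ⟨Q, m, hg⟩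
    refine ⟨P * Q, n + m, fun i => ?_⟩
    rw [map_mul, ← hf, ← hg, Pi.mul_apply]
    ring
  one_mem' := ⟨1, 0, fun i => by simp⟩
  add_mem' := by
    rintro f g ⟨P, n, hf⟩ ⟨Q, m, hg⟩
    refine ⟨P * D ^ m + Q * D ^ n, n + m, fun i => ?_⟩
    rw [map_add, map_mul, map_mul, ← hf, ← hg, map_pow, map_pow, Pi.add_apply]
    ring
  zero_mem' := ⟨0, 0, fun i => by simp⟩
  neg_mem' := by
    rintro f ⟨P, n, hf⟩
    exact ⟨-P, n, fun i => by rw [map_neg, ← hf, Pi.neg_apply, neg_mul]⟩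

theorem eval_mem_coordSubring (q : ι → Aff τ) (D P : MvPolynomial τ ℂ) :
    (fun i => MvPolynomial.eval (q i) P) ∈ coordSubring q D :=
  ⟨P, 0, fun i => by rw [pow_zero, mul_one]⟩

/-- Traces of words lie in any ring of functions that contains the traces of the generators and of
their products. -/
theorem tr_mem_of_mem_closure (S : Subring (ι → ℂ)) {x y z : ι → SL(2, ℂ)}
    (hx : (fun i => tr (x i)) ∈ S) (hy : (fun i => tr (y i)) ∈ S) (hz : (fun i => tr (z i)) ∈ S)
    (hxy : (fun i => tr (x i * y i)) ∈ S) (hxz : (fun i => tr (x i * z i)) ∈ S)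
    (hyz : (fun i => tr (y i * z i)) ∈ S) (hxyz : (fun i => tr (x i * y i * z i)) ∈ S)
    {T : Set (ι → SL(2, ℂ))}
    (hT : ∀ N : Subring (Matrix (Fin 2) (Fin 2) (ι → ℂ)), mat (piSL x) ∈ N → mat (piSL y) ∈ N →
      mat (piSL z) ∈ N → (∀ c ∈ S, c • (1 : Matrix (Fin 2) (Fin 2) (ι → ℂ)) ∈ N) →
      ∀ a ∈ T, mat (piSL a) ∈ N)
    {g : ι → SL(2, ℂ)} (hg : g ∈ Subgroup.closure T) : (fun i => tr (g i)) ∈ S := by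
  obtain ⟨N, h1, h2, h3, hS, hN⟩ := exists_trace_subring S (piSL x) (piSL y) (piSL z)
    (by rwa [trace_piSL]) (by rwa [trace_piSL]) (by rwa [trace_piSL])
    (by rw [← map_mul, trace_piSL]; exact hxy) (by rw [← map_mul, trace_piSL]; exact hxz)
    (by rw [← map_mul, trace_piSL]; exact hyz)
    (by rw [← map_mul, ← map_mul, trace_piSL]; exact hxyz)
  rw [← trace_piSL]
  refine hN _ (mat_mem_of_mem_closure (T := piSL '' T) hS hN ?_ ?_)
  · rintro _ ⟨a, ha, rfl⟩
    exact hT N h1 h2 h3 hS a ha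
  · rw [← MonoidHom.map_closure]
    exact ⟨g, hg, rfl⟩

end TraceFunctions

/-! ### Isomorphisms and closedness from formulas for the coordinates -/

section Isomorphisms

variable {σ τ : Type*}

/-- A regular map is an isomorphism onto its image if the coordinates of a point are regular
functions of its image. -/
theorem isIsomorphismOn_of_surjOn {f : Aff σ → Aff τ} {Y : Set (Aff σ)} {Z : Set (Aff τ)}
    (hf : IsRegularMapOn Y f) (hm : Set.MapsTo f Y Z) (hs : ∀ z ∈ Z, ∃ y ∈ Y, f y = z)
    {D : MvPolynomial τ ℂ} (hD : ∀ z ∈ Z, MvPolynomial.eval z D ≠ 0)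
    (hP : ∀ s, ∃ (P : MvPolynomial τ ℂ) (n : ℕ), ∀ y ∈ Y,
      y s * MvPolynomial.eval (f y) D ^ n = MvPolynomial.eval (f y) P) :
    IsIsomorphismOn f Y Z := by
  choose P n hP using hP
  have hl : ∀ y ∈ Y, (fun s => MvPolynomial.eval (f y) (P s) /
      MvPolynomial.eval (f y) (D ^ n s)) = y := fun y hy => funext fun s => by
    rw [← hP s y hy, map_pow, mul_div_cancel_right₀ _ (pow_ne_zero _ (hD _ (hm hy)))]
  refine ⟨hf, hm, fun z s => MvPolynomial.eval z (P s) / MvPolynomial.eval z (D ^ n s), ?_, ?_,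
    hl, ?_⟩
  · intro s z hz
    refine ⟨P s, D ^ n s, ?_, fun _ _ _ => rfl⟩
    rw [map_pow]
    exact pow_ne_zero _ (hD z hz)
  · intro z hz
    obtain ⟨y, hy, rfl⟩ := hs z hz
    exact Set.mem_of_eq_of_mem (hl y hy) hy
  · intro z hz
    obtain ⟨y, hy, rfl⟩ := hs z hz
    exact congrArg f (hl y hy)

theorem isRegularMapOn_comp (Y : Set (Aff σ)) {f : Aff σ → Aff τ} (γ : τ → σ)
    (hf : ∀ y j, f y j = y (γ j)) : IsRegularMapOn Y f := fun j =>
  (IsRegularOn.of_polynomial Y (.X (γ j))).congr fun y _ => by rw [hf, aff_eval_X]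

/-- If the coordinates of the points of a set are polynomials in some of them, which range over a
closed set, then the set is closed. -/
theorem isClosed_of_eval {Y : Set (Aff σ)} {f : Aff σ → Aff τ} {Z : Set (Aff τ)} (γ : τ → σ)
    (hf : ∀ y j, f y j = y (γ j)) (hZ : IsClosed Z) (hm : Set.MapsTo f Y Z)
    (hs : ∀ z ∈ Z, ∃ y ∈ Y, f y = z)
    (hP : ∀ s, ∃ P : MvPolynomial τ ℂ, ∀ y ∈ Y, y s = MvPolynomial.eval (f y) P) :
    IsClosed Y := by
  choose P hP using hP
  have hcont : Continuous f :=
    continuousOn_univ.1 (isRegularMapOn_comp Set.univ γ hf).continuousOn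
  have hfe : ∀ (y : Aff σ) (Q : MvPolynomial τ ℂ), MvPolynomial.eval y (MvPolynomial.rename γ Q) = MvPolynomial.eval (f y) Q := by
    intro y Q
    refine (MvPolynomial.eval_rename γ y Q).trans ?_
    exact congrArg (fun w => MvPolynomial.eval w Q) (funext fun j => (hf y j).symm)
  refine closure_subset_iff_isClosed.1 fun y hy => ?_
  have hyZ : f y ∈ Z := hZ.closure_subset_iff.2 hm.image_subset
    (image_closure_subset_closure_image hcont ⟨y, hy, rfl⟩)
  obtain ⟨w, hw, hwy⟩ := hs _ hyZ
  convert hw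
  refine funext fun s => ?_
  rw [hP s w hw, hwy]
  refine (sub_eq_zero.1 ?_).trans (hfe y (P s))
  have := mem_closure_iff_eval.1 hy (.X s - MvPolynomial.rename γ (P s)) fun w hw => by
    rw [map_sub, aff_eval_X, hP s w hw]
    exact sub_eq_zero.2 (hfe w (P s)).symm
  rwa [map_sub, aff_eval_X] at this

end Isomorphisms

/-! ### All values of a coloring lie in the subgroup generated by its inputs -/

section Generators

variable {G : Type*} [Group G] {K : Subgroup G}

theorem colorThree_mem {a b : G} (ha : a ∈ K) (hb : b ∈ K) : ∀ h, colorThree a b h ∈ K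
  | (.inl _, k) => by
    cases k <;> simp only [colorThree, colorH] <;>
      repeat' first | exact ha | exact hb | apply K.mul_mem | apply K.inv_mem
  | (.inr (.inl _), k) => by
    cases k <;> simp only [colorThree, colorH] <;>
      repeat' first | exact ha | exact hb | apply K.mul_mem | apply K.inv_mem
  | (.inr (.inr _), k) => by
    cases k <;> simp only [colorThree, colorH] <;>
      repeat' first | exact ha | exact hb | apply K.mul_mem | apply K.inv_mem

theorem colorNegThird_mem {q p : G} (hq : q ∈ K) (hp : p ∈ K) : ∀ h, colorNegThird q p h ∈ K
  | (.inl _, k) => by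
    cases k <;> simp only [colorNegThird, colorN] <;>
      repeat' first | exact hq | exact hp | apply K.mul_mem | apply K.inv_mem
  | (.inr (.inl _), k) => by
    cases k <;> simp only [colorNegThird, colorN] <;>
      repeat' first | exact hq | exact hp | apply K.mul_mem | apply K.inv_mem
  | (.inr (.inr _), k) => by
    cases k <;> simp only [colorNegThird, colorN] <;>
      repeat' first | exact hq | exact hp | apply K.mul_mem | apply K.inv_mem

theorem colorThird_mem {q p : G} (hq : q ∈ K) (hp : p ∈ K) : ∀ h, colorThird q p h ∈ K
  | (.inl _, k) => by
    cases k <;> simp only [colorThird, colorV] <;>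
      repeat' first | exact hq | exact hp | apply K.mul_mem | apply K.inv_mem
  | (.inr (.inl _), k) => by
    cases k <;> simp only [colorThird, colorV] <;>
      repeat' first | exact hq | exact hp | apply K.mul_mem | apply K.inv_mem
  | (.inr (.inr _), k) => by
    cases k <;> simp only [colorThird, colorV] <;>
      repeat' first | exact hq | exact hp | apply K.mul_mem | apply K.inv_mem

theorem out₂_mem {a b : G} (ha : a ∈ K) (hb : b ∈ K) : out₂ a b ∈ K := by
  rw [out₂]
  repeat' first | exact ha | exact hb | apply K.mul_mem | apply K.inv_mem

theorem colorQ1_mem {x₁ y x₄ z : G} (hx₁ : x₁ ∈ K) (hy : y ∈ K) (hx₄ : x₄ ∈ K) (hz : z ∈ K) :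
    ∀ h, colorQ1 x₁ y x₄ z h ∈ K
  | (.inl c, k) => colorThree_mem (K.inv_mem hx₁) (K.inv_mem hy) (c, k)
  | (.inr (.inl c), k) => colorThree_mem hy hx₄ (c, k)
  | (.inr (.inr (.inl c)), k) => colorNegThird_mem (K.inv_mem hz) (K.inv_mem hx₄) (c, k)
  | (.inr (.inr (.inr c)), k) => colorNegThird_mem (out₂_mem hy hx₄) hz (c, k)

theorem colorQ2_mem {x y z v : G} (hx : x ∈ K) (hy : y ∈ K) (hz : z ∈ K) (hv : v ∈ K) :
    ∀ h, colorQ2 x y z v h ∈ K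
  | (.inl c, k) => colorThree_mem (K.inv_mem hx) (K.inv_mem hy) (c, k)
  | (.inr (.inl c), k) => colorThree_mem hy hz (c, k)
  | (.inr (.inr (.inl c)), k) => colorNegThird_mem (K.inv_mem hv) (K.inv_mem hz) (c, k)
  | (.inr (.inr (.inr c)), k) => colorThird_mem (out₂_mem hy hz) hv (c, k)

theorem map_mem_of_arc {T : Tangle} (ρ : T.linkGroup →* G) (h : ∀ e, ρ (T.arc e) ∈ K)
    (g : T.linkGroup) : ρ g ∈ K := by
  have hg : g ∈ Subgroup.closure (Set.range T.arc) := by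
    rw [show T.arc = PresentedGroup.of from rfl, PresentedGroup.closure_range_of]
    trivial
  have hle : Subgroup.closure (Set.range T.arc) ≤ K.comap ρ := (Subgroup.closure_le _).2 (by
    rintro _ ⟨e, rfl⟩
    exact h e)
  exact hle hg

end Generators

/-! ### Traces of twist outputs and the relation between traces of triples -/

section Conjugates

variable {R : Type*} [CommRing R]

theorem trace_mat_conj (g a : SL(2, R)) : (mat (g * a * g⁻¹)).trace = (mat a).trace := by
  rw [mat_mul, Matrix.trace_mul_comm, ← mat_mul, inv_mul_cancel_left]

theorem trace_out₁ (a b : SL(2, R)) : (mat (out₁ a b)).trace = (mat b).trace := by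
  rw [← trace_mat_conj (a * b * a) b, out₁]
  group

theorem trace_out₂ (a b : SL(2, R)) : (mat (out₂ a b)).trace = (mat a).trace := by
  rw [← trace_mat_conj (a * b) a, out₂]
  group

end Conjugates

theorem mem_coordSubring {ι τ : Type*} (q : ι → Aff τ) (D : MvPolynomial τ ℂ) (j : τ) :
    (fun i => q i j) ∈ coordSubring q D := by
  convert eval_mem_coordSubring q D (.X j) using 1
  exact funext fun i => (aff_eval_X (q i) j).symm

/-- The relation between the traces of three matrices and of their products. -/
theorem trace_mul_mul_relation (X Y Z : Matrix (Fin 2) (Fin 2) ℂ) :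
    (X * Y * Z).trace ^ 2 + (X.trace * Y.trace * Z.trace - X.trace * (Y * Z).trace -
      Y.trace * (X * Z).trace - Z.trace * (X * Y).trace) * (X * Y * Z).trace +
      X.trace ^ 2 * Y.det * Z.det + Y.trace ^ 2 * X.det * Z.det + Z.trace ^ 2 * X.det * Y.det +
      (X * Y).trace ^ 2 * Z.det + (X * Z).trace ^ 2 * Y.det + (Y * Z).trace ^ 2 * X.det -
      X.trace * Y.trace * (X * Y).trace * Z.det - X.trace * Z.trace * (X * Z).trace * Y.det -
      Y.trace * Z.trace * (Y * Z).trace * X.det + (X * Y).trace * (X * Z).trace * (Y * Z).trace -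
      4 * X.det * Y.det * Z.det = 0 := by
  simp only [Matrix.det_fin_two, Matrix.trace_fin_two, Matrix.mul_apply, Fin.sum_univ_two]
  ring

theorem fpoly_tr {x y z : SL(2, ℂ)} (hy : tr y = tr x) (hz : tr z = tr x) :
    fpoly (tr x) (tr (x * y)) (tr (x * z)) (tr (y * z)) (tr (x * y * z)) = 0 := by
  have h := trace_mul_mul_relation (mat x) (mat y) (mat z)
  simp only [mat, Matrix.SpecialLinearGroup.det_coe] at h
  simp only [← Matrix.SpecialLinearGroup.coe_mul] at h
  have e : ∀ a : SL(2, ℂ), Matrix.trace (a : Matrix (Fin 2) (Fin 2) ℂ) = tr a := fun _ => rfl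
  simp only [e] at h
  rw [hy, hz] at h
  rw [fpoly]
  linear_combination h

/-! ### The family of Q₁ and its coordinates -/

section RepsQ1

theorem Q1.isLinkColoring_of_braid {G : Type*} [Group G] {x y z : G}
    (hy : x * y * x = y * x * y) (hz : x * z * x = z * x * z) :
    Q1.IsLinkColoring (colorQ1 x y x z) := by
  have o : out₂ y x = x := out₂_of_braid hy.symm
  refine isLinkColoring_colorQ1 ?_ ?_ ?_ ?_
  · rw [out₂_of_braid (braid_inv hy), out₁_of_braid hy.symm, inv_mul_cancel]
  · rw [o, out₁_of_braid (braid_inv hz.symm), out₂_of_braid hz, inv_mul_cancel]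
  · rw [out₂_of_braid (braid_inv hz.symm), mul_inv_cancel]
  · rw [o, out₁_of_braid (braid_inv hy), out₁_of_braid hz, inv_mul_cancel]

/-- Each output of a twist is conjugate to one of its inputs, so the joint relations link the traces
of all four elements. -/
theorem Q1.trace_eq {R : Type*} [CommRing R] {x₁ y x₄ z : SL(2, R)}
    (h₁ : out₂ x₁⁻¹ y⁻¹ * out₁ y x₄ = 1) (h₂ : out₁ z⁻¹ x₄⁻¹ * out₂ (out₂ y x₄) z = 1)
    (h₃ : x₁ * out₂ z⁻¹ x₄⁻¹ = 1) : (mat x₄).trace = (mat x₁).trace ∧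
      (mat y).trace = (mat x₁).trace ∧ (mat z).trace = (mat x₁).trace := by
  have e₁ := congrArg (fun g => (mat g).trace) (eq_inv_of_mul_eq_one_left h₁)
  have e₂ := congrArg (fun g => (mat g).trace) (eq_inv_of_mul_eq_one_left h₂)
  have e₃ := congrArg (fun g => (mat g).trace) (eq_inv_of_mul_eq_one_left h₃)
  simp only [trace_mat_inv, trace_out₁, trace_out₂] at e₁ e₂ e₃
  exact ⟨e₁.symm, e₂.symm.trans e₁.symm, e₃.symm⟩

variable {ρ : Q1.linkGroup →* SL(2, ℂ)} {x y z : SL(2, ℂ)}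

theorem Q1.hasValues_of_color (hρ : (fun h => ρ (Q1.arc h)) = colorQ1 x y x z)
    (hy : x * y * x = y * x * y) (hz : x * z * x = z * x * z) : Q1.HasValues ρ x y z :=
  ⟨(congrFun hρ _).trans (inv_inv x),
    (congrFun hρ _).trans ((colorThree_ne _ _).trans (out₁_of_braid (braid_inv hy))),
    (congrFun hρ (inR (inL (three.tip .se)))).trans (out₂_of_braid hy.symm),
    congrFun hρ (inR (inL (three.tip .sw))),
    (congrFun hρ _).trans (inv_inv y),
    (congrFun hρ (inL (three.tip .se))).trans (out₂_of_braid (braid_inv hy)),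
    (congrFun hρ _).trans (inv_inv z),
    (congrFun hρ _).trans ((colorNegThird_se _ _).trans (out₁_of_braid (braid_inv hz.symm)))⟩

theorem Q1.HasValues.color (h : Q1.HasValues ρ x y z) :
    (fun h => ρ (Q1.arc h)) = colorQ1 x y x z ∧ tr y = tr x ∧ tr z = tr x := by
  obtain ⟨h1, -, -, h4, h5, -, h7, -⟩ := h
  obtain ⟨hc, e1, e2, e3, -⟩ := colorQ1_unique (isLinkColoring_hom ρ) h1 h5 h4 h7
  exact ⟨hc, (Q1.trace_eq e1 e2 e3).2⟩

theorem Q1.HasValues.hom_ext {ρ' : Q1.linkGroup →* SL(2, ℂ)} (h : Q1.HasValues ρ x y z)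
    (h' : Q1.HasValues ρ' x y z) : ρ = ρ' :=
  linkGroup_hom_ext (congrFun (h.color.1.trans h'.color.1.symm))

theorem Q1.exists_hasValues (hy : tr y = tr x) (hz : tr z = tr x) (hxy : tr (x * y) = 1)
    (hxz : tr (x * z) = 1) : ∃ ρ, Q1.HasValues ρ x y z := by
  have by' := braid_of_trace hy.symm hxy
  have bz := braid_of_trace hz.symm hxz
  exact ⟨(Q1.isLinkColoring_of_braid by' bz).hom,
    Q1.hasValues_of_color (funext (Q1.isLinkColoring_of_braid by' bz).hom_arc) by' bz⟩

theorem Q1.HasValues.longitude (h : Q1.HasValues ρ x y z) (hxy : tr (x * y) = 1)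
    (hxz : tr (x * z) = 1) (e : Q1.HalfEdge) : ρ (Q1.longitude e) = ρ (Q1.arc e) ^ 24 := by
  obtain ⟨hc, hy, hz⟩ := h.color
  exact Q1.longitude_of_color hc (braid_of_trace hy.symm hxy) (braid_of_trace hz.symm hxz)
    (braid_square hy.symm hxy) (braid_square hz.symm hxz) (by simp) (by simp) e

/-- The characters of the representations that come from triples `(x,y,z)` with
`tr(xy) = tr(xz) = 1`. -/
def Q1.tripleChars : Set (Aff Q1.linkGroup) :=
  {χ | ∃ ρ x y z, Q1.HasValues ρ x y z ∧ tr (x * y) = 1 ∧ tr (x * z) = 1 ∧ χ = character ρ}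

theorem Q1.HasValues.coords (h : Q1.HasValues ρ x y z) :
    Q1.coords (character ρ) = ![tr x, tr (y * z), tr (x * y * z)] := by
  obtain ⟨h1, -, -, -, h5, -, h7, -⟩ := h
  simp only [Q1.coords, character, map_mul, h1, h5, h7]
  rfl

/-- All triples are treated at once: the tautological representation `Φ` takes values in functions
from the set of triples to SL(2,ℂ), that is, in SL(2) of a ring of functions. One polynomial
therefore serves every triple. -/
theorem Q1.exists_eval (γ : Q1.linkGroup) : ∃ P : MvPolynomial (Fin 3) ℂ,
    ∀ χ ∈ Q1.tripleChars, χ γ = MvPolynomial.eval (Q1.coords χ) P := by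
  let ι := {p : SL(2, ℂ) × SL(2, ℂ) × SL(2, ℂ) // tr p.2.1 = tr p.1 ∧ tr p.2.2 = tr p.1 ∧
    tr (p.1 * p.2.1) = 1 ∧ tr (p.1 * p.2.2) = 1}
  let X : ι → SL(2, ℂ) := fun p => p.1.1
  let Y : ι → SL(2, ℂ) := fun p => p.1.2.1
  let Z : ι → SL(2, ℂ) := fun p => p.1.2.2
  have hY : X * Y * X = Y * X * Y := funext fun p => braid_of_trace p.2.1.symm p.2.2.2.1
  have hZ : X * Z * X = Z * X * Z := funext fun p => braid_of_trace p.2.2.1.symm p.2.2.2.2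
  let q : ι → Aff (Fin 3) := fun p => ![tr (X p), tr (Y p * Z p), tr (X p * Y p * Z p)]
  let S := coordSubring q 1
  have hX : (fun p => tr (X p)) ∈ S := mem_coordSubring q 1 0
  let Φ := (Q1.isLinkColoring_of_braid hY hZ).hom
  have hΦ : ∀ e, Φ (Q1.arc e) = colorQ1 X Y X Z e := (Q1.isLinkColoring_of_braid hY hZ).hom_arc
  have hmem : Φ γ ∈ Subgroup.closure {X, Y, Z} := map_mem_of_arc Φ (fun e => by
    rw [hΦ]
    exact colorQ1_mem (Subgroup.subset_closure (by simp)) (Subgroup.subset_closure (by simp))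
      (Subgroup.subset_closure (by simp)) (Subgroup.subset_closure (by simp)) e) γ
  obtain ⟨P, n, hP⟩ : (fun p => tr (Φ γ p)) ∈ S := by
    refine tr_mem_of_mem_closure S hX ?_ ?_ ?_ ?_ (mem_coordSubring q 1 1) (mem_coordSubring q 1 2)
      (fun N h1 h2 h3 _ a ha => ?_) hmem
    · rwa [show (fun p => tr (Y p)) = fun p => tr (X p) from funext fun p => p.2.1]
    · rwa [show (fun p => tr (Z p)) = fun p => tr (X p) from funext fun p => p.2.2.1]
    · rw [show (fun p => tr (X p * Y p)) = 1 from funext fun p => p.2.2.2.1]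
      exact S.one_mem
    · rw [show (fun p => tr (X p * Z p)) = 1 from funext fun p => p.2.2.2.2]
      exact S.one_mem
    · rcases ha with rfl | rfl | rfl
      exacts [h1, h2, h3]
  refine ⟨P, ?_⟩
  rintro _ ⟨ρ, x, y, z, hρ, hxy, hxz, rfl⟩
  obtain ⟨hc, hy, hz⟩ := hρ.color
  let p : ι := ⟨(x, y, z), hy, hz, hxy, hxz⟩
  have he : (Pi.evalMonoidHom (fun _ : ι => SL(2, ℂ)) p).comp Φ = ρ := by
    refine linkGroup_hom_ext (congrFun (Eq.trans ?_ hc.symm))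
    refine (colorQ1_unique (isLinkColoring_hom _) ?_ ?_ ?_ ?_).1
    · exact (congrFun (hΦ _) p).trans (inv_inv x)
    · exact (congrFun (hΦ _) p).trans (inv_inv y)
    · exact congrFun (hΦ (inR (inL (three.tip .sw)))) p
    · exact (congrFun (hΦ _) p).trans (inv_inv z)
  have := hP p
  rw [map_one, one_pow, mul_one] at this
  rw [hρ.coords, ← he]
  exact this

theorem Q1.mapsTo_coords : Set.MapsTo Q1.coords Q1.tripleChars Q1.surface := by
  rintro _ ⟨ρ, x, y, z, hρ, hxy, hxz, rfl⟩
  obtain ⟨-, hy, hz⟩ := hρ.color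
  have := fpoly_tr hy hz
  rw [hxy, hxz] at this
  rw [hρ.coords]
  exact Q1.mem_surface.2 this

theorem Q1.exists_coords_eq {p : Aff (Fin 3)} (hp : p ∈ Q1.surface) :
    ∃ ρ x y z, Q1.HasValues ρ x y z ∧ tr (x * y) = 1 ∧ tr (x * z) = 1 ∧
      Q1.coords (character ρ) = p ∧ (p ∉ Q1.badPoints → IsIrrep ρ) := by
  obtain ⟨x, y, z, hx, hy, hz, hxy, hxz, hyz, hxyz, hirr⟩ := exists_triple hp
  obtain ⟨ρ, hρ⟩ := Q1.exists_hasValues (hy.trans hx.symm) (hz.trans hx.symm) hxy hxz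
  refine ⟨ρ, x, y, z, hρ, hxy, hxz, ?_, fun hb => ?_⟩
  · rw [hρ.coords, hx, hyz, hxyz]
    refine funext fun j => ?_
    fin_cases j <;> rfl
  · obtain ⟨h1, -, -, -, h5, -, h7, -⟩ := hρ
    by_cases ht : p 0 ^ 2 = 3
    · have hu : p 1 ≠ 1 := fun hu => hb ⟨ht, hu, by
        have hp' : fpoly (p 0) 1 1 (p 1) (p 2) = 0 := hp
        rw [fpoly, hu] at hp'
        have : p 2 ^ 2 = 0 := by linear_combination hp' - p 0 * p 2 * ht
        simpa using this⟩
      rintro ⟨v, hv, h⟩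
      obtain ⟨c, hc⟩ := h (Q1.end1 .nw)
      obtain ⟨d, hd⟩ := h (Q1.end1 .sw)
      obtain ⟨e, he⟩ := h (Q1.end3 .ne)
      rw [h1] at hc
      rw [h5] at hd
      rw [h7] at he
      exact hv (hirr ht hu v c d e hc hd he)
    -- The expression for the pair x, y is t² - 3.
    · refine isIrrep_of_trace h1 h5 fun h0 => ht ?_
      rw [hx, hy, hxy] at h0
      linear_combination h0

theorem Q1.exists_mem_coords_eq {p : Aff (Fin 3)} (hp : p ∈ Q1.surface) :
    ∃ χ ∈ Q1.tripleChars, Q1.coords χ = p := by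
  obtain ⟨ρ, x, y, z, hρ, hxy, hxz, h, -⟩ := Q1.exists_coords_eq hp
  exact ⟨_, ⟨ρ, x, y, z, hρ, hxy, hxz, rfl⟩, h⟩

theorem Q1.coords_apply (χ : Aff Q1.linkGroup) (j : Fin 3) : Q1.coords χ j =
    χ ((![Q1.end1 .nw, Q1.end1 .sw * Q1.end3 .ne, Q1.end1 .nw * Q1.end1 .sw * Q1.end3 .ne] :
      Fin 3 → Q1.linkGroup) j) := by
  fin_cases j <;> rfl

theorem Q1.isIsomorphismOn_coords : IsIsomorphismOn Q1.coords Q1.tripleChars Q1.surface := by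
  refine isIsomorphismOn_of_surjOn (D := 1) (isRegularMapOn_comp _ _ Q1.coords_apply)
    Q1.mapsTo_coords (fun _ => Q1.exists_mem_coords_eq) (fun z _ => by simp) fun γ => ?_
  obtain ⟨P, hP⟩ := Q1.exists_eval γ
  exact ⟨P, 0, fun χ hχ => by rw [pow_zero, mul_one, hP χ hχ]⟩

theorem Q1.isClosed_surface : IsClosed Q1.surface := by
  convert isClosed_eval_eq_zero (.X 2 ^ 2 + .X 0 * (.X 0 ^ 2 - 1 - 1 - .X 1) * .X 2 +
    .X 0 ^ 2 * (3 - 1 - 1 - .X 1) + 1 ^ 2 + 1 ^ 2 + .X 1 ^ 2 + 1 * 1 * .X 1 - 4 :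
      MvPolynomial (Fin 3) ℂ) using 1
  ext p
  simp only [Q1.surface, fpoly, Set.mem_ofPred_eq, map_sub, map_add, map_mul, map_pow, aff_eval_X,
    map_one, map_ofNat]

theorem Q1.isClosed_tripleChars : IsClosed Q1.tripleChars :=
  isClosed_of_eval _ Q1.coords_apply Q1.isClosed_surface Q1.mapsTo_coords
    (fun _ => Q1.exists_mem_coords_eq) Q1.exists_eval

/-- Membership only provides some representation of the family with the same character;
irreducibility of `ρ` carries its relations over to `ρ` itself. -/
theorem Q1.hasValues_of_character_mem (hρ : IsIrrep ρ) (h : character ρ ∈ Q1.tripleChars) :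
    Q1.HasValues ρ (ρ (Q1.end1 .nw)) (ρ (Q1.end1 .sw)) (ρ (Q1.end3 .ne)) ∧
      tr (ρ (Q1.end1 .nw) * ρ (Q1.end1 .sw)) = 1 ∧ tr (ρ (Q1.end1 .nw) * ρ (Q1.end3 .ne)) = 1 := by
  obtain ⟨ρ', x, y, z, ⟨h1, h2, h3, h4, h5, h6, h7, h8⟩, hxy, hxz, hχ⟩ := h
  have key : ∀ {a b}, ρ' a = ρ' b → ρ a = ρ b := fun h => hρ.eq_of_character_eq hχ h
  refine ⟨⟨rfl, ?_, ?_, ?_, rfl, ?_, rfl, ?_⟩, ?_, ?_⟩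
  · rw [← map_inv]; exact key (by rw [map_inv, h1, h2])
  · exact key (by rw [h1, h3])
  · rw [← map_inv]; exact key (by rw [map_inv, h1, h4])
  · rw [← map_inv]; exact key (by rw [map_inv, h5, h6])
  · rw [← map_inv]; exact key (by rw [map_inv, h7, h8])
  · have := congrFun hχ (Q1.end1 .nw * Q1.end1 .sw)
    simp only [character, map_mul, h1, h5, hxy] at this
    exact this
  · have := congrFun hχ (Q1.end1 .nw * Q1.end3 .ne)
    simp only [character, map_mul, h1, h7, hxz] at this
    exact this

theorem Q1.tripleChars_inter_eq_family :
    Q1.tripleChars ∩ irrCharVariety Q1.linkGroup = Q1.family := by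
  ext χ
  constructor
  · rintro ⟨hχ, ρ, hρ, rfl⟩
    obtain ⟨h, hxy, hxz⟩ := Q1.hasValues_of_character_mem hρ hχ
    exact ⟨ρ, _, _, _, hρ, h, hxy, hxz, rfl⟩
  · rintro ⟨ρ, x, y, z, hρ, h, hxy, hxz, rfl⟩
    exact ⟨⟨ρ, x, y, z, h, hxy, hxz, rfl⟩, ρ, hρ, rfl⟩

/-- The bad points are coordinates of abelian representations. -/
theorem Q1.not_irr_of_coords_mem {χ : Aff Q1.linkGroup} (hχ : χ ∈ Q1.tripleChars)
    (hb : Q1.coords χ ∈ Q1.badPoints) : χ ∉ irrCharVariety Q1.linkGroup := by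
  rintro ⟨ρ, hρ, rfl⟩
  obtain ⟨hb0, hb1, hb2⟩ := hb
  obtain ⟨m, n, hmn, h1⟩ := exists_add_eq_mul_eq_one (Q1.coords (character ρ) 0)
  rw [← hmn] at hb0
  have e : m ^ 2 + n ^ 2 = 1 := by linear_combination hb0 - 2 * h1
  -- Here tr(d²) = 1 and tr(d³) = 0, so the triple (d, d, d) has the coordinates of the bad point,
  -- and its representation is abelian.
  let d : SL(2, ℂ) := mkSL m 0 0 n (by linear_combination h1)
  have hd : tr (d * d) = 1 := by rw [mkSL_mul, tr_mkSL]; linear_combination e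
  obtain ⟨ρ', hρ'⟩ := Q1.exists_hasValues (x := d) (y := d) (z := d) rfl rfl hd hd
  have hmem : character ρ' ∈ Q1.tripleChars := ⟨ρ', d, d, d, hρ', hd, hd, rfl⟩
  have hco : Q1.coords (character ρ) = Q1.coords (character ρ') := by
    rw [hρ'.coords]
    refine funext fun j => ?_
    fin_cases j
    · exact hmn.symm.trans (tr_mkSL _).symm
    · exact hb1.trans hd.symm
    · refine hb2.trans (Eq.symm ?_)
      change tr (d * d * d) = 0
      rw [mkSL_mul, mkSL_mul, tr_mkSL]
      linear_combination (m + n) * e - (m + n) * h1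
  obtain ⟨-, -, g, -, -, hl, -⟩ := Q1.isIsomorphismOn_coords
  have heq : character ρ = character ρ' := by
    rw [← hl hχ, ← hl hmem, hco]
  obtain ⟨a, b, hab⟩ := hρ.exists_not_commute
  have hcomm : ∀ g, ρ' g ∈ Subgroup.closure {d} := map_mem_of_arc ρ' fun e => by
    rw [show ρ' (Q1.arc e) = _ from congrFun hρ'.color.1 e]
    have hd := Subgroup.subset_closure (Set.mem_singleton d)
    exact colorQ1_mem hd hd hd hd e
  refine hab (hρ.eq_of_character_eq heq ?_)
  obtain ⟨i, hi⟩ := Subgroup.mem_closure_singleton.1 (hcomm a)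
  obtain ⟨j, hj⟩ := Subgroup.mem_closure_singleton.1 (hcomm b)
  rw [map_mul, map_mul, ← hi, ← hj, zpow_mul_comm]

theorem Q1.isIsomorphismOn_coords_irr : IsIsomorphismOn Q1.coords
    (Q1.tripleChars ∩ irrCharVariety Q1.linkGroup) (Q1.surface \ Q1.badPoints) := by
  refine Q1.isIsomorphismOn_coords.restrict Set.sdiff_subset fun χ => ⟨fun ⟨hχ, hi⟩ => ?_,
    fun ⟨hχ, hs, hb⟩ => ⟨hχ, ?_⟩⟩
  · exact ⟨hχ, Q1.mapsTo_coords hχ, fun hb => Q1.not_irr_of_coords_mem hχ hb hi⟩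
  · obtain ⟨ρ, x, y, z, hρ, hxy, hxz, hco, hirr⟩ := Q1.exists_coords_eq hs
    obtain ⟨-, -, g, -, -, hl, -⟩ := Q1.isIsomorphismOn_coords
    have heq : χ = character ρ := by
      rw [← hl hχ, ← hl ⟨ρ, x, y, z, hρ, hxy, hxz, rfl⟩, hco]
    exact ⟨ρ, hirr hb, heq⟩

end RepsQ1

/-! ### An open condition that isolates the family of Q₁ -/

section OpenQ1

theorem tr_mul_inv (a b : SL(2, ℂ)) : tr (a * b⁻¹) = tr a * tr b - tr (a * b) := by
  change (mat (a * b⁻¹)).trace = (mat a).trace * (mat b).trace - (mat (a * b)).trace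
  rw [mat_mul, mat_inv, mul_sub, mul_smul_comm, mul_one, Matrix.trace_sub, Matrix.trace_smul,
    ← mat_mul, smul_eq_mul, mul_comm]

theorem tr_mul_comm (a b : SL(2, ℂ)) : tr (a * b) = tr (b * a) := by
  change (mat (a * b)).trace = (mat (b * a)).trace
  rw [mat_mul, Matrix.trace_mul_comm, ← mat_mul]

theorem tr_inv (a : SL(2, ℂ)) : tr a⁻¹ = tr a := trace_mat_inv a

theorem tr_inv_mul_inv (a b : SL(2, ℂ)) : tr (a⁻¹ * b⁻¹) = tr (a * b) := by
  rw [← mul_inv_rev, tr_inv, tr_mul_comm]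

theorem tr_mul_out₂ (w : SL(2, ℂ)) {a b : SL(2, ℂ)} (h : tr a = tr b) : tr (w * out₂ a b) =
    tr (w * b) + (tr (a * b) - 1) * (tr (w * a) - tr (w * (a * b * a⁻¹))) := by
  simp only [tr, mat_mul w]
  rw [mat_out₂ h, mul_add, mul_smul_comm, mul_sub]
  simp only [Matrix.trace_add, Matrix.trace_sub, Matrix.trace_smul, smul_eq_mul]

theorem tr_mul_out₁ (w : SL(2, ℂ)) {a b : SL(2, ℂ)} (h : tr a = tr b) : tr (w * out₁ a b) =
    tr (w * a) - (tr (a * b) - 1) *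
      (tr (w * (a * b * a)) - tr (w * (a * b * (a * b * a⁻¹)))) := by
  simp only [tr, mat_mul w]
  rw [mat_out₁ h, mul_sub, smul_mul_assoc, mul_smul_comm, mul_sub, mul_sub, ← mat_mul (a * b),
    ← mat_mul (a * b)]
  simp only [Matrix.trace_sub, Matrix.trace_smul, smul_eq_mul]

/-- An expression in the values of a function `T` on a group, whose nonvanishing for the trace forces
a representation of `Q₁` into the family. -/
def Q1.openVal {A R : Type*} [Group A] [CommRing R] (T : A → R) (x₁ y x₄ x₃ z : A) : R :=
  let α := T (x₁ * x₁⁻¹) - T (x₁ * (x₁⁻¹ * y⁻¹ * x₁⁻¹⁻¹))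
  let β := T (x₁ * (y * x₄ * y)) - T (x₁ * (y * x₄ * (y * x₄ * y⁻¹)))
  let α' := T (x₁ * x₃) - T (x₁ * (x₃ * z * x₃⁻¹))
  let β' := T (x₁ * (z⁻¹ * x₄⁻¹ * z⁻¹)) - T (x₁ * (z⁻¹ * x₄⁻¹ * (z⁻¹ * x₄⁻¹ * z⁻¹⁻¹)))
  let κ := T (y * z⁻¹) - T (y * (z⁻¹ * x₄⁻¹ * z⁻¹⁻¹))
  let κ' := T (z * y) - T (z * (y * x₄ * y⁻¹))
  (β' - α') * ((β - α) * (β' - α') + α * α' * κ * κ')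

/-- Put δ = tr(yx₄) - 1 and ε = tr(x₄z) - 1. Tracing the relations against x₁, y and z gives tr(x₁y)
- 1 = δ - εκ, (tr(x₁y) - 1)α = δβ and (ε + δκ')α' = εβ'. This is a homogeneous linear system for δ
and ε, and its determinant is, up to sign, the last factor of `Q1.openVal`. Then ε = 0 turns the
left closing relation into x₁ = x₄. -/
theorem Q1.eq_of_openVal_ne_zero {x₁ y x₄ z : SL(2, ℂ)}
    (h₁ : out₂ x₁⁻¹ y⁻¹ * out₁ y x₄ = 1) (h₂ : out₁ z⁻¹ x₄⁻¹ * out₂ (out₂ y x₄) z = 1)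
    (h₃ : x₁ * out₂ z⁻¹ x₄⁻¹ = 1) (hne : Q1.openVal tr x₁ y x₄ (out₂ y x₄) z ≠ 0) :
    x₁ = x₄ ∧ tr (x₁ * y) = 1 ∧ tr (x₁ * z) = 1 := by
  obtain ⟨t₄, ty, tz⟩ : tr x₄ = tr x₁ ∧ tr y = tr x₁ ∧ tr z = tr x₁ := Q1.trace_eq h₁ h₂ h₃
  have tx₃ : tr (out₂ y x₄) = tr y := trace_out₂ y x₄
  have E₁ := congrArg (fun g => tr (x₁ * g)) (eq_inv_of_mul_eq_one_left h₁)
  have E₂ := congrArg (fun g => tr (x₁ * g)) (eq_inv_of_mul_eq_one_right h₂)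
  have E₃ := congrArg (fun g => tr (y * g)) (eq_inv_of_mul_eq_one_left h₃)
  have E₄ := tr_mul_out₂ z (ty.trans t₄.symm)
  have i₁ : tr x₁⁻¹ = tr y⁻¹ := by rw [tr_inv, tr_inv, ty]
  have i₂ : tr z⁻¹ = tr x₄⁻¹ := by rw [tr_inv, tr_inv, tz, t₄]
  simp only [tr_mul_inv x₁ (out₁ _ _), tr_mul_inv y (out₂ _ _), tr_mul_inv x₁ y,
    tr_mul_inv x₁ z, tr_mul_inv y x₄, tr_mul_out₁ _ (ty.trans t₄.symm), tr_mul_out₂ _ i₁,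
    tr_mul_out₁ _ i₂, tr_mul_out₂ _ i₂, tr_mul_out₂ _ (tx₃.trans (ty.trans tz.symm)),
    tr_inv_mul_inv, show tr (out₁ y x₄) = tr x₄ from trace_out₁ _ _,
    show tr (out₁ z⁻¹ x₄⁻¹) = tr x₄⁻¹ from trace_out₁ _ _,
    show tr (out₂ z⁻¹ x₄⁻¹) = tr z⁻¹ from trace_out₂ _ _, tr_inv] at E₁ E₂ E₃
  rw [tr_mul_comm z (out₂ y x₄), tr_mul_comm z x₄] at E₄
  rw [tr_mul_comm z x₄] at E₂ E₃
  rw [tr_mul_comm y x₁] at E₃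
  rw [t₄, ty, tz] at *
  simp only [Q1.openVal] at hne
  generalize tr (x₁ * x₁⁻¹) - tr (x₁ * (x₁⁻¹ * y⁻¹ * x₁⁻¹⁻¹)) = α at *
  generalize tr (x₁ * (y * x₄ * y)) - tr (x₁ * (y * x₄ * (y * x₄ * y⁻¹))) = β at *
  generalize tr (x₁ * out₂ y x₄) - tr (x₁ * (out₂ y x₄ * z * (out₂ y x₄)⁻¹)) = α' at *
  generalize tr (x₁ * (z⁻¹ * x₄⁻¹ * z⁻¹)) -
    tr (x₁ * (z⁻¹ * x₄⁻¹ * (z⁻¹ * x₄⁻¹ * z⁻¹⁻¹))) = β' at *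
  generalize tr (y * z⁻¹) - tr (y * (z⁻¹ * x₄⁻¹ * z⁻¹⁻¹)) = κ at *
  generalize tr (z * y) - tr (z * (y * x₄ * y⁻¹)) = κ' at *
  obtain ⟨hne₁, hne₂⟩ := mul_ne_zero_iff.1 hne
  have hδ : tr (y * x₄) - 1 = 0 := by
    refine (mul_eq_zero.1 (?_ : _ * ((β - α) * (β' - α') + α * α' * κ * κ') = 0)).resolve_right hne₂
    linear_combination (-(β' - α')) * (E₁ - α * E₃) + α * κ * (E₂ - α' * E₄)
  have hε : tr (x₄ * z) - 1 = 0 := by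
    refine (mul_eq_zero.1 (?_ : _ * (β' - α') = 0)).resolve_right hne₁
    linear_combination -E₂ + α' * E₄ + α' * κ' * hδ
  have hx : x₁ = x₄ := by
    rw [eq_inv_of_mul_eq_one_left h₃, out₂_of_braid, inv_inv]
    refine braid_of_trace i₂ ?_
    change tr (z⁻¹ * x₄⁻¹) = 1
    rw [tr_inv_mul_inv, tr_mul_comm]
    exact sub_eq_zero.1 hε
  refine ⟨hx, ?_, ?_⟩
  · rw [hx, tr_mul_comm]
    exact sub_eq_zero.1 hδ
  · rw [hx]
    exact sub_eq_zero.1 hε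

/-- The polynomial in the values of a character whose nonvanishing makes it the character of a
representation of the family. -/
noncomputable def Q1.openPoly : MvPolynomial Q1.linkGroup ℂ :=
  Q1.openVal MvPolynomial.X (Q1.end1 .nw) (Q1.end1 .sw) (Q1.end2 .sw)⁻¹ (Q1.end2 .se) (Q1.end3 .ne)

/-- `Q1.openVal` takes an arbitrary function `T`, so that one expression serves for indeterminates
and for traces. -/
theorem Q1.eval_openPoly (ρ : Q1.linkGroup →* SL(2, ℂ)) :
    MvPolynomial.eval (character ρ) Q1.openPoly = Q1.openVal tr (ρ (Q1.end1 .nw))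
      (ρ (Q1.end1 .sw)) (ρ (Q1.end2 .sw))⁻¹ (ρ (Q1.end2 .se)) (ρ (Q1.end3 .ne)) := by
  simp only [Q1.openPoly, Q1.openVal, map_mul, map_sub, map_add, aff_eval_X, character, map_inv]

theorem Q1.character_mem_of_openPoly (ρ : Q1.linkGroup →* SL(2, ℂ))
    (h : MvPolynomial.eval (character ρ) Q1.openPoly ≠ 0) : character ρ ∈ Q1.tripleChars := by
  obtain ⟨hc, h₁, h₂, h₃, -⟩ := colorQ1_unique (isLinkColoring_hom ρ) (x₁ := ρ (Q1.end1 .nw))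
    (y := ρ (Q1.end1 .sw)) (x₄ := (ρ (Q1.end2 .sw))⁻¹) (z := ρ (Q1.end3 .ne)) rfl rfl
    (inv_inv _).symm rfl
  rw [Q1.eval_openPoly, show ρ (Q1.end2 .se) = out₂ _ _ from
    congrFun hc (inR (inL (three.tip .se)))] at h
  obtain ⟨hx, hxy, hxz⟩ := Q1.eq_of_openVal_ne_zero h₁ h₂ h₃ h
  obtain ⟨-, ty, tz⟩ := Q1.trace_eq h₁ h₂ h₃
  rw [← hx] at hc
  exact ⟨ρ, _, _, _, Q1.hasValues_of_color hc (braid_of_trace ty.symm hxy)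
    (braid_of_trace tz.symm hxz), hxy, hxz, rfl⟩

theorem mkSL_inv {a b c d : ℂ} (h : a * d - b * c = 1) :
    (mkSL a b c d h)⁻¹ = mkSL d (-b) (-c) a (by linear_combination h) := by
  refine (eq_inv_of_mul_eq_one_left (mat_injective ?_)).symm
  rw [mkSL_mul]
  ext i j
  fin_cases i <;> fin_cases j <;> simp [mkSL, mat] <;>
    first | linear_combination h | ring1

theorem Q1.exists_openPoly_ne_zero : ∃ χ ∈ Q1.tripleChars ∩ irrCharVariety Q1.linkGroup,
    MvPolynomial.eval χ Q1.openPoly ≠ 0 := by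
  let x : SL(2, ℂ) := mkSL 1 1 0 1 (by norm_num)
  let y : SL(2, ℂ) := mkSL 1 0 (-1) 1 (by norm_num)
  have hxy : tr (x * y) = 1 := by rw [mkSL_mul, tr_mkSL]; norm_num
  have hy : tr y = tr x := by rw [tr_mkSL, tr_mkSL]
  obtain ⟨ρ, hρ⟩ := Q1.exists_hasValues hy hy hxy hxy
  obtain ⟨h1, -, h3, h4, h5, -, h7, -⟩ := id hρ
  refine ⟨character ρ, ⟨⟨ρ, x, y, y, hρ, hxy, hxy, rfl⟩, ρ, isIrrep_of_trace h1 h5 ?_, rfl⟩, ?_⟩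
  · rw [hy, hxy, tr_mkSL]
    norm_num
  · rw [Q1.eval_openPoly, h1, h3, h4, h5, h7]
    simp only [Q1.openVal, x, y, mkSL_inv, mkSL_mul, tr_mkSL]
    norm_num

end OpenQ1

/-! ### The components of Q₁ -/

section ComponentQ1

theorem Q1.isHighDimComponent_tripleChars :
    IsHighDimComponent Q1.tripleChars (charVariety Q1.linkGroup) := by
  refine ⟨isComponent_of_isOpen (U := {χ | MvPolynomial.eval χ Q1.openPoly ≠ 0})
    (Q1.isIsomorphismOn_coords.isIrreducible Q1.isIrreducible_surface) ?_ ?_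
    (isOpen_eval_ne_zero _) ?_ ?_,
    Q1.one_lt_krullDim_surface.trans_le Q1.isIsomorphismOn_coords.krullDim_le⟩
  · rintro _ ⟨ρ, x, y, z, -, -, -, rfl⟩
    exact ⟨ρ, rfl⟩
  · exact fun χ _ h => Q1.isClosed_tripleChars.closure_subset h
  · rintro _ ⟨ρ, rfl⟩ h
    exact Q1.character_mem_of_openPoly ρ h
  · obtain ⟨χ, hχ, h⟩ := Q1.exists_openPoly_ne_zero
    exact ⟨χ, hχ.1, h⟩

theorem Q1.isHighDimComponent_tripleChars_inter :
    IsHighDimComponent (Q1.tripleChars ∩ irrCharVariety Q1.linkGroup)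
      (irrCharVariety Q1.linkGroup) := by
  refine ⟨isComponent_of_isOpen (U := {χ | MvPolynomial.eval χ Q1.openPoly ≠ 0})
    (Q1.isIsomorphismOn_coords_irr.isIrreducible Q1.isIrreducible_surface_sdiff)
    Set.inter_subset_right ?_ (isOpen_eval_ne_zero _) ?_ ?_,
    Q1.one_lt_krullDim_surface_sdiff.trans_le Q1.isIsomorphismOn_coords_irr.krullDim_le⟩
  · exact fun χ hχ h =>
      ⟨Q1.isClosed_tripleChars.closure_subset (closure_mono Set.inter_subset_left h), hχ⟩
  · rintro _ ⟨ρ, hρ, rfl⟩ h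
    exact ⟨Q1.character_mem_of_openPoly ρ h, ρ, hρ, rfl⟩
  · obtain ⟨χ, hχ, h⟩ := Q1.exists_openPoly_ne_zero
    exact ⟨χ, hχ, h⟩

theorem Q1.longitude_of_character_mem {ρ : Q1.linkGroup →* SL(2, ℂ)} (hρ : IsIrrep ρ)
    (h : character ρ ∈ Q1.tripleChars) (e : Q1.HalfEdge) :
    ρ (Q1.longitude e) = ρ (Q1.arc e) ^ 24 := by
  obtain ⟨h', hxy, hxz⟩ := Q1.hasValues_of_character_mem hρ h
  exact h'.longitude hxy hxz e

theorem Q1.existsUnique_hasValues {t : ℂ} {x y z : SL(2, ℂ)} (hx : x ∈ Gset t) (hy : y ∈ Gset t)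
    (hz : z ∈ Gset t) (hxy : tr (x * y) = 1) (hxz : tr (x * z) = 1) :
    ∃! ρ, Q1.HasValues ρ x y z := by
  obtain ⟨ρ, hρ⟩ := Q1.exists_hasValues (hy.2.2.trans hx.2.2.symm) (hz.2.2.trans hx.2.2.symm)
    hxy hxz
  exact ⟨ρ, hρ, fun ρ' h => h.hom_ext hρ⟩

end ComponentQ1

/-! ### Solving the remaining relation of Q₂ for v -/

section SolveV

variable {R : Type*} [CommRing R]

/-- For a given value of tr(zv) the right side is affine in `v`; this is what allows the relation to
be inverted. -/
theorem mat_inv_out₂_inv {z v : SL(2, R)} (hv : (mat v).trace = (mat z).trace) :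
    mat (out₂ v⁻¹ z⁻¹)⁻¹ = (mat (z * v)).trace • mat z -
      ((mat z).trace * ((mat (z * v)).trace - 1)) • 1 -
      ((mat (z * v)).trace - 1) • ((mat z).trace • (mat z * mat v) -
        ((mat (z * v)).trace + 1) • mat v) := by
  have h0 : (mat v⁻¹).trace = (mat z⁻¹).trace := by rw [trace_mat_inv, trace_mat_inv, hv]
  have hs : (mat (v⁻¹ * z⁻¹)).trace = (mat (z * v)).trace := by rw [← mul_inv_rev, trace_mat_inv]
  have h1 : mat v * mat z * mat v = (mat (z * v)).trace • mat v + mat z - (mat z).trace • 1 := by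
    rw [mat_mul_mul, mat_mul v z, Matrix.trace_mul_comm, ← mat_mul]
  have h2 := mat_mul_self v
  rw [mat_inv, trace_out₂, trace_mat_inv, mat_out₂ h0, hs, inv_inv, mat_mul (v⁻¹ * z⁻¹) v, mat_mul v⁻¹,
    mat_inv, mat_inv, hv]
  rw [hv] at h2
  generalize (mat (z * v)).trace = s at *
  generalize (mat z).trace = t at *
  have h3 : (t • 1 - mat v) * (t • 1 - mat z) * mat v =
      s • mat v + mat z - t • (mat z * mat v) := by
    simp only [sub_mul, mul_sub, smul_mul_assoc, mul_smul_comm, one_mul, mul_one, h1, h2]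
    module
  rw [h3]
  module

theorem mul_out₂_eq_one_iff {x z v : SL(2, R)} (hv : (mat v).trace = (mat z).trace) :
    x * out₂ v⁻¹ z⁻¹ = 1 ↔ mat x = (mat (z * v)).trace • mat z -
      ((mat z).trace * ((mat (z * v)).trace - 1)) • 1 -
      ((mat (z * v)).trace - 1) • ((mat z).trace • (mat z * mat v) -
        ((mat (z * v)).trace + 1) • mat v) := by
  rw [← mat_inv_out₂_inv hv, mul_eq_one_iff_eq_inv, mat_injective.eq_iff]

/-- With t = tr z and s = tr(zv), the coefficient of v in the relation is (s - 1)(tz - (s + 1)). The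
adjugate of tz - (s + 1) is (t² - s - 1) - tz, and its determinant is (s + 1)² - st². -/
theorem smul_mat_of_mul_out₂ {x z v : SL(2, R)} (hv : (mat v).trace = (mat z).trace)
    (h : x * out₂ v⁻¹ z⁻¹ = 1) :
    ((((mat (z * v)).trace + 1) ^ 2 - (mat (z * v)).trace * (mat z).trace ^ 2) *
      ((mat (z * v)).trace - 1)) • mat v =
      (((mat z).trace ^ 2 - (mat (z * v)).trace - 1) • 1 - (mat z).trace • mat z) *
        ((mat (z * v)).trace • mat z - ((mat z).trace * ((mat (z * v)).trace - 1)) • 1 - mat x) := by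
  rw [(mul_out₂_eq_one_iff hv).1 h, sub_sub_cancel]
  have h1 : ∀ W, mat z * (mat z * W) = (mat z).trace • (mat z * W) - W := fun W => by
    rw [← mul_assoc, mat_mul_self, sub_mul, smul_mul_assoc, one_mul]
  simp only [sub_mul, mul_sub, smul_mul_assoc, mul_smul_comm, one_mul, h1]
  module

theorem trace_of_mul_out₂ {x z v : SL(2, R)} (hv : (mat v).trace = (mat z).trace)
    (h : x * out₂ v⁻¹ z⁻¹ = 1) :
    ((mat (z * v)).trace + 2 - (mat z).trace ^ 2) * ((mat (z * v)).trace - 1) ^ 2 =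
      (mat (x * z)).trace - (mat z).trace ^ 2 + 2 := by
  have h1 : (mat z * mat v * mat z).trace = (mat (z * v)).trace * (mat z).trace - (mat z).trace := by
    rw [mat_mul_mul, hv]
    simp only [Matrix.trace_sub, Matrix.trace_add, Matrix.trace_smul, Matrix.trace_one, hv,
      smul_eq_mul, Fintype.card_fin]
    push_cast
    ring
  have h2 : (mat v * mat z).trace = (mat (z * v)).trace := by
    rw [Matrix.trace_mul_comm, mat_mul]
  rw [mat_mul x, (mul_out₂_eq_one_iff hv).1 h]
  simp only [sub_mul, smul_mul_assoc, one_mul, Matrix.trace_sub, Matrix.trace_smul, mat_mul_self,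
    h1, h2, smul_eq_mul, Matrix.trace_one, Fintype.card_fin]
  push_cast
  ring

end SolveV

/-- The element `v` exists as soon as the traces of `x`, `z` and `xz` allow it. -/
theorem exists_mul_out₂_eq_one {t s : ℂ} {x z : SL(2, ℂ)} (hx : tr x = t) (hz : tr z = t)
    (hs : (s + 2 - t ^ 2) * (s - 1) ^ 2 = tr (x * z) - t ^ 2 + 2)
    (hD : ((s + 1) ^ 2 - s * t ^ 2) * (s - 1) ≠ 0) :
    ∃ v : SL(2, ℂ), tr v = t ∧ tr (z * v) = s ∧ x * out₂ v⁻¹ z⁻¹ = 1 := by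
  -- The only candidate, by `smul_mat_of_mul_out₂`. The equation `hs` is what gives V the trace t,
  -- the determinant 1 and tr(zV) = s.
  obtain ⟨V, hV⟩ : ∃ V : Matrix (Fin 2) (Fin 2) ℂ, V = (((s + 1) ^ 2 - s * t ^ 2) * (s - 1))⁻¹ •
      (((t ^ 2 - s - 1) • 1 - t • mat z) * (s • mat z - (t * (s - 1)) • 1 - mat x)) := ⟨_, rfl⟩
  have hzx : (mat z * mat x).trace = tr (x * z) := by rw [Matrix.trace_mul_comm, ← mat_mul]; rfl
  have hx' : (mat x).trace = t := hx
  have hz' : (mat z).trace = t := hz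
  have hzz : mat z * mat z = t • mat z - 1 := by rw [mat_mul_self, hz']
  have h1 : ∀ W, mat z * (mat z * W) = t • (mat z * W) - W := fun W => by
    rw [← mul_assoc, hzz, sub_mul, smul_mul_assoc, one_mul]
  have htr : V.trace = t := by
    rw [hV, Matrix.trace_smul, smul_eq_mul, inv_mul_eq_iff_eq_mul₀ hD]
    simp only [sub_mul, mul_sub, smul_mul_assoc, mul_smul_comm, one_mul, mul_one, hzz,
      Matrix.trace_sub, Matrix.trace_smul, Matrix.trace_one, hzx, hx', hz', smul_eq_mul,
      Fintype.card_fin]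
    push_cast
    linear_combination -t * hs
  have htr' : (mat z * V).trace = s := by
    rw [hV, mul_smul_comm, Matrix.trace_smul, smul_eq_mul, inv_mul_eq_iff_eq_mul₀ hD]
    simp only [sub_mul, mul_sub, smul_mul_assoc, mul_smul_comm, one_mul, mul_one, hzz, h1,
      Matrix.trace_sub, Matrix.trace_smul, Matrix.trace_one, hzx, hx', hz', smul_eq_mul,
      Fintype.card_fin]
    push_cast
    linear_combination -(s + 1) * hs
  have hdet : V.det = 1 := by
    have e₁ : ∀ (Z : Matrix (Fin 2) (Fin 2) ℂ) (a b : ℂ),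
        (a • 1 - b • Z).det = a ^ 2 - a * b * Z.trace + b ^ 2 * Z.det := fun Z a b => by
      simp [Matrix.det_fin_two, Matrix.trace_fin_two]
      ring
    have e₂ : ∀ (X Z : Matrix (Fin 2) (Fin 2) ℂ) (a b : ℂ), (a • Z - b • 1 - X).det =
        a ^ 2 * Z.det + b ^ 2 + X.det - a * b * Z.trace -
          a * (Z.trace * X.trace - (Z * X).trace) + b * X.trace := fun X Z a b => by
      simp [Matrix.det_fin_two, Matrix.trace_fin_two, Matrix.mul_apply, Fin.sum_univ_two]
      ring
    rw [hV, Matrix.det_smul, Matrix.det_mul, e₁, e₂, hzx, hx', hz', Fintype.card_fin, inv_pow,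
      inv_mul_eq_iff_eq_mul₀ (pow_ne_zero 2 hD), Matrix.SpecialLinearGroup.det_coe,
      Matrix.SpecialLinearGroup.det_coe]
    linear_combination -s * ((s + 1) ^ 2 - s * t ^ 2) * hs
  refine ⟨⟨V, hdet⟩, htr, htr', (mul_out₂_eq_one_iff (htr.trans hz.symm)).2 ?_⟩
  have htr'' : (mat (z * ⟨V, hdet⟩)).trace = s := htr'
  rw [htr'', hz']
  change mat x = s • mat z - (t * (s - 1)) • 1 - (s - 1) • (t • (mat z * V) - (s + 1) • V)
  have key : (((s + 1) ^ 2 - s * t ^ 2) * (s - 1)) • mat x =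
      (((s + 1) ^ 2 - s * t ^ 2) * (s - 1)) • (s • mat z - (t * (s - 1)) • 1) - (s - 1) •
        (t • (mat z * ((((s + 1) ^ 2 - s * t ^ 2) * (s - 1)) • V)) -
          (s + 1) • (((s + 1) ^ 2 - s * t ^ 2) * (s - 1)) • V) := by
    rw [hV, smul_inv_smul₀ hD]
    simp only [sub_mul, mul_sub, smul_mul_assoc, mul_smul_comm, one_mul, mul_one, hzz, h1]
    module
  refine smul_right_injective _ hD ?_
  simp only
  rw [key, mul_smul_comm]
  module

/-! ### The family of Q₂ and its coordinates -/

section RepsQ2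

theorem Q2.isLinkColoring_of_braid {G : Type*} [Group G] {x y z v : G}
    (hy : x * y * x = y * x * y) (hz : y * z * y = z * y * z) (hv : x * out₂ v⁻¹ z⁻¹ = 1) :
    Q2.IsLinkColoring (colorQ2 x y z v) := by
  have o : out₂ y z = z := out₂_of_braid hz
  refine isLinkColoring_colorQ2 ?_ ?_ hv ?_
  · rw [out₂_of_braid (braid_inv hy), out₁_of_braid hz, inv_mul_cancel]
  · rw [o, mul_inv_cancel]
  · rw [o, out₁_of_braid (braid_inv hy), ← mul_inv_rev, inv_eq_one, mul_eq_one_iff_eq_inv,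
      eq_inv_of_mul_eq_one_left hv, inv_inv]

theorem Q2.trace_eq {R : Type*} [CommRing R] {x y z v : SL(2, R)}
    (h₁ : out₂ x⁻¹ y⁻¹ * out₁ y z = 1) (h₂ : out₁ v⁻¹ z⁻¹ * (out₁ v⁻¹ (out₂ y z)⁻¹)⁻¹ = 1)
    (h₃ : x * out₂ v⁻¹ z⁻¹ = 1) : (mat y).trace = (mat x).trace ∧
      (mat z).trace = (mat x).trace ∧ (mat v).trace = (mat x).trace := by
  have e₁ := congrArg (fun g => (mat g).trace) (eq_inv_of_mul_eq_one_left h₁)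
  have e₂ := congrArg (fun g => (mat g).trace) (eq_inv_of_mul_eq_one_left h₂)
  have e₃ := congrArg (fun g => (mat g).trace) (eq_inv_of_mul_eq_one_left h₃)
  simp only [trace_mat_inv, trace_out₁, trace_out₂] at e₁ e₂ e₃
  exact ⟨e₂.symm.trans e₁.symm, e₁.symm, e₃.symm⟩

variable {ρ : Q2.linkGroup →* SL(2, ℂ)} {x y z v : SL(2, ℂ)}

theorem Q2.hasValues_of_color (hρ : (fun h => ρ (Q2.arc h)) = colorQ2 x y z v)
    (hy : x * y * x = y * x * y) (hz : y * z * y = z * y * z) : Q2.HasValues ρ x y z v :=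
  ⟨(congrFun hρ _).trans (inv_inv x),
    (congrFun hρ _).trans ((colorThree_ne _ _).trans (out₁_of_braid (braid_inv hy))),
    (congrFun hρ _).trans (inv_inv y),
    (congrFun hρ (inL (three.tip .se))).trans (out₂_of_braid (braid_inv hy)),
    (congrFun hρ (inR (inL (three.tip .se)))).trans (out₂_of_braid hz),
    congrFun hρ (inR (inL (three.tip .sw))),
    (congrFun hρ _).trans (inv_inv v)⟩

theorem Q2.HasValues.color (h : Q2.HasValues ρ x y z v) :
    (fun h => ρ (Q2.arc h)) = colorQ2 x y z v ∧ tr y = tr x ∧ tr z = tr x ∧ tr v = tr x ∧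
      x * out₂ v⁻¹ z⁻¹ = 1 := by
  obtain ⟨h1, -, h3, -, -, h6, h7⟩ := h
  obtain ⟨hc, e1, e2, e3, -⟩ := colorQ2_unique (isLinkColoring_hom ρ) h1 h3 h6 h7
  obtain ⟨t1, t2, t3⟩ := Q2.trace_eq e1 e2 e3
  exact ⟨hc, t1, t2, t3, e3⟩

theorem Q2.exists_hasValues (hy : tr y = tr x) (hz : tr z = tr x) (hxy : tr (x * y) = 1)
    (hyz : tr (y * z) = 1) (hv : x * out₂ v⁻¹ z⁻¹ = 1) : ∃ ρ, Q2.HasValues ρ x y z v := by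
  have by' := braid_of_trace hy.symm hxy
  have bz := braid_of_trace (hy.trans hz.symm) hyz
  exact ⟨(Q2.isLinkColoring_of_braid by' bz hv).hom,
    Q2.hasValues_of_color (funext (Q2.isLinkColoring_of_braid by' bz hv).hom_arc) by' bz⟩

theorem Q2.HasValues.longitude (h : Q2.HasValues ρ x y z v) (hxy : tr (x * y) = 1)
    (hyz : tr (y * z) = 1) (e : Q2.HalfEdge) : ρ (Q2.longitude e) = ρ (Q2.arc e) ^ 12 := by
  obtain ⟨hc, hy, hz, -, hv⟩ := h.color
  exact Q2.longitude_of_color hc hv (braid_of_trace hy.symm hxy)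
    (braid_of_trace (hy.trans hz.symm) hyz)
    (braid_square hy.symm hxy) (braid_square (hy.trans hz.symm) hyz) (by simp) (by simp) e

theorem Q2.HasValues.coords (h : Q2.HasValues ρ x y z v) :
    Q2.coords (character ρ) = ![tr x, tr (x * z), tr (x * y * z), tr (z * v)] := by
  obtain ⟨h1, -, h3, -, h5, -, h7⟩ := h
  simp only [Q2.coords, character, map_mul, h1, h3, h5, h7]
  rfl

/-- On the surface, the denominator of the formula for `v` does not vanish. -/
theorem Q2.denom_ne_zero {t u s : ℂ} (hs : (s + 2 - t ^ 2) * (s - 1) ^ 2 = u - t ^ 2 + 2)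
    (hu : u ∈ Bset t) : ((s + 1) ^ 2 - s * t ^ 2) * (s - 1) ≠ 0 := by
  -- The equation `hs` says u + 2 - t² = (s + 2 - t²)(s - 1)² and is equivalent to u - 2 = (s -
  -- 2)((s + 1)² - st²).
  refine mul_ne_zero (fun h => hu.1 ?_) fun h => hu.2 ?_
  · linear_combination (s - 2) * h - hs
  · linear_combination (s + 2 - t ^ 2) * (s - 1) * h - hs

noncomputable def Q2.denom : MvPolynomial (Fin 4) ℂ :=
  ((.X 3 + 1) ^ 2 - .X 3 * .X 0 ^ 2) * (.X 3 - 1)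

theorem Q2.eval_denom (p : Aff (Fin 4)) : MvPolynomial.eval p Q2.denom =
    ((p 3 + 1) ^ 2 - p 3 * p 0 ^ 2) * (p 3 - 1) := by
  simp only [Q2.denom, map_mul, map_sub, map_add, map_pow, map_one, aff_eval_X]

/-- By `smul_mat_of_mul_out₂` the element v is determined by x, z and tr(zv), as the denominator is
nonzero. -/
theorem Q2.HasValues.eq_of_tr {v' : SL(2, ℂ)} {ρ' : Q2.linkGroup →* SL(2, ℂ)}
    (h : Q2.HasValues ρ x y z v) (h' : Q2.HasValues ρ' x y z v')
    (hu : tr (x * z) ∈ Bset (tr x)) (hvv : tr (z * v) = tr (z * v')) : ρ = ρ' := by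
  obtain ⟨hc, -, hz, hv, e⟩ := h.color
  obtain ⟨hc', -, -, hv', e'⟩ := h'.color
  have hs := trace_of_mul_out₂ (hv.trans hz.symm) e
  have k := smul_mat_of_mul_out₂ (hv.trans hz.symm) e
  have k' := smul_mat_of_mul_out₂ (hv'.trans hz.symm) e'
  rw [show (mat (z * v')).trace = (mat (z * v)).trace from hvv.symm, ← k] at k'
  have hz' : (mat z).trace = tr x := hz
  rw [hz'] at hs k'
  have : v' = v := mat_injective (smul_right_injective _ (Q2.denom_ne_zero hs hu) k')
  rw [this] at hc'
  exact linkGroup_hom_ext (congrFun (hc.trans hc'.symm))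

theorem Q2.existsUnique_hasValues {t s : ℂ} (hx : x ∈ Gset t) (hy : y ∈ Gset t) (hz : z ∈ Gset t)
    (hxy : tr (x * y) = 1) (hyz : tr (y * z) = 1) (hu : tr (x * z) ∈ Bset t)
    (hs : (s + 2 - t ^ 2) * (s - 1) ^ 2 = tr (x * z) - t ^ 2 + 2) :
    ∃! ρ, ∃ v, Q2.HasValues ρ x y z v ∧ tr (z * v) = s := by
  obtain ⟨v, -, hvs, hv⟩ := exists_mul_out₂_eq_one hx.2.2 hz.2.2 hs (Q2.denom_ne_zero hs hu)
  obtain ⟨ρ, hρ⟩ := Q2.exists_hasValues (hy.2.2.trans hx.2.2.symm) (hz.2.2.trans hx.2.2.symm)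
    hxy hyz hv
  refine ⟨ρ, ⟨v, hρ, hvs⟩, ?_⟩
  rintro ρ' ⟨v', hρ', hvs'⟩
  refine hρ'.eq_of_tr hρ ?_ (hvs'.trans hvs.symm)
  rw [hx.2.2]
  exact hu

theorem mat_mem_of_mul_out₂ {R : Type*} [CommRing R] {S : Subring R}
    {N : Subring (Matrix (Fin 2) (Fin 2) R)} {x z v : SL(2, R)}
    (hv : (mat v).trace = (mat z).trace) (h : x * out₂ v⁻¹ z⁻¹ = 1) (ht : (mat z).trace ∈ S)
    (hs : (mat (z * v)).trace ∈ S) {d : R} (hd : d ∈ S)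
    (hd1 : d * ((((mat (z * v)).trace + 1) ^ 2 - (mat (z * v)).trace * (mat z).trace ^ 2) *
      ((mat (z * v)).trace - 1)) = 1)
    (hN : ∀ c ∈ S, c • (1 : Matrix (Fin 2) (Fin 2) R) ∈ N) (hx : mat x ∈ N) (hz : mat z ∈ N) :
    mat v ∈ N := by
  have hsc : ∀ c ∈ S, ∀ m ∈ N, c • m ∈ N := fun c hc m hm => by
    have := N.mul_mem (hN c hc) hm
    rwa [smul_mul_assoc, one_mul] at this
  rw [← one_smul R (mat v), ← hd1, mul_smul, smul_mat_of_mul_out₂ hv h]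
  have hs1 := S.sub_mem hs S.one_mem
  refine hsc _ hd _ (N.mul_mem (N.sub_mem (hN _ ?_) (hsc _ ht _ hz))
    (N.sub_mem (N.sub_mem (hsc _ hs _ hz) (hN _ (S.mul_mem ht hs1))) hx))
  exact S.sub_mem (S.sub_mem (S.pow_mem ht 2) hs) S.one_mem

/-- The method of `Q1.exists_eval` with one change: the matrix of v is obtained from x and z by
dividing by `Q2.denom`, so powers of this denominator enter. -/
theorem Q2.exists_eval (γ : Q2.linkGroup) : ∃ (P : MvPolynomial (Fin 4) ℂ) (n : ℕ),
    ∀ χ ∈ Q2.family, χ γ * MvPolynomial.eval (Q2.coords χ) Q2.denom ^ n =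
      MvPolynomial.eval (Q2.coords χ) P := by
  let ι := {p : SL(2, ℂ) × SL(2, ℂ) × SL(2, ℂ) × SL(2, ℂ) // tr p.2.1 = tr p.1 ∧
    tr p.2.2.1 = tr p.1 ∧ tr p.2.2.2 = tr p.1 ∧ tr (p.1 * p.2.1) = 1 ∧ tr (p.2.1 * p.2.2.1) = 1 ∧
    p.1 * out₂ p.2.2.2⁻¹ p.2.2.1⁻¹ = 1 ∧ tr (p.1 * p.2.2.1) ∈ Bset (tr p.1)}
  let X : ι → SL(2, ℂ) := fun p => p.1.1
  let Y : ι → SL(2, ℂ) := fun p => p.1.2.1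
  let Z : ι → SL(2, ℂ) := fun p => p.1.2.2.1
  let V : ι → SL(2, ℂ) := fun p => p.1.2.2.2
  have tY : ∀ p, tr (Y p) = tr (X p) := fun p => p.2.1
  have tZ : ∀ p, tr (Z p) = tr (X p) := fun p => p.2.2.1
  have tV : ∀ p, tr (V p) = tr (X p) := fun p => p.2.2.2.1
  have tXY : ∀ p, tr (X p * Y p) = 1 := fun p => p.2.2.2.2.1
  have tYZ : ∀ p, tr (Y p * Z p) = 1 := fun p => p.2.2.2.2.2.1
  have hV : ∀ p, X p * out₂ (V p)⁻¹ (Z p)⁻¹ = 1 := fun p => p.2.2.2.2.2.2.1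
  have hB : ∀ p, tr (X p * Z p) ∈ Bset (tr (X p)) := fun p => p.2.2.2.2.2.2.2
  have hY : X * Y * X = Y * X * Y := funext fun p => braid_of_trace (tY p).symm (tXY p)
  have hZ : Y * Z * Y = Z * Y * Z :=
    funext fun p => braid_of_trace ((tY p).trans (tZ p).symm) (tYZ p)
  have hV' : X * out₂ V⁻¹ Z⁻¹ = 1 := funext hV
  let q : ι → Aff (Fin 4) := fun p =>
    ![tr (X p), tr (X p * Z p), tr (X p * Y p * Z p), tr (Z p * V p)]
  let S := coordSubring q Q2.denom
  have hX : (fun p => tr (X p)) ∈ S := mem_coordSubring q _ 0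
  have hs : (fun p => tr (Z p * V p)) ∈ S := mem_coordSubring q _ 3
  have htZ : (fun p => tr (Z p)) = fun p => tr (X p) := funext tZ
  have htV : (fun p => tr (V p)) = fun p => tr (X p) := funext tV
  let Φ := (Q2.isLinkColoring_of_braid hY hZ hV').hom
  have hΦ : ∀ e, Φ (Q2.arc e) = colorQ2 X Y Z V e :=
    (Q2.isLinkColoring_of_braid hY hZ hV').hom_arc
  have hmem : Φ γ ∈ Subgroup.closure {X, Y, Z, V} := map_mem_of_arc Φ (fun e => by
    rw [hΦ]
    exact colorQ2_mem (Subgroup.subset_closure (by simp)) (Subgroup.subset_closure (by simp))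
      (Subgroup.subset_closure (by simp)) (Subgroup.subset_closure (by simp)) e) γ
  have hne : ∀ p, MvPolynomial.eval (q p) Q2.denom ≠ 0 := fun p => by
    rw [Q2.eval_denom]
    have := trace_of_mul_out₂ ((tV p).trans (tZ p).symm) (hV p)
    rw [show (mat (Z p)).trace = tr (X p) from tZ p] at this
    exact Q2.denom_ne_zero this (hB p)
  have hinv : (fun p => (MvPolynomial.eval (q p) Q2.denom)⁻¹) ∈ S :=
    ⟨1, 1, fun p => by rw [pow_one, inv_mul_cancel₀ (hne p), map_one]⟩
  have hd : (fun p => (MvPolynomial.eval (q p) Q2.denom)⁻¹) *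
      ((((fun p => tr ((Z * V) p)) + 1) ^ 2 - (fun p => tr ((Z * V) p)) * (fun p => tr (X p)) ^ 2) *
        ((fun p => tr ((Z * V) p)) - 1) : ι → ℂ) = 1 := funext fun p =>
    (congrArg ((MvPolynomial.eval (q p) Q2.denom)⁻¹ * ·) (Q2.eval_denom (q p)).symm).trans
      (inv_mul_cancel₀ (hne p))
  obtain ⟨P, n, hP⟩ : (fun p => tr (Φ γ p)) ∈ S := by
    refine tr_mem_of_mem_closure S hX ?_ ?_ ?_ (mem_coordSubring q _ 1) ?_ (mem_coordSubring q _ 2)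
      (fun N h1 h2 h3 hN a ha => ?_) hmem
    · rwa [show (fun p => tr (Y p)) = fun p => tr (X p) from funext tY]
    · rwa [htZ]
    · rw [show (fun p => tr (X p * Y p)) = 1 from funext tXY]
      exact S.one_mem
    · rw [show (fun p => tr (Y p * Z p)) = 1 from funext tYZ]
      exact S.one_mem
    · rcases ha with rfl | rfl | rfl | rfl
      · exact h1
      · exact h2
      · exact h3
      · exact mat_mem_of_mul_out₂ (x := piSL X) (z := piSL Z)
          (by rw [trace_piSL, trace_piSL, htZ, htV]) (by
            have := congrArg piSL hV'
            simpa only [out₂, map_mul, map_inv, map_one] using this)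
          (by rw [trace_piSL, htZ]; exact hX) (by rw [← map_mul, trace_piSL]; exact hs)
          hinv (by rw [← map_mul, trace_piSL, trace_piSL, htZ]; exact hd) hN h1 h3
  refine ⟨P, n, ?_⟩
  rintro _ ⟨ρ, x, y, z, v, -, hρ, hxy, hyz, hu, -, rfl⟩
  obtain ⟨hc, hy, hz, hv, e⟩ := hρ.color
  let p : ι := ⟨(x, y, z, v), hy, hz, hv, hxy, hyz, e, hu⟩
  have he : (Pi.evalMonoidHom (fun _ : ι => SL(2, ℂ)) p).comp Φ = ρ := by
    refine linkGroup_hom_ext (congrFun (Eq.trans ?_ hc.symm))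
    refine (colorQ2_unique (isLinkColoring_hom _) ?_ ?_ ?_ ?_).1
    · exact (congrFun (hΦ _) p).trans (inv_inv x)
    · exact (congrFun (hΦ _) p).trans (inv_inv y)
    · exact congrFun (hΦ (inR (inL (three.tip .sw)))) p
    · exact (congrFun (hΦ _) p).trans (inv_inv v)
  have := hP p
  rw [hρ.coords, ← he]
  exact this

theorem Q2.mapsTo_coords : Set.MapsTo Q2.coords Q2.family Q2.surface := by
  rintro _ ⟨ρ, x, y, z, v, -, hρ, hxy, hyz, hu, hs, rfl⟩
  obtain ⟨-, hy, hz, hv, e⟩ := hρ.color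
  have h := fpoly_tr hy hz
  rw [hxy, hyz, fpoly] at h
  have h' := trace_of_mul_out₂ (hv.trans hz.symm) e
  rw [show (mat z).trace = tr x from hz] at h'
  rw [hρ.coords]
  refine Q2.mem_surface.2 ⟨?_, h', hu, hs⟩
  rw [fpoly]
  linear_combination h

theorem Q2.exists_mem_coords_eq {p : Aff (Fin 4)} (hp : p ∈ Q2.surface) :
    ∃ χ ∈ Q2.family, Q2.coords χ = p := by
  obtain ⟨hf, hs, hu, hs'⟩ := hp
  -- The roles are permuted cyclically because here it is y whose products with the two others have
  -- trace 1.
  obtain ⟨y, z, x, hy, hz, hx, hyz, hyx, hzx, hyzx, -⟩ := exists_triple hf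
  rw [tr_mul_comm] at hyx hzx
  rw [tr_mul_comm, ← mul_assoc] at hyzx
  rw [← hzx] at hs hu
  have ht := hx.symm
  obtain ⟨v, -, hvs, hv⟩ := exists_mul_out₂_eq_one hx hz hs (Q2.denom_ne_zero hs hu)
  obtain ⟨ρ, hρ⟩ := Q2.exists_hasValues (hy.trans ht) (hz.trans ht) hyx hyz hv
  refine ⟨character ρ, ⟨ρ, x, y, z, v, isIrrep_of_trace hρ.1 hρ.2.2.2.2.1 ?_, hρ, hyx, hyz, ?_, ?_,
    rfl⟩, ?_⟩
  -- The expression for the pair x, z is (t₁₃ - 2)(t₁₃ + 2 - t²).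
  · rw [hx, hz]
    have := mul_ne_zero (sub_ne_zero.2 hu.1) (sub_ne_zero.2 hu.2)
    exact fun h => this (by linear_combination h)
  · rwa [hx]
  · rwa [hx, hvs]
  · rw [hρ.coords, hx, hzx, hyzx, hvs]
    refine funext fun j => ?_
    fin_cases j <;> rfl

theorem Q2.coords_apply (χ : Aff Q2.linkGroup) (j : Fin 4) : Q2.coords χ j =
    χ ((![Q2.end1 .nw, Q2.end1 .nw * Q2.end2 .se, Q2.end1 .nw * Q2.end1 .sw * Q2.end2 .se,
      Q2.end2 .se * Q2.end3 .ne] : Fin 4 → Q2.linkGroup) j) := by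
  fin_cases j <;> rfl

theorem Q2.isIsomorphismOn_coords : IsIsomorphismOn Q2.coords Q2.family Q2.surface := by
  refine isIsomorphismOn_of_surjOn (D := Q2.denom) (isRegularMapOn_comp _ _ Q2.coords_apply)
    Q2.mapsTo_coords (fun _ => Q2.exists_mem_coords_eq) (fun z hz => ?_) Q2.exists_eval
  rw [Q2.eval_denom]
  exact Q2.denom_ne_zero hz.2.1 hz.2.2.1

end RepsQ2

/-! ### An open condition that isolates the family of Q₂ -/

section OpenQ2

/-- An expression in the values of a function `T` on a group, whose nonvanishing for the trace forces
the braid relations between `x`, `y` and between `y`, `z`. -/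
def Q2.openVal {A R : Type*} [Group A] [CommRing R] (T : A → R) (x y z : A) : R :=
  (T (x * x⁻¹) - T (x * (x⁻¹ * y⁻¹ * x⁻¹⁻¹))) *
      (T (z * (y * z * y)) - T (z * (y * z * (y * z * y⁻¹)))) -
    (T (z * x⁻¹) - T (z * (x⁻¹ * y⁻¹ * x⁻¹⁻¹))) *
      (T (x * (y * z * y)) - T (x * (y * z * (y * z * y⁻¹))))

/-- Tracing `h₁` against any w gives a homogeneous linear equation in tr(xy) - 1 and tr(yz) - 1. The
choices w = x and w = z form a system whose determinant is `Q2.openVal` up to sign. -/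
theorem Q2.tr_eq_one_of_openVal_ne_zero {x y z : SL(2, ℂ)} (ty : tr y = tr x) (tz : tr z = tr x)
    (h₁ : out₂ x⁻¹ y⁻¹ * out₁ y z = 1) (hne : Q2.openVal tr x y z ≠ 0) :
    tr (x * y) = 1 ∧ tr (y * z) = 1 := by
  have E : ∀ w : SL(2, ℂ), (tr (x * y) - 1) * (tr (w * x⁻¹) - tr (w * (x⁻¹ * y⁻¹ * x⁻¹⁻¹))) =
      (tr (y * z) - 1) * (tr (w * (y * z * y)) - tr (w * (y * z * (y * z * y⁻¹)))) := by
    intro w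
    have := congrArg (fun g => tr (w * g)) (eq_inv_of_mul_eq_one_left h₁)
    have i : tr x⁻¹ = tr y⁻¹ := by rw [tr_inv, tr_inv, ty]
    simp only [tr_mul_inv w (out₁ _ _), tr_mul_inv w y, tr_mul_out₁ _ (ty.trans tz.symm),
      tr_mul_out₂ _ i, tr_inv_mul_inv, show tr (out₁ y z) = tr z from trace_out₁ _ _] at this
    rw [tz, ty] at this
    linear_combination this
  have e₁ := E x
  have e₂ := E z
  rw [Q2.openVal] at hne
  generalize tr (x * x⁻¹) - tr (x * (x⁻¹ * y⁻¹ * x⁻¹⁻¹)) = a at *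
  generalize tr (z * (y * z * y)) - tr (z * (y * z * (y * z * y⁻¹))) = b at *
  generalize tr (z * x⁻¹) - tr (z * (x⁻¹ * y⁻¹ * x⁻¹⁻¹)) = a' at *
  generalize tr (x * (y * z * y)) - tr (x * (y * z * (y * z * y⁻¹))) = b' at *
  refine ⟨sub_eq_zero.1 ((mul_eq_zero.1 (?_ : _ * (a * b - a' * b') = 0)).resolve_right hne),
    sub_eq_zero.1 ((mul_eq_zero.1 (?_ : _ * (a * b - a' * b') = 0)).resolve_right hne)⟩
  · linear_combination b * e₁ - b' * e₂
  · linear_combination a' * e₁ - a * e₂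

/-- The polynomial in the values of a character that expresses `tr(xz), tr(zv) ∈ 𝔹_t`. -/
noncomputable def Q2.boundPoly : MvPolynomial Q2.linkGroup ℂ :=
  (.X (Q2.end1 .nw * Q2.end2 .se) - 2) *
    (.X (Q2.end1 .nw * Q2.end2 .se) - (.X (Q2.end1 .nw) ^ 2 - 2)) *
    ((.X (Q2.end2 .se * Q2.end3 .ne) - 2) *
    (.X (Q2.end2 .se * Q2.end3 .ne) - (.X (Q2.end1 .nw) ^ 2 - 2)))

theorem Q2.eval_boundPoly (χ : Aff Q2.linkGroup) : MvPolynomial.eval χ Q2.boundPoly ≠ 0 ↔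
    χ (Q2.end1 .nw * Q2.end2 .se) ∈ Bset (χ (Q2.end1 .nw)) ∧
      χ (Q2.end2 .se * Q2.end3 .ne) ∈ Bset (χ (Q2.end1 .nw)) := by
  simp only [Q2.boundPoly, map_mul, map_sub, map_pow, map_ofNat, aff_eval_X, mul_ne_zero_iff,
    sub_ne_zero, Bset, Set.mem_ofPred_eq]

noncomputable def Q2.openPoly : MvPolynomial Q2.linkGroup ℂ :=
  Q2.openVal MvPolynomial.X (Q2.end1 .nw) (Q2.end1 .sw) (Q2.end2 .sw)⁻¹

theorem Q2.eval_openPoly (ρ : Q2.linkGroup →* SL(2, ℂ)) :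
    MvPolynomial.eval (character ρ) Q2.openPoly = Q2.openVal tr (ρ (Q2.end1 .nw))
      (ρ (Q2.end1 .sw)) (ρ (Q2.end2 .sw))⁻¹ := by
  simp only [Q2.openPoly, Q2.openVal, map_mul, map_sub, aff_eval_X, character, map_inv]

theorem Q2.character_mem_family {ρ : Q2.linkGroup →* SL(2, ℂ)} (hρ : IsIrrep ρ)
    {x y z v : SL(2, ℂ)} (h : Q2.HasValues ρ x y z v) (hxy : tr (x * y) = 1)
    (hyz : tr (y * z) = 1) (hB : MvPolynomial.eval (character ρ) Q2.boundPoly ≠ 0) :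
    character ρ ∈ Q2.family := by
  obtain ⟨hB1, hB2⟩ := (Q2.eval_boundPoly _).1 hB
  obtain ⟨h1, -, h3, -, h5, -, h7⟩ := id h
  simp only [character, map_mul, h1, h5, h7] at hB1 hB2
  exact ⟨ρ, x, y, z, v, hρ, h, hxy, hyz, hB1, hB2, rfl⟩

theorem Q2.character_mem_of_openPoly {ρ : Q2.linkGroup →* SL(2, ℂ)} (hρ : IsIrrep ρ)
    (h : MvPolynomial.eval (character ρ) (Q2.openPoly * Q2.boundPoly) ≠ 0) :
    character ρ ∈ Q2.family := by
  rw [map_mul, mul_ne_zero_iff] at h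
  obtain ⟨hc, h₁, h₂, h₃, -⟩ := colorQ2_unique (isLinkColoring_hom ρ) (x := ρ (Q2.end1 .nw))
    (y := ρ (Q2.end1 .sw)) (z := (ρ (Q2.end2 .sw))⁻¹) (v := ρ (Q2.end3 .ne)) rfl rfl
    (inv_inv _).symm rfl
  obtain ⟨ty, tz, -⟩ := Q2.trace_eq h₁ h₂ h₃
  rw [Q2.eval_openPoly] at h
  obtain ⟨hxy, hyz⟩ := Q2.tr_eq_one_of_openVal_ne_zero ty tz h₁ h.1
  exact Q2.character_mem_family hρ (Q2.hasValues_of_color hc (braid_of_trace ty.symm hxy)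
    (braid_of_trace (ty.trans tz.symm) hyz)) hxy hyz h.2

theorem Q2.exists_openPoly_ne_zero : ∃ χ ∈ Q2.family,
    MvPolynomial.eval χ (Q2.openPoly * Q2.boundPoly) ≠ 0 := by
  let x : SL(2, ℂ) := mkSL (-5) 36 (-1) 7 (by norm_num)
  let y : SL(2, ℂ) := mkSL 1 1 0 1 (by norm_num)
  let z : SL(2, ℂ) := mkSL 1 0 (-1) 1 (by norm_num)
  have hx : tr x = 2 := by rw [tr_mkSL]; norm_num
  have hy : tr y = 2 := by rw [tr_mkSL]; norm_num
  have hz : tr z = 2 := by rw [tr_mkSL]; norm_num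
  have hxy : tr (x * y) = 1 := by rw [mkSL_mul, tr_mkSL]; norm_num
  have hyz : tr (y * z) = 1 := by rw [mkSL_mul, tr_mkSL]; norm_num
  have hxz : tr (x * z) = -34 := by rw [mkSL_mul, tr_mkSL]; norm_num
  obtain ⟨v, -, hvs, hv⟩ := exists_mul_out₂_eq_one (s := -2) hx hz (by rw [hxz]; norm_num)
    (by norm_num)
  obtain ⟨ρ, hρ⟩ := Q2.exists_hasValues (hy.trans hx.symm) (hz.trans hx.symm) hxy hyz hv
  obtain ⟨h1, -, h3, -, h5, h6, h7⟩ := id hρ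
  have hirr : IsIrrep ρ := isIrrep_of_trace h1 h5 (by rw [hx, hz, hxz]; norm_num)
  have hB : MvPolynomial.eval (character ρ) Q2.boundPoly ≠ 0 := by
    rw [Q2.eval_boundPoly]
    simp only [character, map_mul, h1, h5, h7, hx, hxz, hvs, Bset, Set.mem_ofPred_eq]
    norm_num
  refine ⟨character ρ, Q2.character_mem_family hirr hρ hxy hyz hB, ?_⟩
  rw [map_mul]
  refine mul_ne_zero ?_ hB
  rw [Q2.eval_openPoly, h1, h3, h6]
  simp only [Q2.openVal, x, y, z, mkSL_inv, mkSL_mul, tr_mkSL]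
  norm_num

end OpenQ2

/-! ### The component of Q₂ -/

section ComponentQ2

/-- The closure of the family in the irreducible character variety. -/
def Q2.familyClosure : Set (Aff Q2.linkGroup) :=
  closure Q2.family ∩ irrCharVariety Q2.linkGroup

theorem Q2.family_subset : Q2.family ⊆ Q2.familyClosure := by
  refine fun χ hχ => ⟨subset_closure hχ, ?_⟩
  obtain ⟨ρ, x, y, z, v, hρ, -, -, -, -, -, rfl⟩ := hχ
  exact ⟨ρ, hρ, rfl⟩

/-- Relations between values and the equations for traces are closed conditions, so they persist in
the closure; the conditions in `Bset` are open and may be lost there. -/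
theorem Q2.hasValues_of_character_mem {ρ : Q2.linkGroup →* SL(2, ℂ)} (hρ : IsIrrep ρ)
    (h : character ρ ∈ closure Q2.family) :
    Q2.HasValues ρ (ρ (Q2.end1 .nw)) (ρ (Q2.end1 .sw)) (ρ (Q2.end2 .se)) (ρ (Q2.end3 .ne)) ∧
      tr (ρ (Q2.end1 .nw) * ρ (Q2.end1 .sw)) = 1 ∧ tr (ρ (Q2.end1 .sw) * ρ (Q2.end2 .se)) = 1 := by
  have key : ∀ {a b}, (∀ ρ' x y z v, Q2.HasValues ρ' x y z v → ρ' a = ρ' b) → ρ a = ρ b := by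
    intro a b hab
    refine hρ.eq_of_mem_closure h ?_
    rintro _ ⟨ρ', x, y, z, v, -, h', -, -, -, -, rfl⟩
    exact ⟨ρ', rfl, hab ρ' x y z v h'⟩
  have key' : ∀ {a}, (∀ χ ∈ Q2.family, χ a = 1) → tr (ρ a) = 1 := by
    intro a ha
    have := mem_closure_iff_eval.1 h (.X a - 1) fun χ hχ => by
      rw [map_sub, aff_eval_X, ha χ hχ, map_one, sub_self]
    rwa [map_sub, aff_eval_X, map_one, sub_eq_zero] at this
  refine ⟨⟨rfl, ?_, rfl, ?_, rfl, ?_, rfl⟩, ?_, ?_⟩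
  · rw [← map_inv]
    refine key fun ρ' x y z v h => ?_
    rw [map_inv, h.1, h.2.1]
  · rw [← map_inv]
    refine key fun ρ' x y z v h => ?_
    rw [map_inv, h.2.2.1, h.2.2.2.1]
  · rw [← map_inv]
    refine key fun ρ' x y z v h => ?_
    rw [map_inv, h.2.2.2.2.1, h.2.2.2.2.2.1]
  · rw [← map_mul]
    refine key' ?_
    rintro _ ⟨ρ', x, y, z, v, -, h', hxy, -, -, -, rfl⟩
    rw [character, map_mul, h'.1, h'.2.2.1, hxy]
  · rw [← map_mul]
    refine key' ?_
    rintro _ ⟨ρ', x, y, z, v, -, h', -, hyz, -, -, rfl⟩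
    rw [character, map_mul, h'.2.2.1, h'.2.2.2.2.1, hyz]

theorem Q2.isIrreducible_family : IsIrreducible Q2.family :=
  Q2.isIsomorphismOn_coords.isIrreducible Q2.isIrreducible_surface

theorem Q2.isHighDimComponent_familyClosure :
    IsHighDimComponent Q2.familyClosure (irrCharVariety Q2.linkGroup) := by
  have hcl : closure Q2.familyClosure = closure Q2.family :=
    (closure_minimal Set.inter_subset_left isClosed_closure).antisymm
      (closure_mono Q2.family_subset)
  refine ⟨isComponent_of_isOpen
    (U := {χ | MvPolynomial.eval χ (Q2.openPoly * Q2.boundPoly) ≠ 0}) ?_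
    Set.inter_subset_right (fun χ hχ h => ⟨hcl ▸ h, hχ⟩) (isOpen_eval_ne_zero _) ?_ ?_, ?_⟩
  · rw [← isIrreducible_iff_closure, hcl]
    exact Q2.isIrreducible_family.closure
  · rintro _ ⟨ρ, hρ, rfl⟩ h
    exact Q2.family_subset (Q2.character_mem_of_openPoly hρ h)
  · obtain ⟨χ, hχ, h⟩ := Q2.exists_openPoly_ne_zero
    exact ⟨χ, Q2.family_subset hχ, h⟩
  · exact (Q2.one_lt_krullDim_surface.trans_le Q2.isIsomorphismOn_coords.krullDim_le).trans_le
      (Topology.IsEmbedding.inclusion Q2.family_subset).isInducing.topologicalKrullDim_le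

/-- The conditions in `Bset` are the only ones that can fail at an irreducible character in the
closure, so imposing them again recovers the family. -/
theorem Q2.isZariskiOpenIn_family : IsZariskiOpenIn Q2.family Q2.familyClosure := by
  refine ⟨{χ | MvPolynomial.eval χ Q2.boundPoly ≠ 0}, isOpen_eval_ne_zero _, ?_⟩
  ext χ
  constructor
  · refine fun hχ => ⟨Q2.family_subset hχ, (Q2.eval_boundPoly χ).2 ?_⟩
    obtain ⟨ρ, x, y, z, v, -, h, -, -, hu, hs, rfl⟩ := hχ
    simp only [character, map_mul, h.1, h.2.2.2.2.1, h.2.2.2.2.2.2]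
    exact ⟨hu, hs⟩
  · rintro ⟨⟨hχ, ρ, hρ, rfl⟩, hB⟩
    obtain ⟨h, hxy, hyz⟩ := Q2.hasValues_of_character_mem hρ hχ
    exact Q2.character_mem_family hρ h hxy hyz hB

theorem Q2.longitude_of_character_mem {ρ : Q2.linkGroup →* SL(2, ℂ)} (hρ : IsIrrep ρ)
    (h : character ρ ∈ Q2.familyClosure) (e : Q2.HalfEdge) :
    ρ (Q2.longitude e) = ρ (Q2.arc e) ^ 12 := by
  obtain ⟨h', hxy, hyz⟩ := Q2.hasValues_of_character_mem hρ h.1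
  exact h'.longitude hxy hyz e

end ComponentQ2

end HDC

/-! ### Assembly -/

theorem mainTheorem6 :
    -- the knot `Q₁`
    (HDC.Q1.IsKnot ∧ (∀ h : HDC.Q1.HalfEdge, HDC.Q1.writhe h = 12) ∧
      (∀ (t : ℂ) (x y z : Matrix.SpecialLinearGroup (Fin 2) ℂ),
        x ∈ HDC.Gset t → y ∈ HDC.Gset t → z ∈ HDC.Gset t →
        HDC.tr (x * y) = 1 → HDC.tr (x * z) = 1 →
        ∃! ρ : HDC.Q1.linkGroup →* Matrix.SpecialLinearGroup (Fin 2) ℂ,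
          HDC.Q1.HasValues ρ x y z) ∧
      (∀ (ρ : HDC.Q1.linkGroup →* Matrix.SpecialLinearGroup (Fin 2) ℂ)
        (x y z : Matrix.SpecialLinearGroup (Fin 2) ℂ),
        HDC.Q1.HasValues ρ x y z → HDC.tr (x * y) = 1 → HDC.tr (x * z) = 1 →
        ∀ h : HDC.Q1.HalfEdge, ρ (HDC.Q1.longitude h) = ρ (HDC.Q1.arc h) ^ 24) ∧
      ∃ C : Set (HDC.Aff HDC.Q1.linkGroup),
        HDC.IsHighDimComponent C (HDC.charVariety HDC.Q1.linkGroup) ∧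
        HDC.IsHighDimComponent (C ∩ HDC.irrCharVariety HDC.Q1.linkGroup)
          (HDC.irrCharVariety HDC.Q1.linkGroup) ∧
        C ∩ HDC.irrCharVariety HDC.Q1.linkGroup = HDC.Q1.family ∧
        HDC.IsIsomorphismOn HDC.Q1.coords C HDC.Q1.surface ∧
        HDC.IsIsomorphismOn HDC.Q1.coords (C ∩ HDC.irrCharVariety HDC.Q1.linkGroup)
          (HDC.Q1.surface \ HDC.Q1.badPoints) ∧
        ∀ ρ : HDC.Q1.linkGroup →* Matrix.SpecialLinearGroup (Fin 2) ℂ,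
          HDC.IsIrrep ρ → HDC.character ρ ∈ C →
          ∀ h : HDC.Q1.HalfEdge, ρ (HDC.Q1.longitude h) = ρ (HDC.Q1.arc h) ^ 24) ∧
    -- the knot `Q₂`
    (HDC.Q2.IsKnot ∧ (∀ h : HDC.Q2.HalfEdge, HDC.Q2.writhe h = 6) ∧
      (∀ (t s : ℂ) (x y z : Matrix.SpecialLinearGroup (Fin 2) ℂ),
        x ∈ HDC.Gset t → y ∈ HDC.Gset t → z ∈ HDC.Gset t →
        HDC.tr (x * y) = 1 → HDC.tr (y * z) = 1 →
        HDC.tr (x * z) ∈ HDC.Bset t → s ∈ HDC.Bset t →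
        (s + 2 - t ^ 2) * (s - 1) ^ 2 = HDC.tr (x * z) - t ^ 2 + 2 →
        ∃! ρ : HDC.Q2.linkGroup →* Matrix.SpecialLinearGroup (Fin 2) ℂ,
          ∃ v, HDC.Q2.HasValues ρ x y z v ∧ HDC.tr (z * v) = s) ∧
      ∃ C : Set (HDC.Aff HDC.Q2.linkGroup),
        HDC.IsHighDimComponent C (HDC.irrCharVariety HDC.Q2.linkGroup) ∧
        HDC.IsZariskiOpenIn HDC.Q2.family C ∧
        HDC.IsIsomorphismOn HDC.Q2.coords HDC.Q2.family HDC.Q2.surface ∧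
        ∀ ρ : HDC.Q2.linkGroup →* Matrix.SpecialLinearGroup (Fin 2) ℂ,
          HDC.IsIrrep ρ → HDC.character ρ ∈ C →
          ∀ h : HDC.Q2.HalfEdge, ρ (HDC.Q2.longitude h) = ρ (HDC.Q2.arc h) ^ 12) := by
  refine ⟨⟨HDC.Q1.isKnot, HDC.Q1.writhe_eq, ?_, ?_, HDC.Q1.tripleChars,
    HDC.Q1.isHighDimComponent_tripleChars, HDC.Q1.isHighDimComponent_tripleChars_inter,
    HDC.Q1.tripleChars_inter_eq_family, HDC.Q1.isIsomorphismOn_coords,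
    HDC.Q1.isIsomorphismOn_coords_irr, fun ρ hρ h => HDC.Q1.longitude_of_character_mem hρ h⟩,
    HDC.Q2.isKnot, HDC.Q2.writhe_eq, ?_, HDC.Q2.familyClosure,
    HDC.Q2.isHighDimComponent_familyClosure, HDC.Q2.isZariskiOpenIn_family,
    HDC.Q2.isIsomorphismOn_coords, fun ρ hρ h => HDC.Q2.longitude_of_character_mem hρ h⟩
  · exact fun t x y z hx hy hz => HDC.Q1.existsUnique_hasValues hx hy hz
  · exact fun ρ x y z h hxy hxz => h.longitude hxy hxz
  · exact fun t s x y z hx hy hz hxy hyz hu _ hs =>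
      HDC.Q2.existsUnique_hasValues hx hy hz hxy hyz hu hs
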